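/- **Bidiagonal block form.** For $\theta\in[0,\frac\pi2]^n$, $\phi\in[0,\frac\pi2]^{n-1}$ put $c_i=\cos\theta_i$, $s_i=\sin\theta_i$, $c'_i=\cos\phi_i$, $s'_i=\sin\phi_i$, and $c'_0=c'_n=1$. Let $B(\theta,\phi)=\left[\begin{smallmatrix}B_{11}&B_{12}\\B_{21}&B_{22}\end{smallmatrix}\right]$ with $n\times n$ blocks whose only possibly nonzero entries are $$B_{11}(i,i)=c_ic'_{i-1},\quad B_{11}(i,i+1)=-s_is'_i,\quad B_{12}(i,i)=s_ic'_i,\quad B_{12}(i+1,i)=c_{i+1}s'_i,$$ $$B_{21}(i,i)=-s_ic'_{i-1},\quad B_{21}(i,i+1)=-c_is'_i,\quad B_{22}(i,i)=c_ic'_i,\quad B_{22}(i+1,i)=-s_{i+1}s'_i.$$ A matrix $B(\theta,\phi)$ is said to be in bidiagonal block form. **Preferred QR factorization.** Let $A$ be real symmetric tridiagonal, $A=A_1\oplus\dots\oplus A_r$ with each $A_i$ unreduced (no zero on the subdiagonal) or 1-by-1. Write $A_i=Q_iR_i$ with $R_i$ upper triangular and $Q_i$ orthogonal, upper Hessenberg,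 with positive subdiagonal and determinant one. If $A$ is invertible, the preferred QR factorization is $A=(Q_1\oplus\dots\oplus Q_r)(R_1\oplus\dots\oplus R_r)$. If not, let $A_k$ be the first singular block, $l$ its last index in $A$, and $P=\left[\begin{smallmatrix}I_{l-1}&0&0\\0&0&\pm1\\0&I&0\end{smallmatrix}\right]$ with $\det P=1$; then it is $A=QR$ with $Q=(Q_1\oplus\dots\oplus Q_k\oplus I)P$ and $R=P^T(R_1\oplus\dots\oplus R_k\oplus A_{k+1}\oplus\dots\oplus A_r)$. **SVD step, CSD step.** For $B$ upper or lower bidiagonal and $\sigma\ge0$, $B\mapsto S^TBT$ is an SVD step with shift $\sigma$ if $BB^T-\sigma^2I=SL^T$ and $B^TB-\sigma^2I=TR$ are preferred QR factorizations. For $\left[\begin{smallmatrix}B_{11}&B_{12}\\B_{21}&B_{22}\end{smallmatrix}\right]$ in bidiagonal block form and $\mu,\nu\ge0$ with $\mu^2+\nu^2=1$, the equation $$\begin{bmatrix}\bar B_{11}&\bar B_{12}\\\bar B_{21}&\bar B_{22}\end{bmatrix}=\begin{bmatrix}D_1\\&D_2\end{bmatrix}\begin{bmatrix}S_1\\&S_2\end{bmatrix}^T\begin{bmatrix}B_{11}&B_{12}\\B_{21}&B_{22}\end{bmatrix}\begin{bmatrix}T_1\\&T_2\end{bmatrix}\begin{bmatrix}E_1\\&E_2\end{bmatrix}$$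 effects a CSD step if $B_{ij}\mapsto S_i^TB_{ij}T_j$ is an SVD step with shift $\mu$ for $i=j$ and with shift $\nu$ for $i\ne j$, if $D_1,D_2,E_1,E_2$ are diagonal with diagonal entries $\pm1$, and if the left-hand side is in bidiagonal block form. **Subroutines.** $\mathbf{givens}(i,x)$ rotates in the coordinates $i,i+1$ by $G=\left[\begin{smallmatrix}c&-s\\s&c\end{smallmatrix}\right]$ with angle in $[0,\pi)$ and $G^Tx=(\pm\|x\|,0)^T$; for $x=0$ the angle is $\frac\pi2$. $\mathbf{bulge\_start}(x,\sigma)$ is any routine that returns a nonzero multiple of $(x_1^2-\sigma^2,x_1x_2)^T$ (so zero if this vector is zero). $\mathbf{merge}(x,y)$ is any routine that, for two vectors in a one-dimensional subspace, returns a vector of that subspace, which is zero only if $x=y=0$. **Algorithm svd_step** on an $n\times n$ upper bidiagonal $B$ with shift $\sigma$. For $i=1,\dots,n-1$: let $v=B(i-1,i:i+1)^T$ if $i>1$ and this is nonzero, and $v=\mathbf{bulge\_start}(B(i,i:i+1)^T,\sigma)$ otherwise; $T_i:=\mathbf{givens}(i,v)$, $B:=BT_i$; then let $u=B(i:i+1,i)$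 if this is nonzero and $u=\mathbf{bulge\_start}(B(i:i+1,i+1),\sigma)$ otherwise; $S_i:=\mathbf{givens}(i,u)$, $B:=S_i^TB$. A lower bidiagonal matrix is transposed, which exchanges left and right. **Algorithm csd_step.** *Input:* $\theta\in[0,\frac\pi2]^q$, $\phi\in[0,\frac\pi2]^{q-1}$; integers $1\le\underline i<\overline i\le q$ such that in each block $B_{jk}$ of $B(\theta,\phi)$ the rows and columns $\underline i,\dots,\overline i$ are decoupled from the others (all entries with exactly one index in this range vanish); shifts $0\le\mu,\nu\le1$ with $\mu^2+\nu^2=1$. Let $n=\overline i-\underline i+1$ and let the $n\times n$ matrices $\bar B_{jk}=B_{jk}(\underline i:\overline i,\underline i:\overline i)$ be the active blocks. With shift $\mu$ for $\bar B_{11},\bar B_{22}$ and $\nu$ for $\bar B_{12},\bar B_{21}$, let $v_{jk}$ and $u_{jk}$ be the vectors from which svd_step would build its next right and left rotation, respectively, of the current $\bar B_{jk}$. Set $v_1=\mathbf{merge}(v_{11},v_{21})$, $v_2=\mathbf{merge}(v_{12},v_{22})$, $u_1=\mathbf{merge}(u_{11},u_{12})$, $u_2=\mathbf{merge}(u_{21},u_{22})$;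 the corresponding Givens rotations are applied to the columns of the left blocks, the columns of the right blocks, the rows of the top blocks, and the rows of the bottom blocks. The order is: $v_1$ in columns $1,2$; $u_1,u_2$ in rows $1,2$; for $i=2,\dots,n-1$: $v_1$ in columns $i,i+1$, $v_2$ in columns $i-1,i$, $u_1,u_2$ in rows $i,i+1$; finally $v_2$ in columns $n-1,n$. At the end rows and columns are multiplied by signs, and the angles are computed, as in the reduction of the resulting matrix to bidiagonal block form (in which each Householder reflector is now just a sign). *Output:* the new angles $\theta^+,\phi^+$ (unchanged outside the active range), and $U_1,U_2,V_1,V_2$, the products of the rotations and of the signs, extended by the identity outside the active range. **Theorem.** In exact arithmetic, for every such input: 1. $\theta^+\in[0,\frac\pi2]^q$, $\phi^+\in[0,\frac\pi2]^{q-1}$, and $U_1,U_2,V_1,V_2$ are real orthogonal $q\times q$ matrices with $$B(\theta^+,\phi^+)=\begin{bmatrix}U_1\\&U_2\end{bmatrix}^*B(\theta,\phi)\begin{bmatrix}V_1\\&V_2\end{bmatrix}.$$ 2. The active blocks of $B(\theta^+,\phi^+)$ result from those of $B(\theta,\phi)$ by a CSD step with shifts $\mu,\nu$, with $U_j=I\oplus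 S_jD_j\oplus I$ and $V_j=I\oplus T_jE_j\oplus I$, and all other entries of the four blocks are unchanged. 3. The merged Givens rotations are well defined: the two arguments of every call of $\mathbf{merge}$ lie in a common subspace of dimension at most one, and the first argument, the second argument and the merged vector determine the same Givens rotation. The rotations obtained are exactly those of svd_step run separately on the active blocks: the $v_1$-rotations are the right rotations for $\bar B_{11}$ and for $\bar B_{21}$, the $v_2$-rotations the right rotations for $\bar B_{12}$ and for $\bar B_{22}$, the $u_1$-rotations the left rotations for $\bar B_{11}$ and for $\bar B_{12}$, and the $u_2$-rotations the left rotations for $\bar B_{21}$ and for $\bar B_{22}$. -/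

import Mathlib

noncomputable section

namespace CSD

/-- The four square blocks of a matrix partitioned as `[b11 b12; b21 b22]`. -/
structure Blocks (n : ℕ) where
  b11 : Matrix (Fin n) (Fin n) ℝ
  b12 : Matrix (Fin n) (Fin n) ℝ
  b21 : Matrix (Fin n) (Fin n) ℝ
  b22 : Matrix (Fin n) (Fin n) ℝ

/-- The partitioned matrix itself. -/
def Blocks.toMatrix {n : ℕ} (B : Blocks n) : Matrix (Fin n ⊕ Fin n) (Fin n ⊕ Fin n) ℝ :=
  Matrix.fromBlocks B.b11 B.b12 B.b21 B.b22

/-- The entry in row `i` and column `j` (counted from zero), read as `0` outside the matrix. -/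
def entry {n : ℕ} (M : Matrix (Fin n) (Fin n) ℝ) (i j : ℕ) : ℝ :=
  if h : i < n ∧ j < n then M ⟨i, h.1⟩ ⟨j, h.2⟩ else 0

/-! ### Bidiagonal block form -/

/-- `φ` extended by the angle `0` beyond its last index. -/
def extAngle {n : ℕ} (φ : Fin (n - 1) → ℝ) (k : ℕ) : ℝ :=
  if h : k < n - 1 then φ ⟨k, h⟩ else 0

/-- The cosine `c'` of the angle `φ` preceding index `i`, read as `1` for the first index. -/
def prevCos {n : ℕ} (φ : Fin (n - 1) → ℝ) (i : ℕ) : ℝ :=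
  if i = 0 then 1 else Real.cos (extAngle φ (i - 1))

/-- The matrix in bidiagonal block form determined by `θ` and `φ`. -/
def bidiagonalBlocks {n : ℕ} (θ : Fin n → ℝ) (φ : Fin (n - 1) → ℝ) : Blocks n where
  b11 := Matrix.of fun i j =>
    if j = i then Real.cos (θ i) * prevCos φ i
    else if (j : ℕ) = i + 1 then -(Real.sin (θ i) * Real.sin (extAngle φ i)) else 0
  b12 := Matrix.of fun i j =>
    if j = i then Real.sin (θ i) * Real.cos (extAngle φ i)
    else if (i : ℕ) = j + 1 then Real.cos (θ i) * Real.sin (extAngle φ j) else 0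
  b21 := Matrix.of fun i j =>
    if j = i then -(Real.sin (θ i) * prevCos φ i)
    else if (j : ℕ) = i + 1 then -(Real.cos (θ i) * Real.sin (extAngle φ i)) else 0
  b22 := Matrix.of fun i j =>
    if j = i then Real.cos (θ i) * Real.cos (extAngle φ i)
    else if (i : ℕ) = j + 1 then -(Real.sin (θ i) * Real.sin (extAngle φ j)) else 0

/-- All the angles lie in `[0, π/2]`. -/
def AnglesInRange {n : ℕ} (θ : Fin n → ℝ) (φ : Fin (n - 1) → ℝ) : Prop :=
  (∀ i, θ i ∈ Set.Icc 0 (Real.pi / 2)) ∧ ∀ i, φ i ∈ Set.Icc 0 (Real.pi / 2)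

def IsBidiagonalBlockForm {n : ℕ} (B : Blocks n) : Prop :=
  ∃ (θ : Fin n → ℝ) (φ : Fin (n - 1) → ℝ), AnglesInRange θ φ ∧ B = bidiagonalBlocks θ φ

def IsUpperBidiagonal {n : ℕ} (B : Matrix (Fin n) (Fin n) ℝ) : Prop :=
  ∀ i j : Fin n, B i j ≠ 0 → (j : ℕ) = i ∨ (j : ℕ) = i + 1

def IsLowerBidiagonal {n : ℕ} (B : Matrix (Fin n) (Fin n) ℝ) : Prop :=
  IsUpperBidiagonal B.transpose

/-! ### Preferred QR factorizations -/

def IsSymmTridiagonal {n : ℕ} (A : Matrix (Fin n) (Fin n) ℝ) : Prop :=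
  A.IsSymm ∧ ∀ i j : Fin n, (i : ℕ) + 1 < j → A i j = 0

/-- Indices `i` and `j` belong to the same diagonal block in the decomposition of the
tridiagonal matrix `A` into unreduced (possibly 1-by-1) blocks: no subdiagonal entry between
them vanishes. -/
def SameBlock {n : ℕ} (A : Matrix (Fin n) (Fin n) ℝ) (i j : Fin n) : Prop :=
  ∀ a b : Fin n, (b : ℕ) = a + 1 → min i j ≤ a → b ≤ max i j → A b a ≠ 0

open Classical in
/-- The determinant of the part of `M` in the rows and columns of the diagonal block of `A`
that contains the index `j`. -/
def blockDet {n : ℕ} (A M : Matrix (Fin n) (Fin n) ℝ) (j : Fin n) : ℝ :=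
  (M.toSquareBlockProp (fun i => SameBlock A j i)).det

/-- `A = (Q₁ ⊕ ⋯ ⊕ Qᵣ)(R₁ ⊕ ⋯ ⊕ Rᵣ)`, the sums being partitioned like the unreduced diagonal
blocks of `A`, where each `Qᵢ` is orthogonal and upper Hessenberg with positive subdiagonal and
determinant one (hence equal to `1` if it is 1-by-1), and each `Rᵢ` is upper triangular. -/
structure IsBlockQR {n : ℕ} (A Q R : Matrix (Fin n) (Fin n) ℝ) : Prop where
  eq_mul : A = Q * R
  orthogonal : Q ∈ Matrix.orthogonalGroup (Fin n) ℝ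
  block_diag : ∀ i j, ¬ SameBlock A i j → Q i j = 0 ∧ R i j = 0
  hessenberg : ∀ i j : Fin n, (j : ℕ) + 1 < i → Q i j = 0
  subdiag_pos : ∀ i j : Fin n, (i : ℕ) = j + 1 → SameBlock A i j → 0 < Q i j
  det_one : ∀ j, blockDet A Q j = 1
  upper : ∀ i j, j < i → R i j = 0

/-- `l` is the last index of the first singular diagonal block of `A`. -/
def IsFirstSingularEnd {n : ℕ} (A : Matrix (Fin n) (Fin n) ℝ) (l : Fin n) : Prop :=
  (∀ j, SameBlock A l j → j ≤ l) ∧ blockDet A A l = 0 ∧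
    ∀ i, i < l → ¬ SameBlock A l i → blockDet A A i ≠ 0

/-- The matrix `[I 0 0; 0 0 ε; 0 I 0]`, whose middle row is row `l`. -/
def slideMatrix {n : ℕ} (l : Fin n) (ε : ℝ) : Matrix (Fin n) (Fin n) ℝ :=
  Matrix.of fun i j =>
    if i < l then (if j = i then 1 else 0)
    else if i = l then (if (j : ℕ) + 1 = n then ε else 0)
    else (if (i : ℕ) = j + 1 then 1 else 0)

/-- The factorization `A = QR` is a preferred QR factorization of the real symmetric
tridiagonal matrix `A`. In the singular case the columns of `Q₁ ⊕ ⋯ ⊕ Qᵣ` and the rows of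
`R₁ ⊕ ⋯ ⊕ Rᵣ` after index `l` are replaced by those of `I` and of `A`, respectively, and then
row `l` of the right factor is moved to the bottom. -/
def IsPreferredQR {n : ℕ} (A Q R : Matrix (Fin n) (Fin n) ℝ) : Prop :=
  IsSymmTridiagonal A ∧
    ((A.det ≠ 0 ∧ IsBlockQR A Q R) ∨
      (A.det = 0 ∧ ∃ (Q₀ R₀ : Matrix (Fin n) (Fin n) ℝ) (l : Fin n) (ε : ℝ),
        IsBlockQR A Q₀ R₀ ∧ IsFirstSingularEnd A l ∧ (ε = 1 ∨ ε = -1) ∧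
        (slideMatrix l ε).det = 1 ∧
        Q = (Matrix.of fun i j =>
          if j ≤ l then Q₀ i j else (1 : Matrix (Fin n) (Fin n) ℝ) i j) * slideMatrix l ε ∧
        R = (slideMatrix l ε).transpose *
          (Matrix.of fun i j => if i ≤ l then R₀ i j else A i j)))

/-! ### SVD steps and CSD steps -/

/-- `B'`, `S`, `T` are obtained from `B` by an SVD step with shift `σ`. -/
def IsSVDStep {n : ℕ} (σ : ℝ) (B B' S T : Matrix (Fin n) (Fin n) ℝ) : Prop :=
  0 ≤ σ ∧ (IsUpperBidiagonal B ∨ IsLowerBidiagonal B) ∧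
    (∃ L : Matrix (Fin n) (Fin n) ℝ,
      IsPreferredQR (B * B.transpose - σ ^ 2 • (1 : Matrix (Fin n) (Fin n) ℝ)) S L.transpose) ∧
    (∃ R : Matrix (Fin n) (Fin n) ℝ,
      IsPreferredQR (B.transpose * B - σ ^ 2 • (1 : Matrix (Fin n) (Fin n) ℝ)) T R) ∧
    B' = S.transpose * B * T

/-- Diagonal signature matrices. -/
def IsSignature {n : ℕ} (D : Matrix (Fin n) (Fin n) ℝ) : Prop :=
  ∃ d : Fin n → ℝ, (∀ i, d i = 1 ∨ d i = -1) ∧ D = Matrix.diagonal d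

/-- `B'` results from `B` by a CSD step with shifts `μ`, `ν`, effected by the outer factors
`S₁`, `S₂`, `T₁`, `T₂` and the diagonal signature matrices `D₁`, `D₂`, `E₁`, `E₂`. -/
structure IsCSDStep {n : ℕ} (μ ν : ℝ) (B B' : Blocks n)
    (S₁ S₂ T₁ T₂ D₁ D₂ E₁ E₂ : Matrix (Fin n) (Fin n) ℝ) : Prop where
  input_form : IsBidiagonalBlockForm B
  shift_left : 0 ≤ μ
  shift_right : 0 ≤ ν
  shifts : μ ^ 2 + ν ^ 2 = 1
  equation : B'.toMatrix =
    Matrix.fromBlocks D₁ 0 0 D₂ * (Matrix.fromBlocks S₁ 0 0 S₂).transpose * B.toMatrix *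
      Matrix.fromBlocks T₁ 0 0 T₂ * Matrix.fromBlocks E₁ 0 0 E₂
  svd11 : IsSVDStep μ B.b11 (S₁.transpose * B.b11 * T₁) S₁ T₁
  svd22 : IsSVDStep μ B.b22 (S₂.transpose * B.b22 * T₂) S₂ T₂
  svd12 : IsSVDStep ν B.b12 (S₁.transpose * B.b12 * T₂) S₁ T₂
  svd21 : IsSVDStep ν B.b21 (S₂.transpose * B.b21 * T₁) S₂ T₁
  signs : IsSignature D₁ ∧ IsSignature D₂ ∧ IsSignature E₁ ∧ IsSignature E₂
  output_form : IsBidiagonalBlockForm B'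

/-! ### The subroutines `givens`, `bulge_start` and `merge` -/

/-- Cosine and sine of the Givens rotation for the vector `x`. The angle lies in `[0, π)`, and the
zero vector is treated like `(0, 1)`. -/
def givensCS (x : ℝ × ℝ) : ℝ × ℝ :=
  if x.2 = 0 then (if x.1 = 0 then (0, 1) else (1, 0))
  else if 0 < x.2 then (x.1 / √(x.1 ^ 2 + x.2 ^ 2), x.2 / √(x.1 ^ 2 + x.2 ^ 2))
  else (-x.1 / √(x.1 ^ 2 + x.2 ^ 2), -x.2 / √(x.1 ^ 2 + x.2 ^ 2))

/-- The rotation `G = [c -s; s c]` has angle in `[0, π)` and `Gᵀ x = (±‖x‖, 0)ᵀ`. -/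
theorem givensCS_spec (x : ℝ × ℝ) :
    (∃ α : ℝ, 0 ≤ α ∧ α < Real.pi ∧ givensCS x = (Real.cos α, Real.sin α)) ∧
      -(givensCS x).2 * x.1 + (givensCS x).1 * x.2 = 0 ∧
      ((givensCS x).1 * x.1 + (givensCS x).2 * x.2) ^ 2 = x.1 ^ 2 + x.2 ^ 2 := by
  have key : ∀ a b : ℝ, 0 < b → ∃ α : ℝ, 0 ≤ α ∧ α < Real.pi ∧
      (a / √(a ^ 2 + b ^ 2), b / √(a ^ 2 + b ^ 2)) = (Real.cos α, Real.sin α) := by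
    intro a b hb
    have hpos : 0 < a ^ 2 + b ^ 2 := by positivity
    have hr : 0 < √(a ^ 2 + b ^ 2) := Real.sqrt_pos.mpr hpos
    have hsq : √(a ^ 2 + b ^ 2) ^ 2 = a ^ 2 + b ^ 2 := Real.sq_sqrt hpos.le
    have hb' : 0 < b / √(a ^ 2 + b ^ 2) := by positivity
    have hone : (a / √(a ^ 2 + b ^ 2)) ^ 2 + (b / √(a ^ 2 + b ^ 2)) ^ 2 = 1 := by
      rw [div_pow, div_pow, hsq]; field_simp
    have h1 : -1 < a / √(a ^ 2 + b ^ 2) := by nlinarith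
    have h2 : a / √(a ^ 2 + b ^ 2) < 1 := by nlinarith
    refine ⟨Real.arccos (a / √(a ^ 2 + b ^ 2)), Real.arccos_nonneg _, ?_, ?_⟩
    · have hle := Real.arccos_le_pi (a / √(a ^ 2 + b ^ 2))
      refine lt_of_le_of_ne hle fun h => ?_
      rw [Real.arccos_eq_pi] at h
      linarith
    · rw [Real.cos_arccos h1.le h2.le, Real.sin_arccos]
      have : 1 - (a / √(a ^ 2 + b ^ 2)) ^ 2 = (b / √(a ^ 2 + b ^ 2)) ^ 2 := by linarith
      rw [this, Real.sqrt_sq hb'.le]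
  obtain ⟨a, b⟩ := x
  rcases lt_trichotomy b 0 with hb | hb | hb
  · have hb0 : b ≠ 0 := hb.ne
    have hpos : 0 < a ^ 2 + b ^ 2 := by positivity
    have hr : √(a ^ 2 + b ^ 2) ≠ 0 := (Real.sqrt_pos.mpr hpos).ne'
    have hsq : √(a ^ 2 + b ^ 2) ^ 2 = a ^ 2 + b ^ 2 := Real.sq_sqrt hpos.le
    have e : givensCS (a, b) = (-a / √(a ^ 2 + b ^ 2), -b / √(a ^ 2 + b ^ 2)) := by
      simp [givensCS, hb0, not_lt.mpr hb.le]
    rw [e]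
    refine ⟨?_, by ring, ?_⟩
    · simpa using key (-a) (-b) (by linarith)
    · dsimp only
      field_simp
      rw [hsq]; ring
  · subst hb
    by_cases ha : a = 0
    · subst ha
      refine ⟨⟨Real.pi / 2, by positivity, by linarith [Real.pi_pos], by simp [givensCS]⟩, ?_, ?_⟩ <;>
        simp [givensCS]
    · refine ⟨⟨0, le_refl 0, Real.pi_pos, by simp [givensCS, ha]⟩, ?_, ?_⟩ <;>
        simp [givensCS, ha]
  · have hb0 : b ≠ 0 := hb.ne'
    have hpos : 0 < a ^ 2 + b ^ 2 := by positivity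
    have hr : √(a ^ 2 + b ^ 2) ≠ 0 := (Real.sqrt_pos.mpr hpos).ne'
    have hsq : √(a ^ 2 + b ^ 2) ^ 2 = a ^ 2 + b ^ 2 := Real.sq_sqrt hpos.le
    have e : givensCS (a, b) = (a / √(a ^ 2 + b ^ 2), b / √(a ^ 2 + b ^ 2)) := by
      simp [givensCS, hb0, hb]
    rw [e]
    refine ⟨key a b hb, by ring, ?_⟩
    dsimp only
    field_simp
    rw [hsq]

/-- The `n`-by-`n` Givens rotation in rows and columns `i`, `i + 1` for the vector `x`. -/
def givens (n i : ℕ) (x : ℝ × ℝ) : Matrix (Fin n) (Fin n) ℝ :=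
  Matrix.of fun a b =>
    if (a : ℕ) = i ∧ (b : ℕ) = i then (givensCS x).1
    else if (a : ℕ) = i ∧ (b : ℕ) = i + 1 then -(givensCS x).2
    else if (a : ℕ) = i + 1 ∧ (b : ℕ) = i then (givensCS x).2
    else if (a : ℕ) = i + 1 ∧ (b : ℕ) = i + 1 then (givensCS x).1
    else if a = b then 1 else 0

/-- `bs` implements `bulge_start`: for a shift `σ ≥ 0` it returns a vector colinear with
`(x₁² - σ², x₁x₂)`, the zero vector exactly when that vector is zero. -/
def IsBulgeStart (bs : ℝ × ℝ → ℝ → ℝ × ℝ) : Prop :=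
  ∀ (x : ℝ × ℝ) (σ : ℝ), 0 ≤ σ → ∃ t : ℝ, t ≠ 0 ∧ bs x σ = t • (x.1 ^ 2 - σ ^ 2, x.1 * x.2)

/-- Both vectors lie in a common subspace of dimension at most one. -/
def Colinear (x y : ℝ × ℝ) : Prop :=
  ∃ w : ℝ × ℝ, x ∈ Submodule.span ℝ {w} ∧ y ∈ Submodule.span ℝ {w}

/-- `mg` implements `merge` in exact arithmetic: given two vectors in any one-dimensional
subspace, it returns a vector in the same subspace, namely the zero vector exactly when both
vectors are zero. Nothing is required for vectors that are not colinear. -/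
def IsMerge (mg : ℝ × ℝ → ℝ × ℝ → ℝ × ℝ) : Prop :=
  ∀ x y w : ℝ × ℝ, x ∈ Submodule.span ℝ {w} → y ∈ Submodule.span ℝ {w} →
    mg x y ∈ Submodule.span ℝ {w} ∧ (mg x y = 0 ↔ x = 0 ∧ y = 0)

/-- The two contracts can be met. -/
theorem isBulgeStart_basic : IsBulgeStart fun x σ => (x.1 ^ 2 - σ ^ 2, x.1 * x.2) :=
  fun _ _ _ => ⟨1, one_ne_zero, (one_smul ℝ _).symm⟩

open Classical in
theorem isMerge_basic : IsMerge fun x y => if x = 0 then y else x := by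
  intro x y w hx hy
  by_cases h : x = 0 <;> simp [h, hx, hy]

/-! ### Algorithm `svd_step` -/

/-- The vector that determines the right rotation in columns `i`, `i + 1` of an upper bidiagonal
matrix with a possible bulge at `(i - 1, i + 1)`. -/
def rightVector {n : ℕ} (bs : ℝ × ℝ → ℝ → ℝ × ℝ) (B : Matrix (Fin n) (Fin n) ℝ) (σ : ℝ)
    (i : ℕ) : ℝ × ℝ :=
  if i = 0 ∨ (entry B (i - 1) i = 0 ∧ entry B (i - 1) (i + 1) = 0) then
    bs (entry B i i, entry B i (i + 1)) σ
  else (entry B (i - 1) i, entry B (i - 1) (i + 1))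

/-- The vector that determines the left rotation in rows `i`, `i + 1` of an upper bidiagonal
matrix with a possible bulge at `(i + 1, i)`. -/
def leftVector {n : ℕ} (bs : ℝ × ℝ → ℝ → ℝ × ℝ) (B : Matrix (Fin n) (Fin n) ℝ) (σ : ℝ)
    (i : ℕ) : ℝ × ℝ :=
  if entry B i i = 0 ∧ entry B (i + 1) i = 0 then
    bs (entry B i (i + 1), entry B (i + 1) (i + 1)) σ
  else (entry B i i, entry B (i + 1) i)

/-- The current matrix and the left and right Givens rotations applied so far. -/
structure SVDState (n : ℕ) where
  B : Matrix (Fin n) (Fin n) ℝ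
  S : List (Matrix (Fin n) (Fin n) ℝ)
  T : List (Matrix (Fin n) (Fin n) ℝ)

def svdBody {n : ℕ} (bs : ℝ × ℝ → ℝ → ℝ × ℝ) (σ : ℝ) (i : ℕ) (s : SVDState n) : SVDState n :=
  let G := givens n i (rightVector bs s.B σ i)
  let B₁ := s.B * G
  let H := givens n i (leftVector bs B₁ σ i)
  ⟨H.transpose * B₁, s.S ++ [H], s.T ++ [G]⟩

def svdRun {n : ℕ} (bs : ℝ × ℝ → ℝ → ℝ × ℝ) (σ : ℝ) (B : Matrix (Fin n) (Fin n) ℝ) :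
    ℕ → SVDState n
  | 0 => ⟨B, [], []⟩
  | i + 1 => svdBody bs σ i (svdRun bs σ B i)

/-- Algorithm `svd_step` on an upper bidiagonal matrix. A lower bidiagonal matrix is handled by
transposing it, which exchanges left and right rotations. -/
def svdStep {n : ℕ} (bs : ℝ × ℝ → ℝ → ℝ × ℝ) (σ : ℝ) (B : Matrix (Fin n) (Fin n) ℝ) :
    SVDState n :=
  svdRun bs σ B (n - 1)

/-! ### Algorithm `csd_step` on the active block -/

/-- Record of one call of `merge`: the pair `idx`, `idx + 1` of rows or columns to be rotated, the
two arguments and the value. -/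
structure MergeCall where
  idx : ℕ
  first : ℝ × ℝ
  second : ℝ × ℝ
  merged : ℝ × ℝ

/-- The current blocks, the accumulated outer factors and the record of the calls of `merge` that
define each of these factors. -/
structure CSDState (n : ℕ) where
  B : Blocks n
  U1 : Matrix (Fin n) (Fin n) ℝ
  U2 : Matrix (Fin n) (Fin n) ℝ
  V1 : Matrix (Fin n) (Fin n) ℝ
  V2 : Matrix (Fin n) (Fin n) ℝ
  callsU1 : List MergeCall
  callsU2 : List MergeCall
  callsV1 : List MergeCall
  callsV2 : List MergeCall

/-- Merge `x` and `y` and rotate columns `i`, `i + 1` of the left blocks. -/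
def rotateV1 {n : ℕ} (mg : ℝ × ℝ → ℝ × ℝ → ℝ × ℝ) (i : ℕ) (x y : ℝ × ℝ) (s : CSDState n) :
    CSDState n :=
  let G := givens n i (mg x y)
  { s with
    B := { s.B with b11 := s.B.b11 * G, b21 := s.B.b21 * G }
    V1 := s.V1 * G
    callsV1 := s.callsV1 ++ [⟨i, x, y, mg x y⟩] }

/-- Merge `x` and `y` and rotate columns `i`, `i + 1` of the right blocks. -/
def rotateV2 {n : ℕ} (mg : ℝ × ℝ → ℝ × ℝ → ℝ × ℝ) (i : ℕ) (x y : ℝ × ℝ) (s : CSDState n) :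
    CSDState n :=
  let G := givens n i (mg x y)
  { s with
    B := { s.B with b12 := s.B.b12 * G, b22 := s.B.b22 * G }
    V2 := s.V2 * G
    callsV2 := s.callsV2 ++ [⟨i, x, y, mg x y⟩] }

/-- Merge `x` and `y` and rotate rows `i`, `i + 1` of the top blocks. -/
def rotateU1 {n : ℕ} (mg : ℝ × ℝ → ℝ × ℝ → ℝ × ℝ) (i : ℕ) (x y : ℝ × ℝ) (s : CSDState n) :
    CSDState n :=
  let G := givens n i (mg x y)
  { s with
    B := { s.B with b11 := G.transpose * s.B.b11, b12 := G.transpose * s.B.b12 }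
    U1 := s.U1 * G
    callsU1 := s.callsU1 ++ [⟨i, x, y, mg x y⟩] }

/-- Merge `x` and `y` and rotate rows `i`, `i + 1` of the bottom blocks. -/
def rotateU2 {n : ℕ} (mg : ℝ × ℝ → ℝ × ℝ → ℝ × ℝ) (i : ℕ) (x y : ℝ × ℝ) (s : CSDState n) :
    CSDState n :=
  let G := givens n i (mg x y)
  { s with
    B := { s.B with b21 := G.transpose * s.B.b21, b22 := G.transpose * s.B.b22 }
    U2 := s.U2 * G
    callsU2 := s.callsU2 ++ [⟨i, x, y, mg x y⟩] }

/-- `v₁ := merge(v₁₁, v₂₁)` and the rotation of columns `i`, `i + 1` of the left blocks. -/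
def stepV1 {n : ℕ} (bs : ℝ × ℝ → ℝ → ℝ × ℝ) (mg : ℝ × ℝ → ℝ × ℝ → ℝ × ℝ) (μ ν : ℝ) (i : ℕ)
    (s : CSDState n) : CSDState n :=
  rotateV1 mg i (rightVector bs s.B.b11 μ i) (rightVector bs s.B.b21 ν i) s

/-- `v₂ := merge(v₁₂, v₂₂)` and the rotation of columns `i`, `i + 1` of the right blocks. -/
def stepV2 {n : ℕ} (bs : ℝ × ℝ → ℝ → ℝ × ℝ) (mg : ℝ × ℝ → ℝ × ℝ → ℝ × ℝ) (μ ν : ℝ) (i : ℕ)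
    (s : CSDState n) : CSDState n :=
  rotateV2 mg i (leftVector bs s.B.b12.transpose ν i) (leftVector bs s.B.b22.transpose μ i) s

/-- `u₁ := merge(u₁₁, u₁₂)`, `u₂ := merge(u₂₁, u₂₂)` and the rotations of rows `i`, `i + 1` of the
top and of the bottom blocks. -/
def stepU {n : ℕ} (bs : ℝ × ℝ → ℝ → ℝ × ℝ) (mg : ℝ × ℝ → ℝ × ℝ → ℝ × ℝ) (μ ν : ℝ) (i : ℕ)
    (s : CSDState n) : CSDState n :=
  rotateU2 mg i (leftVector bs s.B.b21 ν i) (rightVector bs s.B.b22.transpose μ i)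
    (rotateU1 mg i (leftVector bs s.B.b11 μ i) (rightVector bs s.B.b12.transpose ν i) s)

/-- Introduce the bulges, then chase them for `k` rounds. -/
def csdRun {n : ℕ} (bs : ℝ × ℝ → ℝ → ℝ × ℝ) (mg : ℝ × ℝ → ℝ × ℝ → ℝ × ℝ) (μ ν : ℝ)
    (B : Blocks n) : ℕ → CSDState n
  | 0 => stepU bs mg μ ν 0 (stepV1 bs mg μ ν 0 ⟨B, 1, 1, 1, 1, [], [], [], []⟩)
  | k + 1 => stepU bs mg μ ν (k + 1) (stepV2 bs mg μ ν k
      (stepV1 bs mg μ ν (k + 1) (csdRun bs mg μ ν B k)))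

/-- The simultaneous SVD steps (`n ≥ 2`), before the signs are fixed. -/
def csdCore {n : ℕ} (bs : ℝ × ℝ → ℝ → ℝ × ℝ) (mg : ℝ × ℝ → ℝ × ℝ → ℝ × ℝ) (μ ν : ℝ)
    (B : Blocks n) : CSDState n :=
  stepV2 bs mg μ ν (n - 2) (csdRun bs mg μ ν B (n - 2))

/-! ### Fixing the signs and computing the angles -/

/-- The sign of a real number, `1` for zero. -/
def sgn (x : ℝ) : ℝ := if x < 0 then -1 else 1

def atan2 (y x : ℝ) : ℝ := Complex.arg ⟨x, y⟩

/-- What is found in round `i`: the angles `θ i` and `φ i`, the signs `d1`, `d2` of row `i` of the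
top and bottom blocks, the sign `e1` of column `i + 1` of the left blocks and the sign `e2` of
column `i` of the right blocks. -/
structure SignRound where
  θ : ℝ
  φ : ℝ
  d1 : ℝ
  d2 : ℝ
  e1 : ℝ
  e2 : ℝ

/-- Round `i` of Algorithm `bidiagonalize` on a matrix whose blocks are already bidiagonal, so
that each Householder reflector is a sign change. `φ`, `e1`, `e2` come from the previous round. -/
def signRound {n : ℕ} (Y : Blocks n) (i : ℕ) (φ e1 e2 : ℝ) : SignRound :=
  let u1 := Real.cos φ * (entry Y.b11 i i * e1) + Real.sin φ * (entry Y.b12 i (i - 1) * e2)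
  let u2 := -(Real.cos φ * (entry Y.b21 i i * e1)) - Real.sin φ * (entry Y.b22 i (i - 1) * e2)
  let d1 := sgn u1
  let d2 := sgn u2
  let θ := atan2 |u2| |u1|
  let v1 := -(Real.sin θ * (d1 * entry Y.b11 i (i + 1))) -
    Real.cos θ * (d2 * entry Y.b21 i (i + 1))
  let v2 := Real.sin θ * (d1 * entry Y.b12 i i) + Real.cos θ * (d2 * entry Y.b22 i i)
  ⟨θ, atan2 |v1| |v2|, d1, d2, sgn v1, sgn v2⟩

def signRun {n : ℕ} (Y : Blocks n) : ℕ → SignRound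
  | 0 => signRound Y 0 0 1 1
  | i + 1 =>
    let r := signRun Y i
    signRound Y (i + 1) r.φ r.e1 r.e2

def signD1 {n : ℕ} (Y : Blocks n) : Matrix (Fin n) (Fin n) ℝ :=
  Matrix.diagonal fun i => (signRun Y i).d1

def signD2 {n : ℕ} (Y : Blocks n) : Matrix (Fin n) (Fin n) ℝ :=
  Matrix.diagonal fun i => (signRun Y i).d2

def signE1 {n : ℕ} (Y : Blocks n) : Matrix (Fin n) (Fin n) ℝ :=
  Matrix.diagonal fun i => if (i : ℕ) = 0 then 1 else (signRun Y (i - 1)).e1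

def signE2 {n : ℕ} (Y : Blocks n) : Matrix (Fin n) (Fin n) ℝ :=
  Matrix.diagonal fun i => (signRun Y i).e2

/-! ### Algorithm `csd_step` on a partially deflated matrix -/

/-- The number of indices in the active range `lo, …, hi`. -/
abbrev activeSize {q : ℕ} (lo hi : Fin q) : ℕ := hi - lo + 1

/-- The submatrix `M(lo:hi, lo:hi)`. -/
def activePart {q : ℕ} (lo hi : Fin q) (M : Matrix (Fin q) (Fin q) ℝ) :
    Matrix (Fin (activeSize lo hi)) (Fin (activeSize lo hi)) ℝ :=
  Matrix.of fun a b => entry M (lo + a) (lo + b)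

def activeBlocks {q : ℕ} (lo hi : Fin q) (B : Blocks q) : Blocks (activeSize lo hi) :=
  ⟨activePart lo hi B.b11, activePart lo hi B.b12, activePart lo hi B.b21, activePart lo hi B.b22⟩

/-- `I ⊕ M ⊕ I` with `M` in rows and columns `lo, …, hi`. -/
def embed {q : ℕ} (lo hi : Fin q)
    (M : Matrix (Fin (activeSize lo hi)) (Fin (activeSize lo hi)) ℝ) :
    Matrix (Fin q) (Fin q) ℝ :=
  Matrix.of fun i j =>
    if i ∈ Set.Icc lo hi ∧ j ∈ Set.Icc lo hi then entry M (i - lo) (j - lo)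
    else (1 : Matrix (Fin q) (Fin q) ℝ) i j

/-- Rows and columns `lo, …, hi` of `M` are decoupled from the other rows and columns. -/
def Decoupled {q : ℕ} (lo hi : Fin q) (M : Matrix (Fin q) (Fin q) ℝ) : Prop :=
  ∀ i j, ¬ (i ∈ Set.Icc lo hi ↔ j ∈ Set.Icc lo hi) → M i j = 0

/-- All four blocks split off their submatrices in rows and columns `lo, …, hi`. -/
def IsDeflatedAt {q : ℕ} (lo hi : Fin q) (B : Blocks q) : Prop :=
  Decoupled lo hi B.b11 ∧ Decoupled lo hi B.b12 ∧ Decoupled lo hi B.b21 ∧ Decoupled lo hi B.b22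

structure CSDOutput (q : ℕ) where
  θ : Fin q → ℝ
  φ : Fin (q - 1) → ℝ
  U1 : Matrix (Fin q) (Fin q) ℝ
  U2 : Matrix (Fin q) (Fin q) ℝ
  V1 : Matrix (Fin q) (Fin q) ℝ
  V2 : Matrix (Fin q) (Fin q) ℝ

/-- Algorithm `csd_step`: the simultaneous SVD steps on the active block, followed by the fixing of
signs and the computation of the new angles. -/
def csdStep {q : ℕ} (bs : ℝ × ℝ → ℝ → ℝ × ℝ) (mg : ℝ × ℝ → ℝ × ℝ → ℝ × ℝ)
    (θ : Fin q → ℝ) (φ : Fin (q - 1) → ℝ) (lo hi : Fin q) (μ ν : ℝ) : CSDOutput q :=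
  let s := csdCore bs mg μ ν (activeBlocks lo hi (bidiagonalBlocks θ φ))
  { θ := fun i => if i ∈ Set.Icc lo hi then (signRun s.B (i - lo)).θ else θ i
    φ := fun j => if (lo : ℕ) ≤ j ∧ (j : ℕ) < hi then (signRun s.B (j - lo)).φ else φ j
    U1 := embed lo hi (s.U1 * signD1 s.B)
    U2 := embed lo hi (s.U2 * signD2 s.B)
    V1 := embed lo hi (s.V1 * signE1 s.B)
    V2 := embed lo hi (s.V2 * signE2 s.B) }

/-! ### The specification -/

/-- Outside the active rows and columns, `M'` agrees with `M`. -/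
def AgreeOutside {q : ℕ} (lo hi : Fin q) (M M' : Matrix (Fin q) (Fin q) ℝ) : Prop :=
  ∀ i j, ¬ (i ∈ Set.Icc lo hi ∧ j ∈ Set.Icc lo hi) → M' i j = M i j

/-- The output required of `csd_step` on the input `θ`, `φ`, `lo`, `hi`, `μ`, `ν`. -/
structure MeetsSpecification {q : ℕ} (θ : Fin q → ℝ) (φ : Fin (q - 1) → ℝ) (lo hi : Fin q)
    (μ ν : ℝ) (out : CSDOutput q) : Prop where
  angles : AnglesInRange out.θ out.φ
  csd_step : ∃ S₁ S₂ T₁ T₂ D₁ D₂ E₁ E₂ :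
      Matrix (Fin (activeSize lo hi)) (Fin (activeSize lo hi)) ℝ,
    IsCSDStep μ ν (activeBlocks lo hi (bidiagonalBlocks θ φ))
      (activeBlocks lo hi (bidiagonalBlocks out.θ out.φ)) S₁ S₂ T₁ T₂ D₁ D₂ E₁ E₂ ∧
    out.U1 = embed lo hi (S₁ * D₁) ∧ out.U2 = embed lo hi (S₂ * D₂) ∧
    out.V1 = embed lo hi (T₁ * E₁) ∧ out.V2 = embed lo hi (T₂ * E₂)
  outside11 : AgreeOutside lo hi (bidiagonalBlocks θ φ).b11 (bidiagonalBlocks out.θ out.φ).b11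
  outside12 : AgreeOutside lo hi (bidiagonalBlocks θ φ).b12 (bidiagonalBlocks out.θ out.φ).b12
  outside21 : AgreeOutside lo hi (bidiagonalBlocks θ φ).b21 (bidiagonalBlocks out.θ out.φ).b21
  outside22 : AgreeOutside lo hi (bidiagonalBlocks θ φ).b22 (bidiagonalBlocks out.θ out.φ).b22
  orthogonal_U1 : out.U1 ∈ Matrix.orthogonalGroup (Fin q) ℝ
  orthogonal_U2 : out.U2 ∈ Matrix.orthogonalGroup (Fin q) ℝ
  orthogonal_V1 : out.V1 ∈ Matrix.orthogonalGroup (Fin q) ℝ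
  orthogonal_V2 : out.V2 ∈ Matrix.orthogonalGroup (Fin q) ℝ
  equation : (bidiagonalBlocks out.θ out.φ).toMatrix =
    (Matrix.fromBlocks out.U1 0 0 out.U2).transpose * (bidiagonalBlocks θ φ).toMatrix *
      Matrix.fromBlocks out.V1 0 0 out.V2

/-- The calls of `merge` are well defined: both arguments always lie in a common one-dimensional
subspace, and the rotations that the first arguments, the second arguments and the merged vectors
determine are all the same, namely the rotations `R` and `R'` of two SVD steps. -/
def MergesAgree {n : ℕ} (calls : List MergeCall) (R R' : List (Matrix (Fin n) (Fin n) ℝ)) :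
    Prop :=
  (∀ c ∈ calls, Colinear c.first c.second) ∧
    calls.map (fun c => givens n c.idx c.first) = R ∧
    calls.map (fun c => givens n c.idx c.second) = R' ∧
    calls.map (fun c => givens n c.idx c.merged) = R ∧
    R = R'

/-- In the simultaneous SVD steps on `B`, the merged rotations coincide with the rotations that
the separate SVD steps on the four blocks compute. -/
structure MergedRotationsWellDefined {n : ℕ} (bs : ℝ × ℝ → ℝ → ℝ × ℝ)
    (mg : ℝ × ℝ → ℝ × ℝ → ℝ × ℝ) (μ ν : ℝ) (B : Blocks n) : Prop where
  v1 : MergesAgree (csdCore bs mg μ ν B).callsV1 (svdStep bs μ B.b11).T (svdStep bs ν B.b21).T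
  v2 : MergesAgree (csdCore bs mg μ ν B).callsV2
    (svdStep bs ν B.b12.transpose).S (svdStep bs μ B.b22.transpose).S
  u1 : MergesAgree (csdCore bs mg μ ν B).callsU1
    (svdStep bs μ B.b11).S (svdStep bs ν B.b12.transpose).T
  u2 : MergesAgree (csdCore bs mg μ ν B).callsU2
    (svdStep bs ν B.b21).S (svdStep bs μ B.b22.transpose).T

end CSD

end

/-!
Two classical facts about the Givens QR factorization of a symmetric tridiagonal matrix carry the
proof, together with the orthogonality of `B(θ, φ)`.

*The Givens factorization is the preferred one* (`isPreferredQR_tridiag`). Rotating the zero vector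
by `π / 2` only matters at the end of the first singular diagonal block. From there on every vector
to be rotated has first coordinate zero, all rotations are by `π / 2`, and their product is the
signed cyclic permutation `P` of the definition (`exists_rotProd_eq_slide`).

*The implicit step finds the rotations of the explicit one* (`ChaseData.inv`, `svdRun_eq`). A
bidiagonal matrix is a weighted path whose nodes are alternately columns and rows. The square of the
adjacency matrix, minus `σ ^ 2`, splits into `BᵀB - σ²I` on the columns and `BBᵀ - σ²I` on the rows,
so the right and left rotations of an SVD step become one interleaved sequence, and the chase is
described by a single recursion along the path. The invariants `ChaseData.Inv` relate the current
matrix to the pivots of the explicit factorizations. They show that the bulge vector, if it is not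
zero, is colinear with the vector of the explicit factorization (`rot_eq_of_ne_zero`), and that for
a zero bulge vector the restart by `bulge_start` gives the right line (`rot_eq_of_eq_zero`). No
assumption on zeros in the bidiagonal matrix is needed.

Consequently all rotations of the algorithm are determined by the four pairs of shifted Gram
matrices. Orthogonality gives, for instance, `B₁₁ᵀB₁₁ + B₂₁ᵀB₂₁ = I`, and since `μ² + ν² = 1` the
matrices `B₁₁ᵀB₁₁ - μ²I` and `B₂₁ᵀB₂₁ - ν²I` are negatives of each other. A Givens rotation depends
only on the line of its vector, so the two SVD steps have the same right rotations
(`Blocks.IsBidiagonal.sharesRotations`), and both arguments of `merge` lie on that line. By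
induction the simultaneous steps are SVD steps on the four blocks (`csdCore_inv`).

The result is an orthogonal matrix with bidiagonal blocks. Its orthonormality relations, restricted
to neighbouring rows and columns, say that certain pairs of vectors in the plane have a Gram matrix
of rank one (`eq_mul_of_gram`). Each pair therefore consists of multiples of a common unit vector,
whose coordinates are, up to signs, the cosine and the sine of the next angle
(`signRun_isCorrect`). Finally, a block form that is decoupled at both ends of the active range has
angles `φ` equal to zero there (`IsDeflatedAt.isCut`), so that its active blocks are again in
bidiagonal block form, and changing the active angles affects the active entries only.
-/

noncomputable section

namespace CSD

open Matrix

/-! ### Givens rotations -/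

theorem givensCS_norm (x : ℝ × ℝ) : (givensCS x).1 ^ 2 + (givensCS x).2 ^ 2 = 1 := by
  obtain ⟨α, -, -, h⟩ := (givensCS_spec x).1
  rw [h]
  exact Real.cos_sq_add_sin_sq α

theorem givensCS_cross (x : ℝ × ℝ) : (givensCS x).2 * x.1 = (givensCS x).1 * x.2 := by
  linarith [(givensCS_spec x).2.1]

theorem exists_eq_smul_givensCS (x : ℝ × ℝ) : ∃ t : ℝ, x = t • givensCS x := by
  have h1 := givensCS_norm x
  have h2 := givensCS_cross x
  refine ⟨(givensCS x).1 * x.1 + (givensCS x).2 * x.2, Prod.ext ?_ ?_⟩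
  · simp only [Prod.smul_fst, smul_eq_mul]
    linear_combination (-x.1) * h1 + (givensCS x).2 * h2
  · simp only [Prod.smul_snd, smul_eq_mul]
    linear_combination (-x.2) * h1 - (givensCS x).1 * h2

theorem givensCS_zero_left (y : ℝ) : givensCS (0, y) = (0, 1) := by
  rcases lt_trichotomy y 0 with h | h | h
  · have h3 : √(y ^ 2) = -y := by rw [Real.sqrt_sq_eq_abs, abs_of_neg h]
    simp [givensCS, h.ne, not_lt.mpr h.le, h3]
  · simp [givensCS, h]
  · have h3 : √(y ^ 2) = y := Real.sqrt_sq h.le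
    simp [givensCS, h.ne', h, h3]

theorem givensCS_zero_right {x : ℝ} (hx : x ≠ 0) : givensCS (x, 0) = (1, 0) := by
  simp [givensCS, hx]

theorem givensCS_snd_pos {x : ℝ × ℝ} (hx : x.2 ≠ 0) : 0 < (givensCS x).2 := by
  have hr : 0 < √(x.1 ^ 2 + x.2 ^ 2) := Real.sqrt_pos.mpr (by positivity)
  rcases lt_or_gt_of_ne hx with h | h
  · simpa [givensCS, hx, not_lt.mpr h.le] using div_pos (neg_pos.mpr h) hr
  · simpa [givensCS, hx, h] using div_pos h hr

/-- A Givens rotation depends only on the line spanned by its vector. -/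
theorem givensCS_smul {t : ℝ} (ht : t ≠ 0) (x : ℝ × ℝ) : givensCS (t • x) = givensCS x := by
  obtain ⟨a, b⟩ := x
  have hs : √((t * a) ^ 2 + (t * b) ^ 2) = |t| * √(a ^ 2 + b ^ 2) := by
    rw [show (t * a) ^ 2 + (t * b) ^ 2 = t ^ 2 * (a ^ 2 + b ^ 2) by ring,
      Real.sqrt_mul (sq_nonneg t), Real.sqrt_sq_eq_abs]
  by_cases hb : b = 0
  · by_cases ha : a = 0 <;> simp [givensCS, ha, hb, ht]
  have key : ∀ u z : ℝ, u ≠ 0 → u * z / (u * √(a ^ 2 + b ^ 2)) = z / √(a ^ 2 + b ^ 2) :=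
    fun u z hu => mul_div_mul_left _ _ hu
  simp only [givensCS, Prod.smul_mk, smul_eq_mul, hs, mul_eq_zero, ht, hb, or_self, if_false]
  rcases lt_or_gt_of_ne ht with h | h
  · have hc : 0 < t * b ↔ ¬ 0 < b :=
      ⟨fun h1 h2 => (mul_neg_of_neg_of_pos h h2).not_gt h1,
        fun h' => mul_pos_of_neg_of_neg h (lt_of_le_of_ne (not_lt.mp h') hb)⟩
    simp only [hc, abs_of_neg h]
    split_ifs <;> refine Prod.ext ?_ ?_ <;> dsimp only
    all_goals rw [← key (-t) _ (neg_ne_zero.mpr ht)]; first | done | (congr 1; ring)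
  · simp only [mul_pos_iff_of_pos_left h, abs_of_pos h]
    split_ifs <;> refine Prod.ext ?_ ?_ <;> dsimp only
    all_goals rw [← key t _ ht]; first | done | (congr 1; ring)

theorem givensCS_fst_eq_zero {x : ℝ × ℝ} (hx : x.1 = 0) : (givensCS x).1 = 0 := by
  obtain ⟨a, b⟩ := x
  obtain rfl : a = 0 := hx
  rw [givensCS_zero_left]

theorem givensCS_idem (x : ℝ × ℝ) : givensCS (givensCS x) = givensCS x := by
  obtain ⟨t, ht⟩ := exists_eq_smul_givensCS x
  by_cases h0 : t = 0
  · have : x = (0, 0) := by rw [ht, h0, zero_smul]; rfl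
    simp [this, givensCS_zero_left]
  · conv_rhs => rw [ht, givensCS_smul h0]

theorem colinear_of_givensCS_eq {x y : ℝ × ℝ} (h : givensCS x = givensCS y) : Colinear x y := by
  refine ⟨givensCS x, ?_, ?_⟩
  · obtain ⟨t, ht⟩ := exists_eq_smul_givensCS x
    exact Submodule.mem_span_singleton.mpr ⟨t, ht.symm⟩
  · obtain ⟨t, ht⟩ := exists_eq_smul_givensCS y
    exact Submodule.mem_span_singleton.mpr ⟨t, by rw [h]; exact ht.symm⟩

theorem IsMerge.givensCS_eq {mg : ℝ × ℝ → ℝ × ℝ → ℝ × ℝ} (hmg : IsMerge mg) {x y : ℝ × ℝ}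
    (h : givensCS x = givensCS y) : givensCS (mg x y) = givensCS x := by
  obtain ⟨t, ht⟩ := exists_eq_smul_givensCS x
  obtain ⟨u, hu⟩ := exists_eq_smul_givensCS y
  obtain ⟨h1, h2⟩ := hmg x y (givensCS x) (Submodule.mem_span_singleton.mpr ⟨t, ht.symm⟩)
    (Submodule.mem_span_singleton.mpr ⟨u, by rw [h]; exact hu.symm⟩)
  obtain ⟨z, hz⟩ := Submodule.mem_span_singleton.mp h1
  by_cases h0 : z = 0
  · have h3 : mg x y = 0 := by rw [← hz, h0, zero_smul]
    rw [h3, (h2.mp h3).1]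
  · rw [← hz, givensCS_smul h0, givensCS_idem]

/-- The rotation `[c -s; s c]` with `(c, s) = r`, in rows and columns `i`, `i + 1` of the `n`-by-`n`
identity. -/
def planeRot (n i : ℕ) (r : ℝ × ℝ) : Matrix (Fin n) (Fin n) ℝ :=
  Matrix.of fun a b =>
    if (a : ℕ) = i ∧ (b : ℕ) = i then r.1
    else if (a : ℕ) = i ∧ (b : ℕ) = i + 1 then -r.2
    else if (a : ℕ) = i + 1 ∧ (b : ℕ) = i then r.2
    else if (a : ℕ) = i + 1 ∧ (b : ℕ) = i + 1 then r.1
    else if a = b then 1 else 0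

theorem givens_eq_planeRot (n i : ℕ) (x : ℝ × ℝ) : givens n i x = planeRot n i (givensCS x) := rfl

theorem mul_planeRot {m : Type*} {n i : ℕ} (hi : i + 1 < n) (M : Matrix m (Fin n) ℝ) (r : ℝ × ℝ)
    (a : m) (b : Fin n) : (M * planeRot n i r) a b =
      if (b : ℕ) = i then r.1 * M a ⟨i, by omega⟩ + r.2 * M a ⟨i + 1, hi⟩
      else if (b : ℕ) = i + 1 then -r.2 * M a ⟨i, by omega⟩ + r.1 * M a ⟨i + 1, hi⟩
      else M a b := by
  rw [Matrix.mul_apply]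
  split_ifs with h1 h2
  · rw [Finset.sum_eq_add (⟨i, by omega⟩ : Fin n) ⟨i + 1, hi⟩ (by simp)]
    · simp [planeRot, h1]; ring
    · rintro c - ⟨h3, h4⟩
      simp only [ne_eq, Fin.ext_iff] at h3 h4
      have : c ≠ b := by rw [ne_eq, Fin.ext_iff]; omega
      simp [planeRot, h1, h3, h4, this]
    all_goals simp
  · rw [Finset.sum_eq_add (⟨i, by omega⟩ : Fin n) ⟨i + 1, hi⟩ (by simp)]
    · simp [planeRot, h2]; ring
    · rintro c - ⟨h3, h4⟩
      simp only [ne_eq, Fin.ext_iff] at h3 h4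
      have : c ≠ b := by rw [ne_eq, Fin.ext_iff]; omega
      simp [planeRot, h2, h3, h4, this]
    all_goals simp
  · rw [Finset.sum_eq_single b]
    · simp [planeRot, h1, h2]
    · intro c _ h3
      simp [planeRot, h1, h2, h3]
    · simp

theorem planeRot_transpose_mul {m : Type*} {n i : ℕ} (hi : i + 1 < n) (M : Matrix (Fin n) m ℝ)
    (r : ℝ × ℝ) (a : Fin n) (b : m) : ((planeRot n i r)ᵀ * M) a b =
      if (a : ℕ) = i then r.1 * M ⟨i, by omega⟩ b + r.2 * M ⟨i + 1, hi⟩ b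
      else if (a : ℕ) = i + 1 then -r.2 * M ⟨i, by omega⟩ b + r.1 * M ⟨i + 1, hi⟩ b
      else M a b := by
  have : (planeRot n i r)ᵀ * M = (Mᵀ * planeRot n i r)ᵀ := by
    rw [Matrix.transpose_mul, Matrix.transpose_transpose]
  rw [this, Matrix.transpose_apply, mul_planeRot hi]
  rfl

theorem planeRot_mem_orthogonalGroup {n i : ℕ} (hi : i + 1 < n) {r : ℝ × ℝ}
    (hr : r.1 ^ 2 + r.2 ^ 2 = 1) : planeRot n i r ∈ Matrix.orthogonalGroup (Fin n) ℝ := by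
  rw [Matrix.mem_orthogonalGroup_iff']
  ext a b
  rw [planeRot_transpose_mul hi]
  simp only [planeRot, Matrix.of_apply, Matrix.one_apply, Fin.ext_iff]
  split_ifs <;> grind

/-- The product of the rotations `r 0`, …, `r (m - 1)` in the coordinate pairs `(0, 1)`, …,
`(m - 1, m)`. -/
def rotProd (n : ℕ) (r : ℕ → ℝ × ℝ) : ℕ → Matrix (Fin n) (Fin n) ℝ
  | 0 => 1
  | m + 1 => rotProd n r m * planeRot n m (r m)

theorem rotProd_mem_orthogonalGroup {n : ℕ} {r : ℕ → ℝ × ℝ}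
    (hr : ∀ i, (r i).1 ^ 2 + (r i).2 ^ 2 = 1) :
    ∀ m, m < n → rotProd n r m ∈ Matrix.orthogonalGroup (Fin n) ℝ
  | 0, _ => one_mem _
  | m + 1, hm => mul_mem (rotProd_mem_orthogonalGroup hr m (by omega))
      (planeRot_mem_orthogonalGroup hm (hr m))

theorem rotProd_congr {n : ℕ} {r r' : ℕ → ℝ × ℝ} :
    ∀ m, (∀ i, i < m → r i = r' i) → rotProd n r m = rotProd n r' m
  | 0, _ => rfl
  | m + 1, h => by
      rw [rotProd, rotProd, rotProd_congr m fun i hi => h i (by omega), h m (by omega)]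

/-! ### Determinants of rotations -/

theorem det_eq_one_of_rotation {ι : Type*} [Fintype ι] [DecidableEq ι] {x y : ι} (hxy : x ≠ y)
    {r : ℝ × ℝ} (hr : r.1 ^ 2 + r.2 ^ 2 = 1) {M : Matrix ι ι ℝ}
    (hM : ∀ a b, M a b = if a = x ∧ b = x then r.1 else if a = x ∧ b = y then -r.2
      else if a = y ∧ b = x then r.2 else if a = y ∧ b = y then r.1
      else if a = b then 1 else 0) : M.det = 1 := by
  -- `M = 1 + U K Uᵀ`, where the two columns of `U` are the unit vectors of `x` and `y`
  let U : Matrix ι (Fin 2) ℝ := Matrix.of fun a k => if a = ![x, y] k then 1 else 0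
  let K : Matrix (Fin 2) (Fin 2) ℝ := !![r.1 - 1, -r.2; r.2, r.1 - 1]
  have h1 : M = 1 + U * (K * Uᵀ) := by
    ext a b
    rw [hM]
    simp only [U, K, Matrix.add_apply, Matrix.mul_apply, Fin.sum_univ_two, Matrix.one_apply,
      Matrix.of_apply, Matrix.transpose_apply, Matrix.cons_val_zero, Matrix.cons_val_one,
      Matrix.cons_val']
    grind
  have h2 : Uᵀ * U = 1 := by
    ext k l
    rw [Matrix.mul_apply, Finset.sum_eq_single (![x, y] k)]
    · fin_cases k <;> fin_cases l <;> simp [U, hxy, hxy.symm]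
    · intro j _ hj
      simp [U, hj]
    · simp
  rw [h1, Matrix.det_one_add_mul_comm, Matrix.mul_assoc, h2, Matrix.mul_one, Matrix.det_fin_two]
  simp [K]
  linarith

theorem det_planeRot {n i : ℕ} (hi : i + 1 < n) {r : ℝ × ℝ} (hr : r.1 ^ 2 + r.2 ^ 2 = 1) :
    (planeRot n i r).det = 1 := by
  refine det_eq_one_of_rotation (x := (⟨i, by omega⟩ : Fin n)) (y := ⟨i + 1, hi⟩) (by simp) hr ?_
  intro a b
  simp [planeRot, Fin.ext_iff]

theorem det_rotProd {n : ℕ} {r : ℕ → ℝ × ℝ} (hr : ∀ i, (r i).1 ^ 2 + (r i).2 ^ 2 = 1) :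
    ∀ m, m < n → (rotProd n r m).det = 1
  | 0, _ => Matrix.det_one
  | m + 1, hm => by
      rw [rotProd, Matrix.det_mul, det_rotProd hr m (by omega), det_planeRot hm (hr m), one_mul]

theorem planeRot_one_zero (n i : ℕ) : planeRot n i (1, 0) = 1 := by
  ext a b
  simp only [planeRot, Matrix.of_apply, Matrix.one_apply, Fin.ext_iff]
  grind

theorem det_toSquareBlockProp_planeRot {n i : ℕ} (hi : i + 1 < n) {r : ℝ × ℝ}
    (hr : r.1 ^ 2 + r.2 ^ 2 = 1) (q : Fin n → Prop) [DecidablePred q]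
    (hq : q ⟨i, by omega⟩ ↔ q ⟨i + 1, hi⟩) :
    ((planeRot n i r).toSquareBlockProp q).det = 1 := by
  by_cases h : q ⟨i, by omega⟩
  · refine det_eq_one_of_rotation (x := ⟨⟨i, Nat.lt_of_succ_lt hi⟩, h⟩)
      (y := ⟨⟨i + 1, hi⟩, hq.mp h⟩) (by simp) hr ?_
    rintro ⟨a, ha⟩ ⟨b, hb⟩
    simp [planeRot, Fin.ext_iff, Matrix.toSquareBlockProp]
  · have : (planeRot n i r).toSquareBlockProp q = 1 := by
      ext ⟨a, ha⟩ ⟨b, hb⟩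
      have h1 : (a : ℕ) ≠ i := fun h' => h (by convert ha; exact h'.symm)
      have h2 : (a : ℕ) ≠ i + 1 := fun h' => h (hq.mpr (by convert ha; exact h'.symm))
      simp [planeRot, h1, h2, Matrix.toSquareBlockProp, Matrix.one_apply]
    rw [this, Matrix.det_one]

/-! ### Products of rotations -/

theorem rotProd_row {n : ℕ} {r : ℕ → ℝ × ℝ} :
    ∀ m, m < n → ∀ i j : Fin n, m < i → rotProd n r m i j = (1 : Matrix (Fin n) (Fin n) ℝ) i j
  | 0, _, _, _, _ => rfl
  | m + 1, hm, i, j, hi => by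
      rw [rotProd, mul_planeRot hm]
      simp only [rotProd_row m (by omega) i _ (show m < i by omega), Matrix.one_apply, Fin.ext_iff]
      have : (i : ℕ) ≠ m ∧ (i : ℕ) ≠ m + 1 := by omega
      grind

theorem rotProd_col {n : ℕ} {r : ℕ → ℝ × ℝ} :
    ∀ m, m < n → ∀ i j : Fin n, m < j → rotProd n r m i j = (1 : Matrix (Fin n) (Fin n) ℝ) i j
  | 0, _, _, _, _ => rfl
  | m + 1, hm, i, j, hj => by
      rw [rotProd, mul_planeRot hm, if_neg (by omega), if_neg (by omega),
        rotProd_col m (by omega) i j (by omega)]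

theorem rotProd_hessenberg {n : ℕ} {r : ℕ → ℝ × ℝ} :
    ∀ m, m < n → ∀ i j : Fin n, (j : ℕ) + 1 < i → rotProd n r m i j = 0
  | 0, _, i, j, h => Matrix.one_apply_ne (by rw [ne_eq, Fin.ext_iff]; omega)
  | m + 1, hm, i, j, h => by
      have ih := rotProd_hessenberg (r := r) m (by omega) i
      rw [rotProd, mul_planeRot hm]
      split_ifs with h1 h2
      · rw [rotProd_col m (by omega) i ⟨m + 1, hm⟩ (by simp), ih ⟨m, by omega⟩ (by simp; omega),
          Matrix.one_apply_ne (by rw [ne_eq, Fin.ext_iff]; simp; omega)]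
        simp
      · rw [ih ⟨m + 1, hm⟩ (by simp; omega), ih ⟨m, by omega⟩ (by simp; omega)]
        simp
      · exact ih j h

theorem rotProd_subdiag {n : ℕ} {r : ℕ → ℝ × ℝ} :
    ∀ m, m < n → ∀ i j : Fin n, (i : ℕ) = j + 1 → (j : ℕ) < m → rotProd n r m i j = (r j).2
  | 0, _, _, _, _, h => absurd h (by omega)
  | m + 1, hm, i, j, h, hj => by
      rw [rotProd, mul_planeRot hm]
      split_ifs with h1 h2
      · rw [rotProd_col m (by omega) i ⟨m + 1, hm⟩ (by simp),
          rotProd_row m (by omega) i _ (by omega), Matrix.one_apply, Matrix.one_apply,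
          if_neg, if_pos, h1]
        all_goals simp [Fin.ext_iff]; try omega
      · omega
      · exact rotProd_subdiag m (by omega) i j h (by omega)

theorem rotProd_eq_of_le {n l : ℕ} {r : ℕ → ℝ × ℝ} (hl : r l = (1, 0)) (i j : Fin n)
    (hj : (j : ℕ) ≤ l) : ∀ m, l ≤ m → m < n → rotProd n r m i j = rotProd n r l i j := by
  intro m hm
  induction m, hm using Nat.le_induction with
  | base => exact fun _ => rfl
  | succ m hm ih =>
    intro hn
    rw [rotProd, ← ih (by omega)]
    rcases eq_or_lt_of_le hm with rfl | h
    · rw [hl, planeRot_one_zero, Matrix.mul_one]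
    · rw [mul_planeRot hn, if_neg (by omega), if_neg (by omega)]

/-- A product of rotations by the angle `π / 2` is a cyclic permutation matrix up to a sign. -/
theorem exists_rotProd_eq_slide {n l : ℕ} : ∀ m, l ≤ m → m < n → ∃ ε : ℝ, (ε = 1 ∨ ε = -1) ∧
    ∀ i j : Fin n, rotProd n (fun k => if k < l then (1, 0) else (0, 1)) m i j =
      if (i : ℕ) < l ∨ m < i then (if j = i then 1 else 0)
      else if (i : ℕ) = l then (if (j : ℕ) = m then ε else 0)
      else (if (i : ℕ) = j + 1 then 1 else 0) := by
  intro m hm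
  induction m, hm using Nat.le_induction with
  | base =>
    refine fun _ => ⟨1, Or.inl rfl, fun i j => ?_⟩
    have h : ∀ k, k ≤ l → rotProd n (fun k => if k < l then (1, 0) else (0, 1)) k = 1 := by
      intro k
      induction k with
      | zero => exact fun _ => rfl
      | succ k ih =>
        intro hk
        rw [rotProd, ih (by omega), if_pos (by omega), planeRot_one_zero, Matrix.mul_one]
    rw [h l le_rfl, Matrix.one_apply]
    simp only [Fin.ext_iff]
    grind
  | succ m hm ih =>
    intro hn
    obtain ⟨ε, hε, h⟩ := ih (by omega)
    refine ⟨-ε, by rcases hε with rfl | rfl <;> simp, fun i j => ?_⟩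
    have hm' : (if m < l then ((1 : ℝ), (0 : ℝ)) else (0, 1)) = (0, 1) := if_neg (by omega)
    rw [rotProd, mul_planeRot hn, hm']
    simp only [h, Fin.ext_iff]
    grind

theorem rotProd_eq_mul {n l : ℕ} {r : ℕ → ℝ × ℝ} (hl : ∀ k, l ≤ k → r k = (0, 1)) :
    ∀ m, l ≤ m → rotProd n r m =
      rotProd n r l * rotProd n (fun k => if k < l then (1, 0) else (0, 1)) m := by
  intro m hm
  have h1 : ∀ k, k ≤ l → rotProd n (fun k => if k < l then (1, 0) else (0, 1)) k = 1 := by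
    intro k
    induction k with
    | zero => exact fun _ => rfl
    | succ k ih =>
      intro hk
      rw [rotProd, ih (by omega), if_pos (by omega), planeRot_one_zero, Matrix.mul_one]
  induction m, hm using Nat.le_induction with
  | base => rw [h1 l le_rfl, Matrix.mul_one]
  | succ m hm ih => rw [rotProd, rotProd, ← Matrix.mul_assoc, ← ih, if_neg (by omega), hl m hm]

/-! ### Givens QR factorization of tridiagonal matrices -/

/-- The symmetric tridiagonal matrix with diagonal `α` and subdiagonal `β`. -/
def tridiag (n : ℕ) (α β : ℕ → ℝ) : Matrix (Fin n) (Fin n) ℝ :=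
  Matrix.of fun i j => if j = i then α i else if (i : ℕ) = j + 1 then β j
    else if (j : ℕ) = i + 1 then β i else 0

/-- The recursion of the QR factorization of `tridiag n α β` by rotations, `g` computing the cosine
and sine of a rotation from the vector `(p, β i)` that it maps to the first coordinate axis. The
value at `i` consists of the cosine of the preceding rotation (`1` if there is none) and of the
pivot `p`, the current diagonal entry in row `i`. -/
def givensSeq (g : ℝ × ℝ → ℝ × ℝ) (α β : ℕ → ℝ) : ℕ → ℝ × ℝ
  | 0 => (1, α 0)
  | i + 1 =>
    let r := g ((givensSeq g α β i).2, β i)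
    (r.1, r.1 * α (i + 1) - r.2 * (givensSeq g α β i).1 * β i)

/-- Cosine and sine of rotation `i` in the QR factorization of a tridiagonal matrix. -/
def givensRot (g : ℝ × ℝ → ℝ × ℝ) (α β : ℕ → ℝ) (i : ℕ) : ℝ × ℝ :=
  g ((givensSeq g α β i).2, β i)

/-- `g` computes the cosine and sine of a rotation that annihilates the second coordinate. -/
def IsRotator (g : ℝ × ℝ → ℝ × ℝ) : Prop :=
  ∀ x, (g x).1 ^ 2 + (g x).2 ^ 2 = 1 ∧ (g x).2 * x.1 = (g x).1 * x.2

theorem isRotator_givensCS : IsRotator givensCS :=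
  fun x => ⟨givensCS_norm x, givensCS_cross x⟩

/-- The variant of `givensCS` that leaves a vector alone whose second coordinate vanishes, even if
the vector is zero. It keeps the unreduced diagonal blocks apart. -/
def blockCS (x : ℝ × ℝ) : ℝ × ℝ := if x.2 = 0 then (1, 0) else givensCS x

theorem isRotator_blockCS : IsRotator blockCS := by
  intro x
  by_cases h : x.2 = 0
  · simp [blockCS, h]
  · simpa [blockCS, h] using isRotator_givensCS x

section

variable {n : ℕ} {g : ℝ × ℝ → ℝ × ℝ} {α β : ℕ → ℝ}

/-- The first `m` rotations make the leading `m` columns of a tridiagonal matrix triangular. -/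
theorem rotProd_transpose_mul_tridiag (hg : IsRotator g) : ∀ m, m < n → ∀ i j : Fin n,
    ((m < i → ((rotProd n (givensRot g α β) m)ᵀ * tridiag n α β) i j = tridiag n α β i j) ∧
    ((i : ℕ) = m → ((rotProd n (givensRot g α β) m)ᵀ * tridiag n α β) i j =
      if (j : ℕ) = m then (givensSeq g α β m).2
      else if (j : ℕ) = m + 1 then (givensSeq g α β m).1 * β m else 0) ∧
    ((i : ℕ) < m → j < i → ((rotProd n (givensRot g α β) m)ᵀ * tridiag n α β) i j = 0) ∧
    ((i : ℕ) < m → j = i → ((rotProd n (givensRot g α β) m)ᵀ * tridiag n α β) i j =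
      (givensRot g α β i).1 * (givensSeq g α β i).2 + (givensRot g α β i).2 * β i))
  | 0, hm, i, j => by
    refine ⟨fun h => by simp [rotProd], fun h => ?_, fun h => absurd h (by omega),
      fun h => absurd h (by omega)⟩
    simp only [rotProd, Matrix.transpose_one, Matrix.one_mul, tridiag, Matrix.of_apply, givensSeq,
      Fin.ext_iff]
    grind
  | m + 1, hm, i, j => by
    have ih := rotProd_transpose_mul_tridiag hg m (by omega)
    obtain ⟨-, h2, -, -⟩ := ih ⟨m, by omega⟩ j
    obtain ⟨h1, -, -, -⟩ := ih ⟨m + 1, hm⟩ j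
    obtain ⟨h3, -, h4, h5⟩ := ih i j
    specialize h1 (Nat.lt_succ_self m)
    specialize h2 rfl
    have hc := (hg ((givensSeq g α β m).2, β m)).2
    have hs : givensSeq g α β (m + 1) = ((givensRot g α β m).1, (givensRot g α β m).1 * α (m + 1) -
      (givensRot g α β m).2 * (givensSeq g α β m).1 * β m) := rfl
    change (givensRot g α β m).2 * _ = (givensRot g α β m).1 * _ at hc
    rw [rotProd, Matrix.transpose_mul, Matrix.mul_assoc, planeRot_transpose_mul hm, h1, h2]
    rw [show tridiag n α β ⟨m + 1, hm⟩ j = if (j : ℕ) = m + 1 then α (m + 1)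
      else if m + 1 = (j : ℕ) + 1 then β j else if (j : ℕ) = m + 1 + 1 then β (m + 1) else 0 by
        simp [tridiag, Fin.ext_iff]]
    rw [hs]
    dsimp only at hc ⊢
    refine ⟨fun h => ?_, fun h => ?_, fun h h' => ?_, fun h h' => ?_⟩
    · rw [if_neg (by omega), if_neg (by omega), h3 (by omega)]
    · rw [if_neg (by omega), if_pos h]
      have e1 : m ≠ m + 1 := by omega
      rcases Nat.lt_trichotomy j m with h6 | h6 | h6
      · simp [show (j : ℕ) ≠ m by omega, show (j : ℕ) ≠ m + 1 by omega,
          show (j : ℕ) ≠ m + 1 + 1 by omega]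
        intro h7; omega
      · rw [if_pos h6, if_neg (by omega), if_pos (by omega), h6, if_neg (by omega),
          if_neg (by omega)]
        linarith
      · rcases eq_or_ne (j : ℕ) (m + 1) with h7 | h7
        · simp [h7]
          ring
        · simp [h7, h6.ne', show m ≠ (j : ℕ) by omega]
    · rw [Fin.lt_def] at h'
      rcases eq_or_ne (i : ℕ) m with h6 | h6
      · rw [if_pos h6, if_neg (by omega), if_neg (by omega), if_neg (by omega)]
        rcases eq_or_ne (m : ℕ) (j + 1) with h7 | h7
        · rw [if_neg (by omega), if_neg (by omega)]; simp
        · rw [if_neg (by omega), if_neg (by omega)]; simp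
      · rw [if_neg h6, if_neg (by omega)]
        exact h4 (by omega) h'
    · rcases eq_or_ne (i : ℕ) m with h6 | h6
      · rw [if_pos h6, if_pos (by omega), if_neg (by omega), if_pos (by omega), h', h6]
      · rw [if_neg h6, if_neg (by omega)]
        exact h5 (by omega) h'

/-- The triangular factor's diagonal entry `i`. -/
def givensDiag (g : ℝ × ℝ → ℝ × ℝ) (α β : ℕ → ℝ) (i : ℕ) : ℝ :=
  (givensRot g α β i).1 * (givensSeq g α β i).2 + (givensRot g α β i).2 * β i

theorem tridiag_transpose (n : ℕ) (α β : ℕ → ℝ) : (tridiag n α β)ᵀ = tridiag n α β := by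
  ext i j
  simp only [tridiag, Matrix.of_apply, Matrix.transpose_apply, Fin.ext_iff]
  grind

theorem isSymmTridiagonal_tridiag (n : ℕ) (α β : ℕ → ℝ) : IsSymmTridiagonal (tridiag n α β) := by
  refine ⟨tridiag_transpose n α β, fun i j h => ?_⟩
  simp only [tridiag, Matrix.of_apply, Fin.ext_iff]
  grind

/-! ### Diagonal blocks of tridiagonal matrices -/

/-- `M` is block diagonal with respect to the unreduced blocks of `A`. -/
def BlockDiagonalFor (A M : Matrix (Fin n) (Fin n) ℝ) : Prop :=
  ∀ i j, ¬ SameBlock A i j → M i j = 0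

theorem sameBlock_tridiag {i j : Fin n} : SameBlock (tridiag n α β) i j ↔
    ∀ k : ℕ, min (i : ℕ) j ≤ k → k < max (i : ℕ) j → β k ≠ 0 := by
  constructor
  · intro h k h1 h2
    have hk : k + 1 < n := by omega
    have := h ⟨k, by omega⟩ ⟨k + 1, hk⟩ rfl
      (by rw [Fin.le_def, Fin.coe_min]; exact h1) (by rw [Fin.le_def, Fin.coe_max]; exact h2)
    simpa [tridiag, Fin.ext_iff] using this
  · intro h a b hb h1 h2
    rw [Fin.le_def, Fin.coe_min] at h1
    rw [Fin.le_def, Fin.coe_max] at h2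
    have h3 := h a h1 (by omega)
    have h4 : a ≠ b := by rw [ne_eq, Fin.ext_iff]; omega
    simpa [tridiag, hb, h4] using h3

theorem sameBlock_refl (A : Matrix (Fin n) (Fin n) ℝ) (i : Fin n) : SameBlock A i i := by
  intro a b hb h1 h2
  rw [Fin.le_def, Fin.coe_min] at h1
  rw [Fin.le_def, Fin.coe_max] at h2
  omega

theorem SameBlock.symm {A : Matrix (Fin n) (Fin n) ℝ} {i j : Fin n} (h : SameBlock A i j) :
    SameBlock A j i := by
  intro a b hb h1 h2
  exact h a b hb (by rwa [min_comm]) (by rwa [max_comm])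

theorem SameBlock.trans {A : Matrix (Fin n) (Fin n) ℝ} {i j k : Fin n} (h : SameBlock A i j)
    (h' : SameBlock A j k) : SameBlock A i k := by
  intro a b hb h1 h2
  by_cases h3 : min i j ≤ a ∧ b ≤ max i j
  · exact h a b hb h3.1 h3.2
  · refine h' a b hb ?_ ?_ <;> simp only [Fin.le_def, Fin.coe_min, Fin.coe_max] at * <;> omega

theorem BlockDiagonalFor.mul {A M N : Matrix (Fin n) (Fin n) ℝ} (hM : BlockDiagonalFor A M)
    (hN : BlockDiagonalFor A N) : BlockDiagonalFor A (M * N) := by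
  intro i j h
  rw [Matrix.mul_apply]
  refine Finset.sum_eq_zero fun k _ => ?_
  by_cases h1 : SameBlock A i k
  · rw [hN k j fun h2 => h (h1.trans h2), mul_zero]
  · rw [hM i k h1, zero_mul]

theorem BlockDiagonalFor.transpose {A M : Matrix (Fin n) (Fin n) ℝ} (hM : BlockDiagonalFor A M) :
    BlockDiagonalFor A Mᵀ :=
  fun i j h => hM j i fun h' => h h'.symm

theorem blockDiagonalFor_one (A : Matrix (Fin n) (Fin n) ℝ) : BlockDiagonalFor A 1 := by
  intro i j h
  exact Matrix.one_apply_ne fun h' => h (h' ▸ sameBlock_refl A i)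

theorem blockDiagonalFor_self_tridiag : BlockDiagonalFor (tridiag n α β) (tridiag n α β) := by
  intro i j h
  rw [sameBlock_tridiag] at h
  push Not at h
  obtain ⟨k, h1, h2, h3⟩ := h
  simp only [tridiag, Matrix.of_apply, Fin.ext_iff]
  grind

/-- Determinants of diagonal blocks are multiplicative on block diagonal matrices. -/
theorem blockDet_mul {A M N : Matrix (Fin n) (Fin n) ℝ} (hM : BlockDiagonalFor A M) (j : Fin n) :
    blockDet A (M * N) j = blockDet A M j * blockDet A N j := by
  classical
  unfold blockDet
  rw [← Matrix.det_mul]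
  congr 1
  ext ⟨a, ha⟩ ⟨b, hb⟩
  simp only [Matrix.toSquareBlockProp_def, Matrix.mul_apply, Matrix.of_apply]
  rw [← Fintype.sum_subtype_add_sum_subtype (fun k => SameBlock A j k), add_eq_left]
  exact Finset.sum_eq_zero fun k _ => by rw [hM a k fun h => k.2 (ha.trans h), zero_mul]

theorem blockDet_one (A : Matrix (Fin n) (Fin n) ℝ) (j : Fin n) : blockDet A 1 j = 1 := by
  classical
  unfold blockDet
  have : (1 : Matrix (Fin n) (Fin n) ℝ).toSquareBlockProp (fun i => SameBlock A j i) = 1 := by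
    ext ⟨a, ha⟩ ⟨b, hb⟩
    simp [Matrix.toSquareBlockProp_def, Matrix.one_apply]
  rw [this, Matrix.det_one]

open Classical in
theorem blockDet_of_upper {A M : Matrix (Fin n) (Fin n) ℝ} (hM : ∀ i j, j < i → M i j = 0)
    (j : Fin n) : blockDet A M j = ∏ i : {i // SameBlock A j i}, M i i := by
  unfold blockDet
  refine (Matrix.det_of_isUpperTriangular ?_).trans rfl
  rintro ⟨a, ha⟩ ⟨b, hb⟩ h
  exact hM a b h

theorem blockDet_planeRot {i : ℕ} (hi : i + 1 < n) {r : ℝ × ℝ} (hr : r.1 ^ 2 + r.2 ^ 2 = 1)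
    (h : β i = 0 → r = (1, 0)) (j : Fin n) :
    blockDet (tridiag n α β) (planeRot n i r) j = 1 := by
  classical
  by_cases hβ : β i = 0
  · rw [h hβ, planeRot_one_zero, blockDet_one]
  · unfold blockDet
    have h1 : SameBlock (tridiag n α β) ⟨i, by omega⟩ ⟨i + 1, hi⟩ := by
      rw [sameBlock_tridiag]
      intro k h1 h2
      simp at h1 h2
      rwa [show k = i by omega]
    exact det_toSquareBlockProp_planeRot hi hr _ ⟨fun h => h.trans h1, fun h => h.trans h1.symm⟩

theorem blockDiagonalFor_planeRot {i : ℕ} {r : ℝ × ℝ}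
    (h : β i = 0 → r = (1, 0)) : BlockDiagonalFor (tridiag n α β) (planeRot n i r) := by
  by_cases hβ : β i = 0
  · rw [h hβ, planeRot_one_zero]
    exact blockDiagonalFor_one _
  · intro a b h
    rw [sameBlock_tridiag] at h
    push Not at h
    obtain ⟨k, h1, h2, h3⟩ := h
    have : k ≠ i := fun h' => hβ (h' ▸ h3)
    simp only [planeRot, Matrix.of_apply, Fin.ext_iff]
    grind

theorem blockDiagonalFor_rotProd {r : ℕ → ℝ × ℝ} (h : ∀ i, β i = 0 → r i = (1, 0)) :
    ∀ m, m < n → BlockDiagonalFor (tridiag n α β) (rotProd n r m)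
  | 0, _ => blockDiagonalFor_one _
  | m + 1, hm => (blockDiagonalFor_rotProd h m (by omega)).mul (blockDiagonalFor_planeRot (h m))

theorem blockDet_rotProd {r : ℕ → ℝ × ℝ} (hr : ∀ i, (r i).1 ^ 2 + (r i).2 ^ 2 = 1)
    (h : ∀ i, β i = 0 → r i = (1, 0)) (j : Fin n) :
    ∀ m, m < n → blockDet (tridiag n α β) (rotProd n r m) j = 1
  | 0, _ => blockDet_one _ _
  | m + 1, hm => by
    rw [rotProd, blockDet_mul (blockDiagonalFor_rotProd h m (by omega)),
      blockDet_rotProd hr h j m (by omega), blockDet_planeRot hm (hr m) (h m), one_mul]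

/-! ### Preferred QR factorization of tridiagonal matrices -/

theorem givensRot_norm (hg : IsRotator g) (i : ℕ) :
    (givensRot g α β i).1 ^ 2 + (givensRot g α β i).2 ^ 2 = 1 := (hg _).1

theorem givensDiag_eq_zero_iff {i : ℕ} : givensDiag blockCS α β i = 0 ↔
    β i = 0 ∧ (givensSeq blockCS α β i).2 = 0 := by
  obtain ⟨h1, h2⟩ := isRotator_blockCS ((givensSeq blockCS α β i).2, β i)
  unfold givensDiag givensRot
  by_cases hβ : β i = 0
  · simp [blockCS, hβ]
  · have h3 : 0 < (blockCS ((givensSeq blockCS α β i).2, β i)).2 := by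
      simpa [blockCS, hβ] using givensCS_snd_pos (x := ((givensSeq blockCS α β i).2, β i)) hβ
    simp only [hβ, false_and, iff_false]
    intro h
    apply hβ
    dsimp only at h2
    linear_combination (-β i) * h1 + (blockCS ((givensSeq blockCS α β i).2, β i)).2 * h -
      (blockCS ((givensSeq blockCS α β i).2, β i)).1 * h2

/-- The rotations that keep the unreduced diagonal blocks apart yield QR factorizations of all of
these blocks. -/
theorem isBlockQR_tridiag (hn : 0 < n) :
    IsBlockQR (tridiag n α β) (rotProd n (givensRot blockCS α β) (n - 1))
      ((rotProd n (givensRot blockCS α β) (n - 1))ᵀ * tridiag n α β) := by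
  have hr : ∀ i, (givensRot blockCS α β i).1 ^ 2 + (givensRot blockCS α β i).2 ^ 2 = 1 :=
    givensRot_norm isRotator_blockCS
  have h0 : ∀ i, β i = 0 → givensRot blockCS α β i = (1, 0) := by
    intro i hi
    simp [givensRot, blockCS, hi]
  have hm : n - 1 < n := by omega
  have ho := rotProd_mem_orthogonalGroup hr (n - 1) hm
  have hb := blockDiagonalFor_rotProd (α := α) h0 (n - 1) hm
  refine ⟨?_, ho, fun i j h => ⟨hb i j h, hb.transpose.mul blockDiagonalFor_self_tridiag i j h⟩,
    rotProd_hessenberg (n - 1) hm, fun i j h h' => ?_, fun j => blockDet_rotProd hr h0 j _ hm,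
    fun i j h => ?_⟩
  · rw [← Matrix.mul_assoc]
    rw [(Matrix.mem_orthogonalGroup_iff (Fin n) ℝ).mp ho, Matrix.one_mul]
  · rw [rotProd_subdiag (n - 1) hm i j h (by omega)]
    have h1 : β j ≠ 0 := sameBlock_tridiag.mp h' j (by omega) (by omega)
    simpa [givensRot, blockCS, h1] using
      givensCS_snd_pos (x := ((givensSeq blockCS α β j).2, β j)) h1
  · have h1 := rotProd_transpose_mul_tridiag (α := α) (β := β) isRotator_blockCS (n - 1) hm i j
    rw [Fin.lt_def] at h
    rcases eq_or_ne (i : ℕ) (n - 1) with h2 | h2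
    · rw [h1.2.1 h2, if_neg (by omega), if_neg (by omega)]
    · exact h1.2.2.1 (by omega) h

theorem diag_of_blockQR (hn : 0 < n) (hβ : β (n - 1) = 0) (i : Fin n) :
    ((rotProd n (givensRot blockCS α β) (n - 1))ᵀ * tridiag n α β) i i =
      givensDiag blockCS α β i := by
  have h1 := rotProd_transpose_mul_tridiag (α := α) (β := β) isRotator_blockCS (n - 1)
    (by omega) i i
  rcases eq_or_ne (i : ℕ) (n - 1) with h2 | h2
  · rw [h1.2.1 h2, if_pos h2, givensDiag, givensRot, h2, hβ]
    simp [blockCS]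
  · exact h1.2.2.2 (by omega) rfl

theorem det_tridiag (hn : 0 < n) (hβ : β (n - 1) = 0) :
    (tridiag n α β).det = ∏ i : Fin n, givensDiag blockCS α β i := by
  have h := isBlockQR_tridiag (α := α) (β := β) hn
  rw [h.eq_mul, Matrix.det_mul, det_rotProd (givensRot_norm isRotator_blockCS) _ (by omega),
    one_mul, Matrix.det_of_isUpperTriangular fun i j h' => h.upper i j h']
  exact Finset.prod_congr rfl fun i _ => diag_of_blockQR hn hβ i

open Classical in
theorem blockDet_tridiag (hn : 0 < n) (hβ : β (n - 1) = 0) (j : Fin n) :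
    blockDet (tridiag n α β) (tridiag n α β) j =
      ∏ i : {i // SameBlock (tridiag n α β) j i}, givensDiag blockCS α β (i : Fin n) := by
  have h := isBlockQR_tridiag (α := α) (β := β) hn
  have h1 : blockDet (tridiag n α β) (tridiag n α β) j = blockDet (tridiag n α β)
      (rotProd n (givensRot blockCS α β) (n - 1) *
        ((rotProd n (givensRot blockCS α β) (n - 1))ᵀ * tridiag n α β)) j := by
    rw [← h.eq_mul]
  rw [h1, blockDet_mul fun i j h' => (h.block_diag i j h').1, h.det_one, one_mul,
    blockDet_of_upper h.upper]
  exact Finset.prod_congr rfl fun i _ => diag_of_blockQR hn hβ i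

theorem givensCS_eq_blockCS {x : ℝ × ℝ} (h : ¬ (x.2 = 0 ∧ x.1 = 0)) :
    givensCS x = blockCS x := by
  obtain ⟨a, b⟩ := x
  by_cases h3 : b = 0
  · subst h3
    simp only [true_and] at h
    simp [blockCS, givensCS_zero_right h]
  · simp [blockCS, h3]

/-- As long as no singular leading block has been completed, both kinds of rotations agree. -/
theorem givensSeq_eq_blockCS {l : ℕ} (hl : ∀ k, k < l → givensDiag blockCS α β k ≠ 0) :
    ∀ i, i ≤ l → givensSeq givensCS α β i = givensSeq blockCS α β i
  | 0, _ => rfl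
  | i + 1, hi => by
    have h2 := hl i (by omega)
    rw [ne_eq, givensDiag_eq_zero_iff] at h2
    simp only [givensSeq, givensSeq_eq_blockCS hl i (by omega),
      givensCS_eq_blockCS (x := (_, β i)) h2]

theorem givensRot_eq_blockCS {l : ℕ} (hl : ∀ k, k < l → givensDiag blockCS α β k ≠ 0) (i : ℕ)
    (hi : i < l) : givensRot givensCS α β i = givensRot blockCS α β i := by
  have h2 := hl i hi
  rw [ne_eq, givensDiag_eq_zero_iff] at h2
  rw [givensRot, givensRot, givensSeq_eq_blockCS hl i hi.le, givensCS_eq_blockCS h2]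

/-- From the end of a singular leading block on, all rotations are by the angle `π / 2`. -/
theorem givensRot_eq_of_singular {l : ℕ} (hl : β l = 0 ∧ (givensSeq givensCS α β l).2 = 0) :
    ∀ k, l ≤ k → givensRot givensCS α β k = (0, 1) := by
  have key : ∀ k, l ≤ k → (givensSeq givensCS α β k).2 = 0 ∧
      (givensSeq givensCS α β k).1 * β k = 0 := by
    intro k hk
    induction k, hk using Nat.le_induction with
    | base => simp [hl]
    | succ k hk ih =>
      have h1 : givensCS ((givensSeq givensCS α β k).2, β k) = (0, 1) := by
        rw [ih.1, givensCS_zero_left]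
      simp only [givensSeq, h1]
      simp [ih.2]
  intro k hk
  rw [givensRot, (key k hk).1, givensCS_zero_left]

/-- The QR factorization of a symmetric tridiagonal matrix by Givens rotations, the zero vector
being rotated by the angle `π / 2`, is the preferred one. -/
theorem isPreferredQR_tridiag (hn : 0 < n) (hβ : β (n - 1) = 0) :
    IsPreferredQR (tridiag n α β) (rotProd n (givensRot givensCS α β) (n - 1))
      ((rotProd n (givensRot givensCS α β) (n - 1))ᵀ * tridiag n α β) := by
  classical
  refine ⟨isSymmTridiagonal_tridiag n α β, ?_⟩
  by_cases hdet : (tridiag n α β).det = 0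
  · right
    refine ⟨hdet, ?_⟩
    have hex : ∃ k, k < n ∧ givensDiag blockCS α β k = 0 := by
      rw [det_tridiag hn hβ, Finset.prod_eq_zero_iff] at hdet
      obtain ⟨k, -, hk⟩ := hdet
      exact ⟨k, k.2, hk⟩
    obtain ⟨l, ⟨hln, hl0⟩, hmin⟩ : ∃ l, (l < n ∧ givensDiag blockCS α β l = 0) ∧
        ∀ k, k < l → givensDiag blockCS α β k ≠ 0 :=
      ⟨Nat.find hex, Nat.find_spec hex, fun k hk h =>
        Nat.find_min hex hk ⟨hk.trans (Nat.find_spec hex).1, h⟩⟩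
    have hl1 := givensDiag_eq_zero_iff.mp hl0
    have hblock : givensRot blockCS α β l = (1, 0) := by simp [givensRot, blockCS, hl1.1]
    have hlate := givensRot_eq_of_singular (α := α) (β := β) (l := l)
      ⟨hl1.1, by rw [givensSeq_eq_blockCS hmin l le_rfl]; exact hl1.2⟩
    obtain ⟨ε, hε, hslide⟩ :=
      exists_rotProd_eq_slide (n := n) (l := l) (n - 1) (by omega) (by omega)
    have hslide' : rotProd n (fun k => if k < l then (1, 0) else (0, 1)) (n - 1) =
        slideMatrix ⟨l, hln⟩ ε := by
      ext i j
      rw [hslide]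
      simp only [slideMatrix, Matrix.of_apply, Fin.ext_iff, Fin.lt_def]
      grind
    have hQ : rotProd n (givensRot givensCS α β) (n - 1) =
        rotProd n (givensRot blockCS α β) l * slideMatrix ⟨l, hln⟩ ε := by
      rw [rotProd_eq_mul hlate (n - 1) (by omega), hslide',
        rotProd_congr l (givensRot_eq_blockCS hmin)]
    have hQ0 : rotProd n (givensRot blockCS α β) l = Matrix.of fun i j =>
        if j ≤ (⟨l, hln⟩ : Fin n) then rotProd n (givensRot blockCS α β) (n - 1) i j
        else (1 : Matrix (Fin n) (Fin n) ℝ) i j := by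
      ext i j
      rw [Matrix.of_apply]
      split_ifs with h
      · exact (rotProd_eq_of_le hblock i j h (n - 1) (by omega) (by omega)).symm
      · exact rotProd_col l hln i j (not_le.mp h)
    refine ⟨_, _, ⟨l, hln⟩, ε, isBlockQR_tridiag hn, ⟨?_, ?_, ?_⟩, hε, ?_, ?_, ?_⟩
    · intro j hj
      by_contra h
      rw [Fin.le_def, not_le] at h
      exact sameBlock_tridiag.mp hj l (by simp) (by simp; omega) hl1.1
    · rw [blockDet_tridiag hn hβ]
      exact Finset.prod_eq_zero (Finset.mem_univ ⟨⟨l, hln⟩, sameBlock_refl _ _⟩) hl0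
    · intro i hi hil
      rw [Fin.lt_def] at hi
      rw [blockDet_tridiag hn hβ]
      refine Finset.prod_ne_zero_iff.mpr ?_
      rintro ⟨j, hj⟩ -
      refine hmin j ?_
      by_contra h
      refine hil (SameBlock.symm ?_)
      rw [sameBlock_tridiag] at hj ⊢
      intro k h1 h2
      dsimp only at hi h h1 h2
      exact hj k (by omega) (by omega)
    · rw [← hslide']
      refine det_rotProd (fun i => ?_) _ (by omega)
      split_ifs <;> simp
    · rw [hQ, hQ0]
    · rw [hQ, Matrix.transpose_mul, Matrix.mul_assoc]
      congr 1
      ext i j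
      rw [Matrix.of_apply]
      split_ifs with h
      · simp only [Matrix.mul_apply, Matrix.transpose_apply]
        exact Finset.sum_congr rfl fun k _ => by
          rw [rotProd_eq_of_le hblock k i h (n - 1) (by omega) (by omega)]
      · simp only [Matrix.mul_apply, Matrix.transpose_apply,
          rotProd_col l hln _ i (not_le.mp h), Matrix.one_apply]
        simp
  · left
    refine ⟨hdet, ?_⟩
    have h1 : ∀ k, k < n → givensDiag blockCS α β k ≠ 0 := by
      rw [det_tridiag hn hβ, Finset.prod_eq_zero_iff] at hdet
      intro k hk h
      exact hdet ⟨⟨k, hk⟩, Finset.mem_univ _, h⟩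
    rw [rotProd_congr (n - 1) fun i hi => givensRot_eq_blockCS h1 i (by omega)]
    exact isBlockQR_tridiag hn

end

/-! ### Bulge chasing along a path -/

/-- The data of an implicit double-shift QR step on a path. A bidiagonal matrix with its diagonal
and superdiagonal entries `b 2, b 3, …` is the weighted path whose nodes `2, 3, 4, …` are,
alternately, its columns and its rows, `b m` being the weight of the edge from `m` to `m + 1`. The
square of the adjacency matrix of this path, minus `σ ^ 2`, couples only nodes of equal parity; `(c
m, s m)` is the rotation of the nodes `m`, `m + 2` in the QR factorizations of its two tridiagonal
parts, and `p m` the pivot. The two empty nodes `0`, `1` spare the treatment of the first two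
rotations as special cases. -/
structure ChaseData (b c s p : ℕ → ℝ) (σ : ℝ) : Prop where
  b_zero : b 0 = 0
  b_one : b 1 = 0
  c_zero : c 0 = 1
  c_one : c 1 = 1
  s_zero : s 0 = 0
  s_one : s 1 = 0
  pivot : ∀ m, p (m + 2) = c m * (b (m + 1) ^ 2 + b (m + 2) ^ 2 - σ ^ 2) -
    s m * c (m - 2) * (b m * b (m + 1))
  rot : ∀ m, (c (m + 2), s (m + 2)) = givensCS (p (m + 2), b (m + 2) * b (m + 3))

/-- The weight of the edge from `m + 1` to `m + 2` just before the rotation of `m + 1`, `m + 3`. -/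
def chaseH (b c s : ℕ → ℝ) : ℕ → ℝ
  | 0 => 0
  | m + 1 => -s (m + 1) * chaseH b c s m + c (m + 1) * (c m * b (m + 2))

/-- The weight of the edge from `m + 1` to `m + 2` just after the rotation of `m + 1`, `m + 3`. -/
def chaseF (b c s : ℕ → ℝ) (m : ℕ) : ℝ :=
  c (m + 1) * chaseH b c s m + s (m + 1) * (c m * b (m + 2))

namespace ChaseData

variable {b c s p : ℕ → ℝ} {σ : ℝ}

theorem norm (h : ChaseData b c s p σ) : ∀ m, c m ^ 2 + s m ^ 2 = 1
  | 0 => by simp [h.c_zero, h.s_zero]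
  | 1 => by simp [h.c_one, h.s_one]
  | m + 2 => by
    have := givensCS_norm (p (m + 2), b (m + 2) * b (m + 3))
    rwa [← h.rot m] at this

theorem cross (h : ChaseData b c s p σ) (m : ℕ) :
    s (m + 2) * p (m + 2) = c (m + 2) * (b (m + 2) * b (m + 3)) := by
  have := givensCS_cross (p (m + 2), b (m + 2) * b (m + 3))
  rwa [← h.rot m] at this

theorem c_eq_zero (h : ChaseData b c s p σ) {m : ℕ} (hp : p (m + 2) = 0) : c (m + 2) = 0 := by
  have := givensCS_fst_eq_zero (x := (p (m + 2), b (m + 2) * b (m + 3))) hp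
  rwa [← h.rot m] at this

/-- The length, up to sign, of the vector that determines rotation `m`. -/
def len (b c s p : ℕ → ℝ) (m : ℕ) : ℝ := c m * p m + s m * (b m * b (m + 1))

theorem len_mul_c (h : ChaseData b c s p σ) (m : ℕ) :
    len b c s p (m + 2) * c (m + 2) = p (m + 2) := by
  unfold len
  linear_combination p (m + 2) * h.norm (m + 2) - s (m + 2) * h.cross m

theorem len_mul_s (h : ChaseData b c s p σ) (m : ℕ) :
    len b c s p (m + 2) * s (m + 2) = b (m + 2) * b (m + 3) := by
  unfold len
  linear_combination b (m + 2) * b (m + 3) * h.norm (m + 2) + c (m + 2) * h.cross m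

/-- The invariants of the chase just before the rotation of `m + 2`, `m + 4`: the square of the
current path matrix minus `σ ^ 2` is what the explicit QR steps produce (`sq`, `sq'`), the
triangular factors intertwine with the path matrix (`tri`), and the rotation annihilates the bulge
(`bulge`). -/
structure Inv (b c s p : ℕ → ℝ) (σ : ℝ) (m : ℕ) : Prop where
  sq : chaseH b c s m ^ 2 + c m ^ 2 * b (m + 2) ^ 2 - σ ^ 2 = c m * p (m + 2)
  sq' : chaseH b c s (m + 1) ^ 2 + c (m + 1) ^ 2 * b (m + 3) ^ 2 - σ ^ 2 = c (m + 1) * p (m + 3)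
  tri : chaseH b c s (m + 1) * p (m + 2) + c (m + 1) * b (m + 3) * (b (m + 2) * b (m + 3)) =
    b (m + 2) * p (m + 3)
  bulge : s (m + 2) * chaseF b c s m = c (m + 2) * (s (m + 1) * b (m + 3))

theorem chaseF_sq_add (h : ChaseData b c s p σ) (m : ℕ) :
    chaseF b c s m ^ 2 + chaseH b c s (m + 1) ^ 2 =
      chaseH b c s m ^ 2 + c m ^ 2 * b (m + 2) ^ 2 := by
  rw [chaseF, chaseH]
  linear_combination (chaseH b c s m ^ 2 + c m ^ 2 * b (m + 2) ^ 2) * h.norm (m + 1)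

theorem chaseF_mul_add (h : ChaseData b c s p σ) (m : ℕ) :
    chaseF b c s m * (s (m + 1) * b (m + 3)) + chaseH b c s (m + 1) * (c (m + 1) * b (m + 3)) =
      c m * (b (m + 2) * b (m + 3)) := by
  rw [chaseF, chaseH]
  linear_combination (c m * b (m + 2) * b (m + 3)) * h.norm (m + 1)

theorem Inv.len_mul_chaseF (h : ChaseData b c s p σ) {m : ℕ} (i : Inv b c s p σ m) :
    len b c s p (m + 2) * chaseF b c s (m + 1) = b (m + 2) * p (m + 3) := by
  rw [← i.tri, chaseF]
  linear_combination chaseH b c s (m + 1) * h.len_mul_c m + c (m + 1) * b (m + 3) * h.len_mul_s m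

/-- If rotation `m + 2` is determined by a zero vector at the end of a path component, then either
the shift is zero or the rotation before it also belongs to a singular leading block. -/
theorem Inv.shift_eq_zero (h : ChaseData b c s p σ) {m : ℕ} (i : Inv b c s p σ m)
    (hm : ∀ k, m = k + 1 → Inv b c s p σ k) (hb : b (m + 2) = 0) (hp : p (m + 2) = 0) :
    c (m + 1) * σ ^ 2 = 0 := by
  rcases m with _ | k
  · -- the first column has no other entry, so its pivot is `-σ ^ 2`
    have := h.pivot 0
    simp only [Nat.zero_add] at *
    rw [hp, hb, h.b_one, h.b_zero, h.c_zero] at this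
    linear_combination c 1 * this
  · have j := hm k rfl
    by_contra hne
    have hc : c (k + 2) ≠ 0 := left_ne_zero_of_mul hne
    have hp' : p (k + 2) ≠ 0 := fun h' => hc (h.c_eq_zero h')
    have hr : len b c s p (k + 2) ≠ 0 := fun h' => hp' (by rw [← h.len_mul_c k, h', zero_mul])
    have hs : s (k + 2) = 0 := by
      have := h.len_mul_s k
      rw [show k + 3 = k + 1 + 2 by ring, hb, mul_zero] at this
      exact (mul_eq_zero.mp this).resolve_left hr
    have hF : chaseF b c s (k + 1) = 0 := by
      have := j.len_mul_chaseF h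
      rw [show k + 3 = k + 1 + 2 by ring, hp, mul_zero] at this
      exact (mul_eq_zero.mp this).resolve_left hr
    have hH : chaseH b c s (k + 2) = 0 := by
      rw [chaseH, hs, show k + 1 + 2 = k + 3 by ring, show b (k + 3) = 0 from hb]
      ring
    have h1 := h.chaseF_sq_add (k + 1)
    rw [hF, hH] at h1
    apply hne
    linear_combination (-c (k + 1 + 1)) * i.sq + (-c (k + 1 + 1)) * h1 +
      (-c (k + 1 + 1)) * c (k + 1) * hp

/-- The vector `(chaseF b c s (m + 1), s (m + 2) * b (m + 4))` found in the row or column before the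
bulge is colinear with the vector of the explicit QR step. -/
theorem Inv.colinear (h : ChaseData b c s p σ) {m : ℕ} (i : Inv b c s p σ m)
    (hm : ∀ k, m = k + 1 → Inv b c s p σ k) :
    (len b c s p (m + 2) ≠ 0 ∧ len b c s p (m + 2) * chaseF b c s (m + 1) = b (m + 2) * p (m + 3) ∧
      len b c s p (m + 2) * (s (m + 2) * b (m + 4)) = b (m + 2) * (b (m + 3) * b (m + 4))) ∨
    (p (m + 3) = b (m + 3) * chaseF b c s (m + 1) ∧
      b (m + 3) * b (m + 4) = b (m + 3) * (s (m + 2) * b (m + 4)) ∧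
      chaseF b c s (m + 1) = c (m + 1) * b (m + 3) ∧ c (m + 2) = 0 ∧ s (m + 2) = 1) := by
  by_cases hr : len b c s p (m + 2) = 0
  · right
    have hp : p (m + 2) = 0 := by rw [← h.len_mul_c, hr, zero_mul]
    have hbb : b (m + 2) * b (m + 3) = 0 := by rw [← h.len_mul_s, hr, zero_mul]
    have hcs : (c (m + 2), s (m + 2)) = (0, 1) := by
      rw [h.rot m, hp, hbb, givensCS_zero_left]
    obtain ⟨hc, hs⟩ := Prod.ext_iff.mp hcs
    dsimp only at hc hs
    have hF : chaseF b c s (m + 1) = c (m + 1) * b (m + 3) := by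
      rw [chaseF, show m + 1 + 1 = m + 2 by ring, hc, hs, show m + 1 + 2 = m + 3 by ring]
      ring
    have htri := i.tri
    rw [hp, hbb, mul_zero, mul_zero, add_zero] at htri
    refine ⟨?_, by rw [hs, one_mul], hF, hc, hs⟩
    rw [hF]
    rcases mul_eq_zero.mp htri.symm with h0 | h0
    · -- the only case in which the shift matters
      have hz := i.shift_eq_zero h hm h0 hp
      have hpiv := h.pivot (m + 1)
      rw [show m + 1 + 1 = m + 2 by ring, show m + 1 + 2 = m + 3 by ring, h0] at hpiv
      linear_combination hpiv - hz
    · rw [h0]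
      by_cases h1 : b (m + 3) = 0
      · rw [h1]; ring
      · have h2 : b (m + 2) = 0 := (mul_eq_zero.mp hbb).resolve_right h1
        have hz := i.shift_eq_zero h hm h2 hp
        have hpiv := h.pivot (m + 1)
        rw [show m + 1 + 1 = m + 2 by ring, show m + 1 + 2 = m + 3 by ring, h2] at hpiv
        linear_combination (-1 : ℝ) * h0 + hpiv - hz
  · left
    refine ⟨hr, i.len_mul_chaseF h, ?_⟩
    linear_combination b (m + 4) * h.len_mul_s m

theorem Inv.bulge_succ (h : ChaseData b c s p σ) {m : ℕ} (i : Inv b c s p σ m)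
    (hm : ∀ k, m = k + 1 → Inv b c s p σ k) :
    s (m + 3) * chaseF b c s (m + 1) = c (m + 3) * (s (m + 2) * b (m + 4)) := by
  have hx := h.cross (m + 1)
  rw [show m + 1 + 2 = m + 3 by ring, show m + 1 + 3 = m + 4 by ring] at hx
  rcases i.colinear h hm with ⟨hr, h1, h2⟩ | ⟨h1, h2, h3, h4, h5⟩
  · refine mul_left_cancel₀ hr ?_
    linear_combination s (m + 3) * h1 - c (m + 3) * h2 + b (m + 2) * hx
  · by_cases hb : b (m + 3) = 0
    · have hp : p (m + 1 + 2) = 0 := by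
        rw [show m + 1 + 2 = m + 3 by ring, h1, hb, zero_mul]
      rw [h3, hb, show m + 3 = m + 1 + 2 by ring, h.c_eq_zero hp]
      ring
    · refine mul_left_cancel₀ hb ?_
      linear_combination (-s (m + 3)) * h1 + c (m + 3) * h2 + hx

theorem inv_zero (h : ChaseData b c s p σ) : Inv b c s p σ 0 := by
  have hp2 := h.pivot 0
  have hp3 := h.pivot 1
  simp only [Nat.zero_add, Nat.reduceAdd, h.b_zero, h.b_one, h.c_zero, h.c_one, h.s_zero, h.s_one,
    Nat.reduceSub] at *
  refine ⟨?_, ?_, ?_, ?_⟩ <;>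
    simp only [chaseH, chaseF, Nat.zero_add, h.c_zero, h.c_one, h.s_one]
  · linear_combination -hp2
  · linear_combination -hp3
  · linear_combination b 2 * hp2 - b 2 * hp3
  · ring

theorem Inv.succ (h : ChaseData b c s p σ) {m : ℕ} (i : Inv b c s p σ m)
    (hm : ∀ k, m = k + 1 → Inv b c s p σ k) : Inv b c s p σ (m + 1) := by
  have hpiv := h.pivot (m + 2)
  have hF := h.chaseF_mul_add m
  have hFF := h.chaseF_sq_add m
  have hn1 := h.norm (m + 1)
  have hn2 := h.norm (m + 2)
  have hx := h.cross m
  have hsq := i.sq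
  have hsq' := i.sq'
  have hb := i.bulge
  rw [show m + 2 + 2 = m + 4 by ring, show m + 2 + 1 = m + 3 by ring,
    show m + 2 - 2 = m by omega] at hpiv
  have hF1 : b (m + 3) * chaseF b c s (m + 1) = s (m + 2) * p (m + 3) := by
    rcases i.colinear h hm with ⟨hr, h1, -⟩ | ⟨h1, -, -, -, h5⟩
    · refine mul_left_cancel₀ hr ?_
      linear_combination b (m + 3) * h1 - p (m + 3) * h.len_mul_s m
    · rw [h1, h5, one_mul]
  refine ⟨i.sq', ?_, ?_, i.bulge_succ h hm⟩
  · rw [show m + 1 + 3 = m + 4 by ring, show m + 1 + 1 = m + 2 by ring, hpiv,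
      show chaseH b c s (m + 2) = -s (m + 2) * chaseH b c s (m + 1) +
        c (m + 2) * (c (m + 1) * b (m + 3)) from rfl]
    linear_combination c (m + 2) ^ 2 * b (m + 3) ^ 2 * hn1 + σ ^ 2 * hn2 -
      2 * c (m + 2) * s (m + 2) * hF + s (m + 2) * c m * hx + s (m + 2) ^ 2 * hsq +
      s (m + 2) ^ 2 * hFF -
      (s (m + 2) * chaseF b c s m - c (m + 2) * (s (m + 1) * b (m + 3))) * hb
  · rw [show m + 1 + 3 = m + 4 by ring, show m + 1 + 1 = m + 2 by ring,
      show m + 1 + 2 = m + 3 by ring, hpiv,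
      show chaseH b c s (m + 2) = -s (m + 2) * chaseH b c s (m + 1) +
        c (m + 2) * (c (m + 1) * b (m + 3)) from rfl]
    rw [show chaseF b c s (m + 1) = c (m + 2) * chaseH b c s (m + 1) +
      s (m + 2) * (c (m + 1) * b (m + 3)) from rfl] at hF1
    linear_combination c (m + 2) * b (m + 3) * (b (m + 3) ^ 2 * hn1 - hsq') -
      s (m + 2) * b (m + 3) * hF + b (m + 3) * s (m + 1) * b (m + 3) * hb +
      chaseH b c s (m + 1) * hF1

theorem inv (h : ChaseData b c s p σ) (m : ℕ) : Inv b c s p σ m := by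
  induction m using Nat.strong_induction_on with
  | _ m ih =>
    rcases m with _ | m
    · exact h.inv_zero
    · exact (ih m (by omega)).succ h fun k hk => ih k (by omega)

/-- Rotation `m + 3` is determined by the vector found in the row or column before the bulge,
provided that this vector is not zero. -/
theorem rot_eq_of_ne_zero (h : ChaseData b c s p σ) (m : ℕ)
    (hv : ¬ (chaseF b c s (m + 1) = 0 ∧ s (m + 2) * b (m + 4) = 0)) :
    givensCS (chaseF b c s (m + 1), s (m + 2) * b (m + 4)) = (c (m + 3), s (m + 3)) := by
  rw [show (c (m + 3), s (m + 3)) = givensCS (p (m + 3), b (m + 3) * b (m + 4)) from h.rot (m + 1)]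
  rcases (h.inv m).colinear h fun k _ => h.inv k with ⟨hr, h1, h2⟩ | ⟨h1, h2, h3, -⟩
  · have hb : b (m + 2) ≠ 0 := by
      intro h0
      rw [h0, zero_mul] at h1 h2
      exact hv ⟨(mul_eq_zero.mp h1).resolve_left hr, (mul_eq_zero.mp h2).resolve_left hr⟩
    rw [← givensCS_smul hr, ← givensCS_smul hb (p (m + 3), _)]
    simp only [Prod.smul_mk, smul_eq_mul, h1, h2]
  · by_cases hb : b (m + 3) = 0
    · rw [h1, h3, hb]
      simp [givensCS_zero_left]
    · rw [← givensCS_smul hb, h1, h2]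
      simp only [Prod.smul_mk, smul_eq_mul]

/-- If the vector before the bulge is zero, then rotation `m + 2` is determined by the first column
of the shifted square of the remaining path matrix. -/
theorem rot_eq_of_eq_zero (h : ChaseData b c s p σ) (m : ℕ)
    (hv : chaseF b c s m = 0 ∧ s (m + 1) * b (m + 3) = 0) :
    givensCS (chaseH b c s (m + 1) ^ 2 - σ ^ 2, chaseH b c s (m + 1) * (c (m + 1) * b (m + 3))) =
      (c (m + 2), s (m + 2)) := by
  have h1 := h.chaseF_sq_add m
  have h2 := h.chaseF_mul_add m
  have h3 := (h.inv m).sq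
  rw [hv.1] at h1 h2
  have e : (chaseH b c s (m + 1) ^ 2 - σ ^ 2, chaseH b c s (m + 1) * (c (m + 1) * b (m + 3))) =
      c m • (p (m + 2), b (m + 2) * b (m + 3)) := by
    simp only [Prod.smul_mk, smul_eq_mul]
    refine Prod.ext ?_ ?_
    · dsimp only
      linear_combination h1 + h3
    · dsimp only
      linear_combination h2
  rw [e, h.rot m]
  by_cases hc : c m = 0
  · -- both vectors have a vanishing first coordinate
    suffices hp : p (m + 2) = 0 by rw [hc, hp, zero_smul, Prod.zero_eq_mk, givensCS_zero_left,
      givensCS_zero_left]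
    rcases m with _ | _ | m
    · rw [h.c_zero] at hc; exact absurd hc one_ne_zero
    · rw [h.c_one] at hc; exact absurd hc one_ne_zero
    · have hpiv := h.pivot (m + 2)
      rw [hc, show m + 2 - 2 = m by omega, show m + 2 + 1 = m + 3 by ring] at hpiv
      rcases (h.inv (m + 1)).colinear h fun k _ => h.inv k with ⟨hr, h4, -⟩ | ⟨h4, -, h5, -⟩
      · rw [show m + 1 + 1 = m + 2 by ring, hv.1, mul_zero] at h4
        rcases mul_eq_zero.mp h4.symm with h6 | h6
        · rw [hpiv, show b (m + 3) = 0 from h6]; ring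
        · exact h6
      · rw [show m + 2 + 2 = m + 1 + 3 by ring, h4, h5, show c (m + 1 + 1) = 0 from hc]
        ring
  · rw [givensCS_smul hc]

end ChaseData

/-! ### The matrices that occur in the chase -/

/-- The weight of the edge from node `y + 2` to node `y + 3` just before the rotation of the nodes
`m + 2`, `m + 4`. -/
def chaseEdge (b c s : ℕ → ℝ) (m y : ℕ) : ℝ :=
  if y + 1 < m then c (y + 3) * chaseF b c s (y + 1) + s (y + 3) * (s (y + 2) * b (y + 4))
  else if y + 1 = m then chaseF b c s (y + 1)
  else if y = m then chaseH b c s (y + 1)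
  else if y = m + 1 then c y * b (y + 2)
  else b (y + 2)

/-- The weight of the edge from node `y + 2` to node `y + 5`, nonzero only at the bulge. -/
def chaseBulge (b s : ℕ → ℝ) (m y : ℕ) : ℝ := if y + 1 = m then s (y + 2) * b (y + 4) else 0

/-- The adjacency matrix of the path just before the rotation of the nodes `m + 2`, `m + 4`. The
indices `x`, `y` stand for the nodes `x + 2`, `y + 2`. -/
def chaseMat (b c s : ℕ → ℝ) (m x y : ℕ) : ℝ :=
  if y = x + 1 then chaseEdge b c s m x
  else if x = y + 1 then chaseEdge b c s m y
  else if y = x + 3 then chaseBulge b s m x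
  else if x = y + 3 then chaseBulge b s m y
  else 0

theorem chaseMat_symm (b c s : ℕ → ℝ) (m x y : ℕ) :
    chaseMat b c s m x y = chaseMat b c s m y x := by
  unfold chaseMat
  split_ifs <;> first | omega | rfl

section

variable {b c s p : ℕ → ℝ} {σ : ℝ}

theorem chaseMat_eq_zero {m x y : ℕ} (h1 : y ≠ x + 1) (h2 : x ≠ y + 1)
    (h3 : ¬ (x + 1 = m ∧ y = m + 2)) (h4 : ¬ (y + 1 = m ∧ x = m + 2)) :
    chaseMat b c s m x y = 0 := by
  unfold chaseMat chaseBulge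
  split_ifs <;> first | rfl | omega

theorem chaseMat_up (m x : ℕ) : chaseMat b c s m x (x + 1) = chaseEdge b c s m x := if_pos rfl

theorem chaseMat_down (m x : ℕ) : chaseMat b c s m (x + 1) x = chaseEdge b c s m x := by
  rw [chaseMat_symm, chaseMat_up]

theorem chaseMat_up_bulge (m : ℕ) : chaseMat b c s (m + 1) m (m + 3) = s (m + 2) * b (m + 4) := by
  rw [chaseMat, if_neg (by omega), if_neg (by omega), if_pos rfl, chaseBulge, if_pos rfl]

theorem chaseMat_down_bulge (m : ℕ) : chaseMat b c s (m + 1) (m + 3) m = s (m + 2) * b (m + 4) := by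
  rw [chaseMat_symm, chaseMat_up_bulge]

theorem chaseEdge_pred (m : ℕ) : chaseEdge b c s (m + 1) m = chaseF b c s (m + 1) := by
  rw [chaseEdge, if_neg (by omega), if_pos rfl]

theorem chaseEdge_self (m : ℕ) : chaseEdge b c s m m = chaseH b c s (m + 1) := by
  rw [chaseEdge, if_neg (by omega), if_neg (by omega), if_pos rfl]

theorem chaseEdge_succ (m : ℕ) : chaseEdge b c s m (m + 1) = c (m + 1) * b (m + 3) := by
  rw [chaseEdge, if_neg (by omega), if_neg (by omega), if_neg (by omega), if_pos rfl]

theorem chaseEdge_of_gt {m y : ℕ} (h : m + 1 < y) : chaseEdge b c s m y = b (y + 2) := by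
  rw [chaseEdge, if_neg (by omega), if_neg (by omega), if_neg (by omega), if_neg (by omega)]

theorem chaseMat_succ_of_ne (m x y : ℕ) (hx : x % 2 = m % 2) (h1 : x ≠ m) (h2 : x ≠ m + 2) :
    chaseMat b c s (m + 1) x y = chaseMat b c s m x y := by
  unfold chaseMat chaseBulge chaseEdge
  split_ifs <;> first | rfl | omega

/-- The rotation of the nodes `m + 2`, `m + 4`, seen from any node `y + 2` of the other parity. -/
theorem ChaseData.chaseMat_succ (h : ChaseData b c s p σ) (m y : ℕ) (hy : y % 2 ≠ m % 2) :
    chaseMat b c s (m + 1) m y = c (m + 2) * chaseMat b c s m m y +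
      s (m + 2) * chaseMat b c s m (m + 2) y ∧
    chaseMat b c s (m + 1) (m + 2) y = -s (m + 2) * chaseMat b c s m m y +
      c (m + 2) * chaseMat b c s m (m + 2) y := by
  have key : y + 1 = m ∨ y = m + 1 ∨ y = m + 3 ∨ (y ≠ m + 1 ∧ m ≠ y + 1 ∧ y ≠ m + 3) := by
    omega
  rcases key with rfl | rfl | rfl | ⟨h1, h2, h3⟩
  · have hb := (h.inv (y + 1)).bulge
    rw [chaseMat_down, chaseMat_down, show y + 1 + 2 = y + 3 by ring, chaseMat_down_bulge,
      chaseEdge_pred, chaseEdge, if_pos (by omega), chaseMat_eq_zero] <;> try omega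
    refine ⟨rfl, ?_⟩
    linear_combination hb
  · rw [chaseMat_up, chaseMat_up, chaseMat_down _ (m + 1), chaseMat_down _ (m + 1), chaseEdge_pred,
      chaseEdge_self, chaseEdge_self, chaseEdge_succ]
    exact ⟨rfl, rfl⟩
  · rw [chaseMat_up_bulge, chaseMat_up _ (m + 2), chaseMat_up _ (m + 2), chaseMat_eq_zero,
      chaseEdge_of_gt, chaseEdge_succ] <;> try omega
    constructor <;> ring
  · constructor
    · rw [chaseMat_eq_zero, chaseMat_eq_zero, chaseMat_eq_zero] <;> first | omega | ring
    · rw [chaseMat_eq_zero, chaseMat_eq_zero, chaseMat_eq_zero] <;> first | omega | ring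

end

/-- `B` is the biadjacency matrix (rows by columns) of the path just before the rotation of the
nodes `m + 2`, `m + 4`. Row `i` is the node `2 i + 3` and column `j` the node `2 j + 2`. -/
def IsChase {n : ℕ} (b c s : ℕ → ℝ) (m : ℕ) (B : Matrix (Fin n) (Fin n) ℝ) : Prop :=
  ∀ i j : Fin n, B i j = chaseMat b c s m (2 * i + 1) (2 * j)

section

variable {n : ℕ} {b c s p : ℕ → ℝ} {σ : ℝ} {B : Matrix (Fin n) (Fin n) ℝ}

theorem IsChase.mul_planeRot (h : ChaseData b c s p σ) {k : ℕ} (hk : k + 1 < n)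
    (hB : IsChase b c s (2 * k) B) :
    IsChase b c s (2 * k + 1) (B * planeRot n k (c (2 * k + 2), s (2 * k + 2))) := by
  intro i j
  have h1 := h.chaseMat_succ (2 * k) (2 * i + 1) (by omega)
  rw [CSD.mul_planeRot hk, chaseMat_symm]
  simp only [hB i, chaseMat_symm b c s (2 * k) (2 * i + 1)]
  split_ifs with h2 h3
  · rw [h2, h1.1]
    rfl
  · rw [h3, show 2 * (k + 1) = 2 * k + 2 by ring, h1.2]
  · rw [chaseMat_succ_of_ne] <;> omega

theorem IsChase.planeRot_mul (h : ChaseData b c s p σ) {k : ℕ} (hk : k + 1 < n)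
    (hB : IsChase b c s (2 * k + 1) B) :
    IsChase b c s (2 * k + 2) ((planeRot n k (c (2 * k + 3), s (2 * k + 3)))ᵀ * B) := by
  intro i j
  have h1 := h.chaseMat_succ (2 * k + 1) (2 * j) (by omega)
  rw [CSD.planeRot_transpose_mul hk]
  simp only [hB _ j]
  split_ifs with h2 h3
  · rw [h2, h1.1]
    rfl
  · rw [h3, show 2 * (k + 1) + 1 = 2 * k + 1 + 2 by ring, h1.2]
  · rw [chaseMat_succ_of_ne (2 * k + 1)] <;> omega

theorem IsChase.entry_eq {m i j : ℕ} (hB : IsChase b c s m B) (hi : i < n) (hj : j < n) :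
    entry B i j = chaseMat b c s m (2 * i + 1) (2 * j) := by
  rw [entry, dif_pos ⟨hi, hj⟩, hB]

theorem IsBulgeStart.givensCS_eq {bs : ℝ × ℝ → ℝ → ℝ × ℝ} (hbs : IsBulgeStart bs) (hσ : 0 ≤ σ)
    (x y : ℝ) : givensCS (bs (x, y) σ) = givensCS (x ^ 2 - σ ^ 2, x * y) := by
  obtain ⟨t, ht, h⟩ := hbs (x, y) σ hσ
  rw [h, givensCS_smul ht]

/-- The right rotations of the algorithm are those of the explicit QR step. -/
theorem IsChase.givensCS_rightVector (h : ChaseData b c s p σ) {bs : ℝ × ℝ → ℝ → ℝ × ℝ}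
    (hbs : IsBulgeStart bs) (hσ : 0 ≤ σ) {k : ℕ} (hk : k + 1 < n) (hB : IsChase b c s (2 * k) B) :
    givensCS (rightVector bs B σ k) = (c (2 * k + 2), s (2 * k + 2)) := by
  have e3 : entry B k k = chaseH b c s (2 * k + 1) := by
    rw [hB.entry_eq (by omega) (by omega), chaseMat_down, chaseEdge_self]
  have e4 : entry B k (k + 1) = c (2 * k + 1) * b (2 * k + 3) := by
    rw [hB.entry_eq (by omega) (by omega)]
    exact (chaseMat_up _ _).trans (chaseEdge_succ _)
  rcases k with _ | k
  · rw [rightVector, if_pos (Or.inl rfl), hbs.givensCS_eq hσ, e3, e4]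
    refine h.rot_eq_of_eq_zero 0 ⟨?_, ?_⟩ <;> simp [chaseF, chaseH, h.s_one]
  have e1 : entry B k (k + 1) = chaseF b c s (2 * k + 2) := by
    rw [hB.entry_eq (by omega) (by omega)]
    exact (chaseMat_up _ _).trans (chaseEdge_pred _)
  have e2 : entry B k (k + 1 + 1) = s (2 * k + 3) * b (2 * k + 5) := by
    rw [hB.entry_eq (by omega) (by omega)]
    exact chaseMat_up_bulge (2 * k + 1)
  rw [rightVector, Nat.add_sub_cancel, e1, e2]
  by_cases h0 : chaseF b c s (2 * k + 2) = 0 ∧ s (2 * k + 3) * b (2 * k + 5) = 0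
  · rw [if_pos (Or.inr h0), hbs.givensCS_eq hσ, e3, e4]
    exact h.rot_eq_of_eq_zero (2 * (k + 1)) h0
  · rw [if_neg (by rintro (h' | h'); exacts [by omega, h0 h'])]
    exact h.rot_eq_of_ne_zero (2 * k + 1) h0

/-- The left rotations of the algorithm are those of the explicit QR step. -/
theorem IsChase.givensCS_leftVector (h : ChaseData b c s p σ) {bs : ℝ × ℝ → ℝ → ℝ × ℝ}
    (hbs : IsBulgeStart bs) (hσ : 0 ≤ σ) {k : ℕ} (hk : k + 1 < n)
    (hB : IsChase b c s (2 * k + 1) B) :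
    givensCS (leftVector bs B σ k) = (c (2 * k + 3), s (2 * k + 3)) := by
  have e1 : entry B k k = chaseF b c s (2 * k + 1) := by
    rw [hB.entry_eq (by omega) (by omega), chaseMat_down, chaseEdge_pred]
  have e2 : entry B (k + 1) k = s (2 * k + 2) * b (2 * k + 4) := by
    rw [hB.entry_eq (by omega) (by omega)]
    exact chaseMat_down_bulge (2 * k)
  have e3 : entry B k (k + 1) = chaseH b c s (2 * k + 2) := by
    rw [hB.entry_eq (by omega) (by omega)]
    exact (chaseMat_up _ _).trans (chaseEdge_self _)
  have e4 : entry B (k + 1) (k + 1) = c (2 * k + 2) * b (2 * k + 4) := by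
    rw [hB.entry_eq (by omega) (by omega)]
    exact (chaseMat_down _ (2 * k + 2)).trans (chaseEdge_succ _)
  rw [leftVector, e1, e2]
  split_ifs with h0
  · rw [hbs.givensCS_eq hσ, e3, e4]
    exact h.rot_eq_of_eq_zero (2 * k + 1) h0
  · exact h.rot_eq_of_ne_zero (2 * k) h0

theorem IsChase.isUpperBidiagonal (hB : IsChase b c s (2 * (n - 1)) B) : IsUpperBidiagonal B := by
  intro i j hij
  by_contra h
  refine hij ?_
  rw [hB, chaseMat_eq_zero] <;> omega

end

/-! ### Explicit QR steps on a bidiagonal matrix -/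

/-- The entries of an upper bidiagonal matrix along its path, after two zeros. -/
def pathWeight {n : ℕ} (B : Matrix (Fin n) (Fin n) ℝ) : ℕ → ℝ
  | 0 => 0
  | 1 => 0
  | m + 2 => entry B (m / 2) ((m + 1) / 2)

/-- The diagonal of the shifted square of the path matrix at the nodes `2 i + e + 2`. -/
def pathDiag (b : ℕ → ℝ) (σ : ℝ) (e i : ℕ) : ℝ :=
  b (2 * i + e + 1) ^ 2 + b (2 * i + e + 2) ^ 2 - σ ^ 2

/-- The entry of the shifted square of the path matrix that couples the nodes `2 i + e + 2` and
`2 i + e + 4`. -/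
def pathOff (b : ℕ → ℝ) (e i : ℕ) : ℝ := b (2 * i + e + 2) * b (2 * i + e + 3)

/-- The rotations of the explicit QR step on the nodes `2 i + e + 2`: the right ones for `e = 0`,
the left ones for `e = 1`. -/
def stepRot (b : ℕ → ℝ) (σ : ℝ) (e i : ℕ) : ℝ × ℝ :=
  givensRot givensCS (pathDiag b σ e) (pathOff b e) i

/-- The interleaved rotations of the two explicit QR steps. -/
def pathRot (b : ℕ → ℝ) (σ : ℝ) : ℕ → ℝ × ℝ
  | 0 => (1, 0)
  | 1 => (1, 0)
  | m + 2 => stepRot b σ (m % 2) (m / 2)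

/-- The pivots of the two explicit QR steps, interleaved in the same way. -/
def pathPivot (b : ℕ → ℝ) (σ : ℝ) : ℕ → ℝ
  | 0 => 0
  | 1 => 0
  | m + 2 => (givensSeq givensCS (pathDiag b σ (m % 2)) (pathOff b (m % 2)) (m / 2)).2

theorem chaseData_path (b : ℕ → ℝ) (σ : ℝ) (h0 : b 0 = 0) (h1 : b 1 = 0) :
    ChaseData b (fun m => (pathRot b σ m).1) (fun m => (pathRot b σ m).2) (pathPivot b σ) σ where
  b_zero := h0
  b_one := h1
  c_zero := rfl
  c_one := rfl
  s_zero := rfl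
  s_one := rfl
  pivot m := by
    rcases m with _ | _ | m
    · simp [pathPivot, givensSeq, pathDiag, pathRot]
    · simp [pathPivot, givensSeq, pathDiag, pathRot]
    · have e1 : (m + 2) % 2 = m % 2 := by omega
      have e2 : (m + 2) / 2 = m / 2 + 1 := by omega
      have e3 : (givensSeq givensCS (pathDiag b σ (m % 2)) (pathOff b (m % 2)) (m / 2)).1 =
          (pathRot b σ m).1 := by
        rcases m with _ | _ | m
        · rfl
        · rfl
        · rw [show (m + 1 + 1) % 2 = m % 2 by omega, show (m + 1 + 1) / 2 = m / 2 + 1 by omega]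
          rfl
      have e4 : 2 * (m / 2 + 1) + m % 2 = m + 2 := by omega
      have e5 : 2 * (m / 2) + m % 2 = m := by omega
      rw [show m + 1 + 1 - 2 = m by omega, ← e3]
      simp only [pathPivot, e1, e2, givensSeq, pathRot, stepRot, givensRot, pathDiag, pathOff, e4,
        e5]
  rot m := by
    have e5 : 2 * (m / 2) + m % 2 = m := by omega
    simp only [pathRot, stepRot, givensRot, pathOff, pathPivot, e5]

section

variable {n : ℕ} {B : Matrix (Fin n) (Fin n) ℝ} {σ : ℝ}

/-- `IsChase` for the rotations of the explicit QR steps. -/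
def IsPathChase (b : ℕ → ℝ) (σ : ℝ) (m : ℕ) (B : Matrix (Fin n) (Fin n) ℝ) : Prop :=
  IsChase b (fun m => (pathRot b σ m).1) (fun m => (pathRot b σ m).2) m B

theorem pathRot_even (b : ℕ → ℝ) (σ : ℝ) (k : ℕ) : pathRot b σ (2 * k + 2) = stepRot b σ 0 k := by
  rw [pathRot, show 2 * k % 2 = 0 by omega, show 2 * k / 2 = k by omega]

theorem pathRot_odd (b : ℕ → ℝ) (σ : ℝ) (k : ℕ) : pathRot b σ (2 * k + 3) = stepRot b σ 1 k := by
  rw [pathRot, show (2 * k + 1) % 2 = 1 by omega, show (2 * k + 1) / 2 = k by omega]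

theorem isPathChase_zero (hB : IsUpperBidiagonal B) (σ : ℝ) :
    IsPathChase (pathWeight B) σ 0 B := by
  intro i j
  have hedge : ∀ y, chaseEdge (pathWeight B) (fun m => (pathRot (pathWeight B) σ m).1)
      (fun m => (pathRot (pathWeight B) σ m).2) 0 y = entry B (y / 2) ((y + 1) / 2) := by
    rintro (_ | _ | y)
    · rw [chaseEdge_self]
      simp [chaseH, pathRot, pathWeight]
    · rw [chaseEdge_succ]
      simp [pathRot, pathWeight]
    · rw [chaseEdge_of_gt (by omega)]
      rfl
  have hij : B i j = entry B i j := by simp [entry]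
  have key : (j : ℕ) = i ∨ (j : ℕ) = i + 1 ∨ ((j : ℕ) ≠ i ∧ (j : ℕ) ≠ i + 1) := by omega
  rcases key with h | h | ⟨h, h'⟩
  · rw [hij, h, chaseMat_down, hedge]
    congr <;> omega
  · rw [hij, h, show 2 * ((i : ℕ) + 1) = 2 * i + 1 + 1 by ring, chaseMat_up, hedge]
    congr <;> omega
  · rw [chaseMat_eq_zero] <;> try omega
    by_contra h0
    exact (hB i j h0).elim h h'

variable {b : ℕ → ℝ} {bs : ℝ × ℝ → ℝ → ℝ × ℝ}

theorem IsPathChase.mul_planeRot (h0 : b 0 = 0) (h1 : b 1 = 0) {k : ℕ} (hk : k + 1 < n)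
    (hB : IsPathChase b σ (2 * k) B) :
    IsPathChase b σ (2 * k + 1) (B * planeRot n k (stepRot b σ 0 k)) := by
  rw [← pathRot_even]
  exact IsChase.mul_planeRot (chaseData_path b σ h0 h1) hk hB

theorem IsPathChase.planeRot_mul (h0 : b 0 = 0) (h1 : b 1 = 0) {k : ℕ} (hk : k + 1 < n)
    (hB : IsPathChase b σ (2 * k + 1) B) :
    IsPathChase b σ (2 * k + 2) ((planeRot n k (stepRot b σ 1 k))ᵀ * B) := by
  rw [← pathRot_odd]
  exact IsChase.planeRot_mul (chaseData_path b σ h0 h1) hk hB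

theorem IsPathChase.givensCS_rightVector (h0 : b 0 = 0) (h1 : b 1 = 0) (hbs : IsBulgeStart bs)
    (hσ : 0 ≤ σ) {k : ℕ} (hk : k + 1 < n) (hB : IsPathChase b σ (2 * k) B) :
    givensCS (rightVector bs B σ k) = stepRot b σ 0 k := by
  rw [← pathRot_even]
  exact IsChase.givensCS_rightVector (chaseData_path b σ h0 h1) hbs hσ hk hB

theorem IsPathChase.givensCS_leftVector (h0 : b 0 = 0) (h1 : b 1 = 0) (hbs : IsBulgeStart bs)
    (hσ : 0 ≤ σ) {k : ℕ} (hk : k + 1 < n) (hB : IsPathChase b σ (2 * k + 1) B) :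
    givensCS (leftVector bs B σ k) = stepRot b σ 1 k := by
  rw [← pathRot_odd]
  exact IsChase.givensCS_leftVector (chaseData_path b σ h0 h1) hbs hσ hk hB

/-- The rotations found by `svd_step` are those of the explicit QR steps. -/
theorem svdRun_eq (hbs : IsBulgeStart bs) (hσ : 0 ≤ σ) (hB : IsUpperBidiagonal B) :
    ∀ k, k < n → IsPathChase (pathWeight B) σ (2 * k) (svdRun bs σ B k).B ∧
      (svdRun bs σ B k).S =
        (List.range k).map (fun i => planeRot n i (stepRot (pathWeight B) σ 1 i)) ∧
      (svdRun bs σ B k).T =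
        (List.range k).map (fun i => planeRot n i (stepRot (pathWeight B) σ 0 i))
  | 0, _ => ⟨isPathChase_zero hB σ, rfl, rfl⟩
  | k + 1, hk => by
    obtain ⟨h1, h2, h3⟩ := svdRun_eq hbs hσ hB k (by omega)
    have e1 := h1.givensCS_rightVector rfl rfl hbs hσ hk
    have h4 := h1.mul_planeRot rfl rfl hk
    have e2 := h4.givensCS_leftVector rfl rfl hbs hσ hk
    have h5 := h4.planeRot_mul rfl rfl hk
    simp only [svdRun, svdBody, givens_eq_planeRot, e1, e2, List.range_succ, List.map_append, h2,
      h3, List.map_cons, List.map_nil, and_true]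
    exact h5

end

/-! ### SVD steps -/

section

variable {n : ℕ} {B : Matrix (Fin n) (Fin n) ℝ} {σ : ℝ}

theorem entry_val (B : Matrix (Fin n) (Fin n) ℝ) (i j : Fin n) : entry B i j = B i j := by
  simp [entry]

theorem entry_of_row_ge (B : Matrix (Fin n) (Fin n) ℝ) {i : ℕ} (j : ℕ) (h : n ≤ i) :
    entry B i j = 0 := dif_neg (by omega)

theorem entry_of_col_ge (B : Matrix (Fin n) (Fin n) ℝ) (i : ℕ) {j : ℕ} (h : n ≤ j) :
    entry B i j = 0 := dif_neg (by omega)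

theorem IsUpperBidiagonal.entry_eq_zero (hB : IsUpperBidiagonal B) {i j : ℕ} (h : j ≠ i)
    (h' : j ≠ i + 1) : entry B i j = 0 := by
  unfold entry
  split_ifs with h1
  · by_contra h0
    exact (hB _ _ h0).elim h h'
  · rfl

theorem IsUpperBidiagonal.sum_row (hB : IsUpperBidiagonal B) (i : Fin n) (f : ℕ → ℝ) :
    ∑ k, B i k * f k = entry B i i * f i + entry B i (i + 1) * f (i + 1) := by
  rw [show ∑ k, B i k * f k = ∑ k ∈ Finset.range n, entry B i k * f k by
    rw [Finset.sum_range]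
    exact Finset.sum_congr rfl fun k _ => by rw [entry_val]]
  by_cases h : (i : ℕ) + 1 < n
  · rw [Finset.sum_eq_add (i : ℕ) (i + 1) (by omega)]
    · rintro k - ⟨h1, h2⟩
      rw [hB.entry_eq_zero h1 h2, zero_mul]
    · intro h'; simp at h'
    · intro h'; simp at h'; omega
  · rw [Finset.sum_eq_single (i : ℕ), entry_of_col_ge B i (not_lt.mp h), zero_mul, add_zero]
    · intro k hk h1
      rw [hB.entry_eq_zero h1 (by simp at hk; omega), zero_mul]
    · intro h'; simp at h'

theorem IsUpperBidiagonal.sum_col (hB : IsUpperBidiagonal B) (j : Fin n) (f : ℕ → ℝ) :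
    ∑ k, B k j * f k = (if (j : ℕ) = 0 then 0 else entry B (j - 1) j * f (j - 1)) +
      entry B j j * f j := by
  rw [show ∑ k, B k j * f k = ∑ k ∈ Finset.range n, entry B k j * f k by
    rw [Finset.sum_range]
    exact Finset.sum_congr rfl fun k _ => by rw [entry_val]]
  split_ifs with h
  · rw [Finset.sum_eq_single (j : ℕ), zero_add]
    · intro k hk h1
      rw [hB.entry_eq_zero (Ne.symm h1) (by omega), zero_mul]
    · intro h'; simp at h'
  · rw [Finset.sum_eq_add ((j : ℕ) - 1) j (by omega)]
    · rintro k - ⟨h1, h2⟩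
      rw [hB.entry_eq_zero (Ne.symm h2) (by omega), zero_mul]
    · intro h'; simp at h'; omega
    · intro h'; simp at h'

theorem pathWeight_diag (B : Matrix (Fin n) (Fin n) ℝ) (i : ℕ) :
    pathWeight B (2 * i + 2) = entry B i i := by
  rw [pathWeight]
  congr <;> omega

theorem pathWeight_super (B : Matrix (Fin n) (Fin n) ℝ) (i : ℕ) :
    pathWeight B (2 * i + 3) = entry B i (i + 1) := by
  rw [pathWeight]
  congr <;> omega

theorem pathWeight_prev (B : Matrix (Fin n) (Fin n) ℝ) (i : ℕ) :
    pathWeight B (2 * i + 1) = if i = 0 then 0 else entry B (i - 1) i := by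
  rcases i with _ | i
  · rfl
  · rw [if_neg (by omega), Nat.add_sub_cancel, show 2 * (i + 1) + 1 = 2 * i + 3 by ring,
      pathWeight_super]

theorem tridiag_eq_of (α β : ℕ → ℝ) {M : Matrix (Fin n) (Fin n) ℝ} (hM : M.IsSymm)
    (h0 : ∀ i : Fin n, M i i = α i) (h1 : ∀ i j : Fin n, (i : ℕ) = j + 1 → M i j = β j)
    (h2 : ∀ i j : Fin n, (j : ℕ) + 1 < i → M i j = 0) : M = tridiag n α β := by
  ext i j
  simp only [tridiag, Matrix.of_apply]
  split_ifs with h3 h4 h5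
  · rw [h3, h0]
  · exact h1 i j h4
  · rw [← hM.apply]
    exact h1 j i h5
  · rw [Fin.ext_iff] at h3
    rcases lt_or_gt_of_ne h3 with h6 | h6
    · exact h2 i j (by omega)
    · rw [← hM.apply]
      exact h2 j i (by omega)

theorem IsUpperBidiagonal.mul_transpose_eq_tridiag (hB : IsUpperBidiagonal B) (σ : ℝ) :
    B * Bᵀ - σ ^ 2 • (1 : Matrix (Fin n) (Fin n) ℝ) =
      tridiag n (pathDiag (pathWeight B) σ 1) (pathOff (pathWeight B) 1) := by
  have key : ∀ i j : Fin n, (B * Bᵀ) i j = entry B i i * entry B j i +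
      entry B i (i + 1) * entry B j (i + 1) := fun i j => by
    rw [Matrix.mul_apply, ← hB.sum_row i fun k => entry B j k]
    exact Finset.sum_congr rfl fun k _ => by rw [Matrix.transpose_apply, entry_val]
  refine tridiag_eq_of _ _ ?_ ?_ ?_ ?_
  · exact (Matrix.isSymm_mul_transpose_self B).sub (Matrix.isSymm_one.smul _)
  · intro i
    rw [Matrix.sub_apply, key, pathDiag, show 2 * (i : ℕ) + 1 + 1 = 2 * i + 2 by ring,
      show 2 * (i : ℕ) + 1 + 2 = 2 * i + 3 by ring, pathWeight_diag, pathWeight_super]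
    simp
    ring
  · intro i j h
    rw [Matrix.sub_apply, key, pathOff, show 2 * (j : ℕ) + 1 + 2 = 2 * j + 3 by ring,
      show 2 * (j : ℕ) + 1 + 3 = 2 * (j + 1) + 2 by ring, pathWeight_diag, pathWeight_super,
      hB.entry_eq_zero (i := j) (j := i + 1) (by omega) (by omega), h]
    have : i ≠ j := by rw [ne_eq, Fin.ext_iff]; omega
    simp [Matrix.one_apply_ne this]
    ring
  · intro i j h
    have : i ≠ j := by rw [ne_eq, Fin.ext_iff]; omega
    rw [Matrix.sub_apply, key, hB.entry_eq_zero (i := j) (j := i + 1) (by omega) (by omega),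
      hB.entry_eq_zero (i := j) (j := i) (by omega) (by omega)]
    simp [Matrix.one_apply_ne this]

theorem IsUpperBidiagonal.transpose_mul_eq_tridiag (hB : IsUpperBidiagonal B) (σ : ℝ) :
    Bᵀ * B - σ ^ 2 • (1 : Matrix (Fin n) (Fin n) ℝ) =
      tridiag n (pathDiag (pathWeight B) σ 0) (pathOff (pathWeight B) 0) := by
  have key : ∀ i j : Fin n, (Bᵀ * B) i j =
      (if (j : ℕ) = 0 then 0 else entry B (j - 1) j * entry B (j - 1) i) +
      entry B j j * entry B j i := fun i j => by
    rw [Matrix.mul_apply, ← hB.sum_col j fun k => entry B k i]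
    exact Finset.sum_congr rfl fun k _ => by rw [Matrix.transpose_apply, entry_val, mul_comm]
  refine tridiag_eq_of _ _ ?_ ?_ ?_ ?_
  · exact (Matrix.isSymm_transpose_mul_self B).sub (Matrix.isSymm_one.smul _)
  · intro i
    rw [Matrix.sub_apply, key, pathDiag, Nat.add_zero, pathWeight_diag, pathWeight_prev]
    split_ifs <;> simp <;> ring
  · intro i j h
    have : i ≠ j := by rw [ne_eq, Fin.ext_iff]; omega
    rw [Matrix.sub_apply, key, pathOff, Nat.add_zero, pathWeight_diag, pathWeight_super,
      show ((i : Fin n) : ℕ) = j + 1 from h]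
    have h1 : (j : ℕ) ≠ 0 → entry B (j - 1) (j + 1) = 0 := fun h' =>
      hB.entry_eq_zero (by omega) (by omega)
    simp only [Matrix.smul_apply, Matrix.one_apply_ne this]
    split_ifs with h2
    · simp
    · rw [h1 h2]; simp
  · intro i j h
    have : i ≠ j := by rw [ne_eq, Fin.ext_iff]; omega
    have h1 : (j : ℕ) ≠ 0 → entry B (j - 1) i = 0 := fun h' =>
      hB.entry_eq_zero (by omega) (by omega)
    rw [Matrix.sub_apply, key, hB.entry_eq_zero (i := j) (j := i) (by omega) (by omega)]
    simp only [Matrix.smul_apply, Matrix.one_apply_ne this]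
    split_ifs with h2
    · simp
    · rw [h1 h2]; simp

theorem pathOff_last (hn : 0 < n) (B : Matrix (Fin n) (Fin n) ℝ) {e : ℕ} (he : e ≤ 1) :
    pathOff (pathWeight B) e (n - 1) = 0 := by
  have h : pathWeight B (2 * (n - 1) + 3) = 0 := by
    rw [pathWeight_super]
    exact entry_of_col_ge _ _ (by omega)
  interval_cases e
  · rw [pathOff, Nat.add_zero, h, mul_zero]
  · rw [pathOff, show 2 * (n - 1) + 1 + 2 = 2 * (n - 1) + 3 by ring, h, zero_mul]

/-- The product of the left (`e = 1`) or right (`e = 0`) rotations of an SVD step. -/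
def stepProd (B : Matrix (Fin n) (Fin n) ℝ) (σ : ℝ) (e : ℕ) : Matrix (Fin n) (Fin n) ℝ :=
  rotProd n (stepRot (pathWeight B) σ e) (n - 1)

theorem IsUpperBidiagonal.isPreferredQR_right (hB : IsUpperBidiagonal B) (hn : 0 < n) (σ : ℝ) :
    ∃ R, IsPreferredQR (Bᵀ * B - σ ^ 2 • (1 : Matrix (Fin n) (Fin n) ℝ)) (stepProd B σ 0) R := by
  rw [hB.transpose_mul_eq_tridiag]
  exact ⟨_, isPreferredQR_tridiag hn (pathOff_last hn B (by omega))⟩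

theorem IsUpperBidiagonal.isPreferredQR_left (hB : IsUpperBidiagonal B) (hn : 0 < n) (σ : ℝ) :
    ∃ R, IsPreferredQR (B * Bᵀ - σ ^ 2 • (1 : Matrix (Fin n) (Fin n) ℝ)) (stepProd B σ 1) R := by
  rw [hB.mul_transpose_eq_tridiag]
  exact ⟨_, isPreferredQR_tridiag hn (pathOff_last hn B le_rfl)⟩

theorem IsUpperBidiagonal.isSVDStep (hB : IsUpperBidiagonal B) (hn : 0 < n) (hσ : 0 ≤ σ) :
    IsSVDStep σ B ((stepProd B σ 1)ᵀ * B * stepProd B σ 0) (stepProd B σ 1) (stepProd B σ 0) := by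
  obtain ⟨L, hL⟩ := hB.isPreferredQR_left hn σ
  exact ⟨hσ, Or.inl hB, ⟨Lᵀ, by rwa [Matrix.transpose_transpose]⟩, hB.isPreferredQR_right hn σ, rfl⟩

theorem IsLowerBidiagonal.isSVDStep (hB : IsLowerBidiagonal B) (hn : 0 < n) (hσ : 0 ≤ σ) :
    IsSVDStep σ B ((stepProd Bᵀ σ 0)ᵀ * B * stepProd Bᵀ σ 1) (stepProd Bᵀ σ 0)
      (stepProd Bᵀ σ 1) := by
  have hB' : IsUpperBidiagonal Bᵀ := hB
  obtain ⟨L, hL⟩ := hB'.isPreferredQR_right hn σ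
  have hR := hB'.isPreferredQR_left hn σ
  rw [Matrix.transpose_transpose] at hL hR
  exact ⟨hσ, Or.inr hB, ⟨Lᵀ, by rwa [Matrix.transpose_transpose]⟩, hR, rfl⟩

theorem givensSeq_neg {α β α' β' : ℕ → ℝ} : ∀ i, (∀ j ≤ i, α' j = -α j) → (∀ j < i, β' j = -β j) →
    givensSeq givensCS α' β' i = ((givensSeq givensCS α β i).1, -(givensSeq givensCS α β i).2)
  | 0, hα, _ => by simp [givensSeq, hα 0 le_rfl]
  | i + 1, hα, hβ => by
    have h1 : givensCS (-(givensSeq givensCS α β i).2, -β i) =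
        givensCS ((givensSeq givensCS α β i).2, β i) := by
      rw [← givensCS_smul (neg_ne_zero.mpr (one_ne_zero' ℝ)) ((givensSeq givensCS α β i).2, β i)]
      simp
    simp only [givensSeq, givensSeq_neg i (fun j hj => hα j (by omega)) fun j hj => hβ j (by omega),
      hα (i + 1) le_rfl, hβ i (by omega), h1]
    refine Prod.ext rfl ?_
    ring

/-- QR steps on a matrix and on its negative use the same rotations. -/
theorem givensRot_neg {α β α' β' : ℕ → ℝ} (i : ℕ) (hα : ∀ j ≤ i, α' j = -α j)
    (hβ : ∀ j ≤ i, β' j = -β j) : givensRot givensCS α' β' i = givensRot givensCS α β i := by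
  rw [givensRot, givensSeq_neg i hα fun j hj => hβ j hj.le, hβ i le_rfl, givensRot,
    ← givensCS_smul (neg_ne_zero.mpr (one_ne_zero' ℝ)) ((givensSeq givensCS α β i).2, β i)]
  simp

end

/-! ### Orthogonality of matrices in bidiagonal block form -/

/-- The column relations of an orthogonal matrix, blockwise. -/
structure Blocks.IsColOrthogonal {n : ℕ} (Y : Blocks n) : Prop where
  left : Y.b11ᵀ * Y.b11 + Y.b21ᵀ * Y.b21 = 1
  right : Y.b12ᵀ * Y.b12 + Y.b22ᵀ * Y.b22 = 1
  cross : Y.b11ᵀ * Y.b12 + Y.b21ᵀ * Y.b22 = 0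

/-- The zero pattern of the bidiagonal block form. -/
structure Blocks.IsBidiagonal {n : ℕ} (Y : Blocks n) : Prop where
  b11 : IsUpperBidiagonal Y.b11
  b12 : IsLowerBidiagonal Y.b12
  b21 : IsUpperBidiagonal Y.b21
  b22 : IsLowerBidiagonal Y.b22

section

variable {n : ℕ}

theorem Blocks.toMatrix_transpose_mul (Y Z : Blocks n) : Y.toMatrixᵀ * Z.toMatrix =
    Matrix.fromBlocks (Y.b11ᵀ * Z.b11 + Y.b21ᵀ * Z.b21) (Y.b11ᵀ * Z.b12 + Y.b21ᵀ * Z.b22)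
      (Y.b12ᵀ * Z.b11 + Y.b22ᵀ * Z.b21) (Y.b12ᵀ * Z.b12 + Y.b22ᵀ * Z.b22) := by
  rw [Blocks.toMatrix, Blocks.toMatrix, Matrix.fromBlocks_transpose, Matrix.fromBlocks_multiply]

theorem Blocks.isColOrthogonal_iff (Y : Blocks n) : Y.IsColOrthogonal ↔
    Y.toMatrixᵀ * Y.toMatrix = 1 := by
  rw [Y.toMatrix_transpose_mul, ← Matrix.fromBlocks_one, Matrix.fromBlocks_inj]
  constructor
  · rintro ⟨h1, h2, h3⟩
    refine ⟨h1, h3, ?_, h2⟩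
    have := congrArg Matrix.transpose h3
    simpa using this
  · rintro ⟨h1, h2, -, h3⟩
    exact ⟨h1, h3, h2⟩

/-- The row relations follow from the column relations. -/
theorem Blocks.IsColOrthogonal.rows {Y : Blocks n} (h : Y.IsColOrthogonal) :
    Y.b11 * Y.b11ᵀ + Y.b12 * Y.b12ᵀ = 1 ∧ Y.b11 * Y.b21ᵀ + Y.b12 * Y.b22ᵀ = 0 ∧
      Y.b21 * Y.b21ᵀ + Y.b22 * Y.b22ᵀ = 1 := by
  have h1 := mul_eq_one_comm.mp (Y.isColOrthogonal_iff.mp h)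
  rw [Blocks.toMatrix, Matrix.fromBlocks_transpose, Matrix.fromBlocks_multiply,
    ← Matrix.fromBlocks_one, Matrix.fromBlocks_inj] at h1
  exact ⟨h1.1, h1.2.1, h1.2.2.2⟩

variable (θ : Fin n → ℝ) (φ : Fin (n - 1) → ℝ)

/-- `θ` extended by the angle `0`. -/
def extTheta (k : ℕ) : ℝ := if h : k < n then θ ⟨k, h⟩ else 0

theorem extTheta_val (i : Fin n) : extTheta θ i = θ i := by simp [extTheta]

theorem sin_extAngle_of_le {k : ℕ} (h : n ≤ k + 1) : Real.sin (extAngle φ k) = 0 := by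
  rw [extAngle, dif_neg (by omega), Real.sin_zero]

theorem entry_b11 {i : ℕ} (hi : i < n) (j : ℕ) : entry (bidiagonalBlocks θ φ).b11 i j =
    if j = i then Real.cos (extTheta θ i) * prevCos φ i
    else if j = i + 1 then -(Real.sin (extTheta θ i) * Real.sin (extAngle φ i)) else 0 := by
  by_cases hj : j < n
  · simp [entry, hi, hj, bidiagonalBlocks, extTheta]
  · rw [entry_of_col_ge _ _ (not_lt.mp hj), if_neg (by omega)]
    split_ifs with h
    · rw [sin_extAngle_of_le φ (by omega)]; simp
    · rfl

theorem entry_b21 {i : ℕ} (hi : i < n) (j : ℕ) : entry (bidiagonalBlocks θ φ).b21 i j =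
    if j = i then -(Real.sin (extTheta θ i) * prevCos φ i)
    else if j = i + 1 then -(Real.cos (extTheta θ i) * Real.sin (extAngle φ i)) else 0 := by
  by_cases hj : j < n
  · simp [entry, hi, hj, bidiagonalBlocks, extTheta]
  · rw [entry_of_col_ge _ _ (not_lt.mp hj), if_neg (by omega)]
    split_ifs with h
    · rw [sin_extAngle_of_le φ (by omega)]; simp
    · rfl

theorem entry_b12 (i : ℕ) {j : ℕ} (hj : j < n) : entry (bidiagonalBlocks θ φ).b12 i j =
    if j = i then Real.sin (extTheta θ i) * Real.cos (extAngle φ i)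
    else if i = j + 1 then Real.cos (extTheta θ i) * Real.sin (extAngle φ j) else 0 := by
  by_cases hi : i < n
  · simp [entry, hi, hj, bidiagonalBlocks, extTheta]
  · rw [entry_of_row_ge _ _ (not_lt.mp hi), if_neg (by omega)]
    split_ifs with h
    · rw [sin_extAngle_of_le φ (by omega)]; simp
    · rfl

theorem entry_b22 (i : ℕ) {j : ℕ} (hj : j < n) : entry (bidiagonalBlocks θ φ).b22 i j =
    if j = i then Real.cos (extTheta θ i) * Real.cos (extAngle φ i)
    else if i = j + 1 then -(Real.sin (extTheta θ i) * Real.sin (extAngle φ j)) else 0 := by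
  by_cases hi : i < n
  · simp [entry, hi, hj, bidiagonalBlocks, extTheta]
  · rw [entry_of_row_ge _ _ (not_lt.mp hi), if_neg (by omega)]
    split_ifs with h
    · rw [sin_extAngle_of_le φ (by omega)]; simp
    · rfl

theorem entry_transpose (M : Matrix (Fin n) (Fin n) ℝ) (i j : ℕ) : entry Mᵀ i j = entry M j i := by
  simp only [entry, and_comm, Matrix.transpose_apply]

theorem isBidiagonal_bidiagonalBlocks : (bidiagonalBlocks θ φ).IsBidiagonal := by
  constructor <;> intro i j h <;> by_contra h' <;> rw [not_or] at h' <;> apply h <;>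
    simp [bidiagonalBlocks, Fin.ext_iff, h'] <;> intro h'' <;> omega

theorem Blocks.IsBidiagonal.transpose_mul_upper {M : Matrix (Fin n) (Fin n) ℝ}
    (hM : IsUpperBidiagonal M) (N : Matrix (Fin n) (Fin n) ℝ) (i j : Fin n) : (Mᵀ * N) i j =
      (if (i : ℕ) = 0 then 0 else entry M (i - 1) i * entry N (i - 1) j) +
        entry M i i * entry N i j := by
  rw [Matrix.mul_apply, ← hM.sum_col i fun k => entry N k j]
  exact Finset.sum_congr rfl fun k _ => by rw [Matrix.transpose_apply, entry_val]

theorem Blocks.IsBidiagonal.transpose_mul_lower {M : Matrix (Fin n) (Fin n) ℝ}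
    (hM : IsLowerBidiagonal M) (N : Matrix (Fin n) (Fin n) ℝ) (i j : Fin n) : (Mᵀ * N) i j =
      entry M i i * entry N i j + entry M (i + 1) i * entry N (i + 1) j := by
  have hM' : IsUpperBidiagonal Mᵀ := hM
  rw [Matrix.mul_apply, ← entry_transpose M i, ← entry_transpose M i,
    ← hM'.sum_row i fun k => entry N k j]
  exact Finset.sum_congr rfl fun k _ => by rw [entry_val]

theorem prevCos_succ (k : ℕ) : prevCos φ (k + 1) = Real.cos (extAngle φ k) := by
  rw [prevCos, if_neg (by omega), Nat.add_sub_cancel]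

theorem isColOrthogonal_bidiagonalBlocks : (bidiagonalBlocks θ φ).IsColOrthogonal := by
  obtain ⟨h11, h12, h21, h22⟩ := isBidiagonal_bidiagonalBlocks θ φ
  have hT : ∀ k, Real.sin (extTheta θ k) ^ 2 + Real.cos (extTheta θ k) ^ 2 = 1 :=
    fun k => Real.sin_sq_add_cos_sq _
  have hP : ∀ k, Real.sin (extAngle φ k) ^ 2 + Real.cos (extAngle φ k) ^ 2 = 1 :=
    fun k => Real.sin_sq_add_cos_sq _
  have symm_ext : ∀ M : Matrix (Fin n) (Fin n) ℝ, M.IsSymm → (∀ i, M i i = 1) →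
      (∀ i j, i < j → M i j = 0) → M = 1 := by
    intro M hM h0 h1
    ext i j
    rcases lt_trichotomy i j with h | h | h
    · rw [h1 i j h, Matrix.one_apply_ne h.ne]
    · rw [h, h0, Matrix.one_apply_eq]
    · rw [← hM.apply, h1 j i h, Matrix.one_apply_ne h.ne']
  constructor
  · refine symm_ext _
      ((Matrix.isSymm_transpose_mul_self _).add (Matrix.isSymm_transpose_mul_self _)) ?_ ?_
    · rintro ⟨a, ha⟩
      rw [Matrix.add_apply, Blocks.IsBidiagonal.transpose_mul_upper h11,
        Blocks.IsBidiagonal.transpose_mul_upper h21]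
      rcases a with _ | k
      · simp [entry_b11 θ φ ha, entry_b21 θ φ ha, prevCos]
        linear_combination hT 0
      · simp [entry_b11 θ φ ha, entry_b21 θ φ ha, entry_b11 θ φ (show k < n by omega),
          entry_b21 θ φ (show k < n by omega), prevCos_succ]
        linear_combination Real.sin (extAngle φ k) ^ 2 * hT k +
          Real.cos (extAngle φ k) ^ 2 * hT (k + 1) + hP k
    · rintro ⟨a, ha⟩ ⟨b, hb⟩ h
      rw [Fin.lt_def] at h
      dsimp only at h
      rw [Matrix.add_apply, Blocks.IsBidiagonal.transpose_mul_upper h11,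
        Blocks.IsBidiagonal.transpose_mul_upper h21]
      rcases a with _ | k
      · simp [entry_b11 θ φ ha, entry_b21 θ φ ha, h.ne']
        split_ifs <;> ring
      · simp [entry_b11 θ φ ha, entry_b21 θ φ ha, entry_b11 θ φ (show k < n by omega),
          entry_b21 θ φ (show k < n by omega), h.ne', show b ≠ k by omega]
        split_ifs <;> ring
  · refine symm_ext _
      ((Matrix.isSymm_transpose_mul_self _).add (Matrix.isSymm_transpose_mul_self _)) ?_ ?_
    · rintro ⟨a, ha⟩
      rw [Matrix.add_apply, Blocks.IsBidiagonal.transpose_mul_lower h12,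
        Blocks.IsBidiagonal.transpose_mul_lower h22]
      simp [entry_b12 θ φ _ ha, entry_b22 θ φ _ ha]
      linear_combination Real.cos (extAngle φ a) ^ 2 * hT a +
        Real.sin (extAngle φ a) ^ 2 * hT (a + 1) + hP a
    · rintro ⟨a, ha⟩ ⟨b, hb⟩ h
      rw [Fin.lt_def] at h
      dsimp only at h
      rw [Matrix.add_apply, Blocks.IsBidiagonal.transpose_mul_lower h12,
        Blocks.IsBidiagonal.transpose_mul_lower h22]
      simp [entry_b12 θ φ _ ha, entry_b22 θ φ _ ha, entry_b12 θ φ _ hb, entry_b22 θ φ _ hb, h.ne',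
        show a ≠ b + 1 by omega, show a ≠ b by omega]
      split_ifs <;> ring
  · ext ⟨a, ha⟩ ⟨b, hb⟩
    rw [Matrix.add_apply, Blocks.IsBidiagonal.transpose_mul_upper h11,
      Blocks.IsBidiagonal.transpose_mul_upper h21, Matrix.zero_apply]
    rcases a with _ | k
    · simp [entry_b11 θ φ ha, entry_b21 θ φ ha, entry_b12 θ φ _ hb, entry_b22 θ φ _ hb]
      split_ifs <;> ring
    · simp [entry_b11 θ φ ha, entry_b21 θ φ ha, entry_b11 θ φ (show k < n by omega),
        entry_b21 θ φ (show k < n by omega), entry_b12 θ φ _ hb, entry_b22 θ φ _ hb, prevCos_succ]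
      have key : b = k + 1 ∨ b = k ∨ k = b + 1 ∨ (b ≠ k + 1 ∧ b ≠ k ∧ k ≠ b + 1) := by omega
      rcases key with rfl | rfl | rfl | ⟨h1, h2, h3⟩
      · simp [show k ≠ k + 1 + 1 by omega]
        ring
      · simp
        linear_combination Real.sin (extAngle φ b) * Real.cos (extAngle φ b) * (hT (b + 1) - hT b)
      · simp [show b ≠ b + 1 + 1 by omega]
        ring
      · simp [h1, h2, h3, Ne.symm h2]

/-! ### Coincidence of the rotations of the four blocks -/

theorem tridiag_neg_iff {α β α' β' : ℕ → ℝ} (h : tridiag n α β = -tridiag n α' β') :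
    (∀ i < n, α i = -α' i) ∧ ∀ i, i + 1 < n → β i = -β' i := by
  constructor
  · intro i hi
    have := congrFun (congrFun h ⟨i, hi⟩) ⟨i, hi⟩
    simpa [tridiag] using this
  · intro i hi
    have := congrFun (congrFun h ⟨i + 1, hi⟩) ⟨i, by omega⟩
    simpa [tridiag] using this

theorem stepRot_eq_of_tridiag {b b' : ℕ → ℝ} {σ σ' : ℝ} {e e' : ℕ}
    (h : tridiag n (pathDiag b σ e) (pathOff b e) = -tridiag n (pathDiag b' σ' e') (pathOff b' e'))
    (i : ℕ) (hi : i + 1 < n) : stepRot b σ e i = stepRot b' σ' e' i := by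
  obtain ⟨h1, h2⟩ := tridiag_neg_iff h
  exact givensRot_neg i (fun j hj => h1 j (by omega)) fun j hj => h2 j (by omega)

/-- If `F + F' = 1` and the squared shifts add up to one as well, then the shifted matrices are the
negatives of each other. -/
theorem sub_smul_one_eq_neg {F F' : Matrix (Fin n) (Fin n) ℝ} {μ ν : ℝ} (h : F + F' = 1)
    (hs : μ ^ 2 + ν ^ 2 = 1) : F - μ ^ 2 • (1 : Matrix (Fin n) (Fin n) ℝ) =
      -(F' - ν ^ 2 • (1 : Matrix (Fin n) (Fin n) ℝ)) := by
  rw [show ν ^ 2 = 1 - μ ^ 2 by linarith, sub_smul, one_smul, ← h]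
  abel

/-- In an orthogonal matrix with bidiagonal blocks, the SVD steps on two adjacent blocks use the
same rotations for the rows or columns that they share. -/
structure Blocks.SharesRotations (Y : Blocks n) (μ ν : ℝ) : Prop where
  v1 : ∀ i, i + 1 < n → stepRot (pathWeight Y.b21) ν 0 i = stepRot (pathWeight Y.b11) μ 0 i
  u1 : ∀ i, i + 1 < n → stepRot (pathWeight Y.b12ᵀ) ν 0 i = stepRot (pathWeight Y.b11) μ 1 i
  u2 : ∀ i, i + 1 < n → stepRot (pathWeight Y.b22ᵀ) μ 0 i = stepRot (pathWeight Y.b21) ν 1 i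
  v2 : ∀ i, i + 1 < n → stepRot (pathWeight Y.b22ᵀ) μ 1 i = stepRot (pathWeight Y.b12ᵀ) ν 1 i

theorem Blocks.IsBidiagonal.sharesRotations {Y : Blocks n} (hY : Y.IsBidiagonal)
    (ho : Y.IsColOrthogonal) {μ ν : ℝ} (hs : μ ^ 2 + ν ^ 2 = 1) : Y.SharesRotations μ ν := by
  have h12 : IsUpperBidiagonal Y.b12ᵀ := hY.b12
  have h22 : IsUpperBidiagonal Y.b22ᵀ := hY.b22
  have hs' : ν ^ 2 + μ ^ 2 = 1 := by rw [add_comm, hs]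
  obtain ⟨r1, -, r2⟩ := ho.rows
  constructor
  · refine stepRot_eq_of_tridiag ?_
    rw [← hY.b11.transpose_mul_eq_tridiag, ← hY.b21.transpose_mul_eq_tridiag]
    exact sub_smul_one_eq_neg (by rw [add_comm]; exact ho.left) hs'
  · refine stepRot_eq_of_tridiag ?_
    rw [← hY.b11.mul_transpose_eq_tridiag, ← h12.transpose_mul_eq_tridiag,
      Matrix.transpose_transpose]
    exact sub_smul_one_eq_neg (by rw [add_comm]; exact r1) hs'
  · refine stepRot_eq_of_tridiag ?_
    rw [← hY.b21.mul_transpose_eq_tridiag, ← h22.transpose_mul_eq_tridiag,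
      Matrix.transpose_transpose]
    exact sub_smul_one_eq_neg (by rw [add_comm]; exact r2) hs
  · refine stepRot_eq_of_tridiag ?_
    rw [← h12.mul_transpose_eq_tridiag, ← h22.mul_transpose_eq_tridiag,
      Matrix.transpose_transpose, Matrix.transpose_transpose]
    exact sub_smul_one_eq_neg (by rw [add_comm]; exact ho.right) hs

end

/-! ### The simultaneous SVD steps -/

section

variable {n : ℕ}

/-- The first `k` calls of `merge` all determine the rotations `r`. -/
structure CallsMatch (n : ℕ) (r : ℕ → ℝ × ℝ) (k : ℕ) (calls : List MergeCall) : Prop where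
  colinear : ∀ c ∈ calls, Colinear c.first c.second
  first : calls.map (fun c => givens n c.idx c.first) =
    (List.range k).map fun i => planeRot n i (r i)
  second : calls.map (fun c => givens n c.idx c.second) =
    (List.range k).map fun i => planeRot n i (r i)
  merged : calls.map (fun c => givens n c.idx c.merged) =
    (List.range k).map fun i => planeRot n i (r i)

theorem callsMatch_nil (r : ℕ → ℝ × ℝ) : CallsMatch n r 0 [] :=
  ⟨fun _ hc => absurd hc List.not_mem_nil, rfl, rfl, rfl⟩

theorem CallsMatch.append {r : ℕ → ℝ × ℝ} {k : ℕ} {calls : List MergeCall}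
    (h : CallsMatch n r k calls) {x y z : ℝ × ℝ} (hx : givensCS x = r k) (hy : givensCS y = r k)
    (hz : givensCS z = r k) : CallsMatch n r (k + 1) (calls ++ [⟨k, x, y, z⟩]) := by
  refine ⟨?_, ?_, ?_, ?_⟩
  · intro c hc
    rcases List.mem_append.mp hc with h1 | h1
    · exact h.colinear c h1
    · obtain rfl := List.mem_singleton.mp h1
      exact colinear_of_givensCS_eq (hx.trans hy.symm)
  · rw [List.map_append, List.range_succ, List.map_append, h.first]
    simp [givens_eq_planeRot, hx]
  · rw [List.map_append, List.range_succ, List.map_append, h.second]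
    simp [givens_eq_planeRot, hy]
  · rw [List.map_append, List.range_succ, List.map_append, h.merged]
    simp [givens_eq_planeRot, hz]

/-- The state of the simultaneous SVD steps on `B` after `k` rotations of the columns of the left
blocks, `l` of the rows, and `m` of the columns of the right blocks. -/
structure CSDInv (μ ν : ℝ) (B : Blocks n) (k l m : ℕ) (s : CSDState n) : Prop where
  b11 : IsPathChase (pathWeight B.b11) μ (k + l) s.B.b11
  b21 : IsPathChase (pathWeight B.b21) ν (k + l) s.B.b21
  b12 : IsPathChase (pathWeight B.b12ᵀ) ν (l + m) s.B.b12ᵀ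
  b22 : IsPathChase (pathWeight B.b22ᵀ) μ (l + m) s.B.b22ᵀ
  V1 : s.V1 = rotProd n (stepRot (pathWeight B.b11) μ 0) k
  U1 : s.U1 = rotProd n (stepRot (pathWeight B.b11) μ 1) l
  U2 : s.U2 = rotProd n (stepRot (pathWeight B.b21) ν 1) l
  V2 : s.V2 = rotProd n (stepRot (pathWeight B.b12ᵀ) ν 1) m
  eq11 : s.B.b11 = s.U1ᵀ * B.b11 * s.V1
  eq12 : s.B.b12 = s.U1ᵀ * B.b12 * s.V2
  eq21 : s.B.b21 = s.U2ᵀ * B.b21 * s.V1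
  eq22 : s.B.b22 = s.U2ᵀ * B.b22 * s.V2
  callsV1 : CallsMatch n (stepRot (pathWeight B.b11) μ 0) k s.callsV1
  callsU1 : CallsMatch n (stepRot (pathWeight B.b11) μ 1) l s.callsU1
  callsU2 : CallsMatch n (stepRot (pathWeight B.b21) ν 1) l s.callsU2
  callsV2 : CallsMatch n (stepRot (pathWeight B.b12ᵀ) ν 1) m s.callsV2

variable {bs : ℝ × ℝ → ℝ → ℝ × ℝ} {mg : ℝ × ℝ → ℝ × ℝ → ℝ × ℝ} {μ ν : ℝ} {B : Blocks n}
  {k l m : ℕ} {s : CSDState n}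

theorem CSDInv.zero (hB : B.IsBidiagonal) (μ ν : ℝ) :
    CSDInv μ ν B 0 0 0 ⟨B, 1, 1, 1, 1, [], [], [], []⟩ where
  b11 := isPathChase_zero hB.b11 μ
  b21 := isPathChase_zero hB.b21 ν
  b12 := isPathChase_zero hB.b12 ν
  b22 := isPathChase_zero hB.b22 μ
  V1 := rfl
  U1 := rfl
  U2 := rfl
  V2 := rfl
  eq11 := by simp
  eq12 := by simp
  eq21 := by simp
  eq22 := by simp
  callsV1 := callsMatch_nil _
  callsU1 := callsMatch_nil _
  callsU2 := callsMatch_nil _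
  callsV2 := callsMatch_nil _

theorem CSDInv.stepV1 (h : CSDInv μ ν B k k m s) (hR : B.SharesRotations μ ν)
    (hbs : IsBulgeStart bs) (hmg : IsMerge mg) (hμ : 0 ≤ μ) (hν : 0 ≤ ν) (hk : k + 1 < n) :
    CSDInv μ ν B (k + 1) k m (stepV1 bs mg μ ν k s) := by
  have c11 : IsPathChase (pathWeight B.b11) μ (2 * k) s.B.b11 := by
    rw [two_mul]; exact h.b11
  have c21 : IsPathChase (pathWeight B.b21) ν (2 * k) s.B.b21 := by
    rw [two_mul]; exact h.b21
  have e1 := c11.givensCS_rightVector rfl rfl hbs hμ hk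
  have e2 := c21.givensCS_rightVector rfl rfl hbs hν hk
  rw [hR.v1 k hk] at e2
  have e3 := (hmg.givensCS_eq (e1.trans e2.symm)).trans e1
  have n11 := c11.mul_planeRot rfl rfl hk
  have n21 := c21.mul_planeRot rfl rfl hk
  rw [hR.v1 k hk] at n21
  have ek : k + 1 + k = 2 * k + 1 := by ring
  unfold CSD.stepV1 rotateV1
  simp only [givens_eq_planeRot, e3]
  exact
    { b11 := ek ▸ n11
      b21 := ek ▸ n21
      b12 := h.b12
      b22 := h.b22
      V1 := by rw [rotProd, h.V1]
      U1 := h.U1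
      U2 := h.U2
      V2 := h.V2
      eq11 := by rw [h.eq11]; simp only [Matrix.mul_assoc]
      eq12 := h.eq12
      eq21 := by rw [h.eq21]; simp only [Matrix.mul_assoc]
      eq22 := h.eq22
      callsV1 := h.callsV1.append e1 e2 e3
      callsU1 := h.callsU1
      callsU2 := h.callsU2
      callsV2 := h.callsV2 }

theorem CSDInv.stepV2 (h : CSDInv μ ν B l (k + 1) k s) (hR : B.SharesRotations μ ν)
    (hbs : IsBulgeStart bs) (hmg : IsMerge mg) (hμ : 0 ≤ μ) (hν : 0 ≤ ν) (hk : k + 1 < n) :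
    CSDInv μ ν B l (k + 1) (k + 1) (stepV2 bs mg μ ν k s) := by
  have ek : k + 1 + k = 2 * k + 1 := by ring
  have c12 : IsPathChase (pathWeight B.b12ᵀ) ν (2 * k + 1) s.B.b12ᵀ := ek ▸ h.b12
  have c22 : IsPathChase (pathWeight B.b22ᵀ) μ (2 * k + 1) s.B.b22ᵀ := ek ▸ h.b22
  have e1 := c12.givensCS_leftVector rfl rfl hbs hν hk
  have e2 := c22.givensCS_leftVector rfl rfl hbs hμ hk
  rw [hR.v2 k hk] at e2
  have e3 := (hmg.givensCS_eq (e1.trans e2.symm)).trans e1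
  have n12 := c12.planeRot_mul rfl rfl hk
  have n22 := c22.planeRot_mul rfl rfl hk
  rw [hR.v2 k hk] at n22
  rw [← Matrix.transpose_mul] at n12 n22
  have ek' : k + 1 + (k + 1) = 2 * k + 2 := by ring
  unfold CSD.stepV2 rotateV2
  simp only [givens_eq_planeRot, e3]
  exact
    { b11 := h.b11
      b21 := h.b21
      b12 := ek' ▸ n12
      b22 := ek' ▸ n22
      V1 := h.V1
      U1 := h.U1
      U2 := h.U2
      V2 := by rw [rotProd, h.V2]
      eq11 := h.eq11
      eq12 := by rw [h.eq12]; simp only [Matrix.mul_assoc]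
      eq21 := h.eq21
      eq22 := by rw [h.eq22]; simp only [Matrix.mul_assoc]
      callsV1 := h.callsV1
      callsU1 := h.callsU1
      callsU2 := h.callsU2
      callsV2 := h.callsV2.append e1 e2 e3 }

theorem CSDInv.stepU (h : CSDInv μ ν B (k + 1) k k s) (hR : B.SharesRotations μ ν)
    (hbs : IsBulgeStart bs) (hmg : IsMerge mg) (hμ : 0 ≤ μ) (hν : 0 ≤ ν) (hk : k + 1 < n) :
    CSDInv μ ν B (k + 1) (k + 1) k (stepU bs mg μ ν k s) := by
  have ek : k + 1 + k = 2 * k + 1 := by ring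
  have c11 : IsPathChase (pathWeight B.b11) μ (2 * k + 1) s.B.b11 := ek ▸ h.b11
  have c21 : IsPathChase (pathWeight B.b21) ν (2 * k + 1) s.B.b21 := ek ▸ h.b21
  have c12 : IsPathChase (pathWeight B.b12ᵀ) ν (2 * k) s.B.b12ᵀ := by rw [two_mul]; exact h.b12
  have c22 : IsPathChase (pathWeight B.b22ᵀ) μ (2 * k) s.B.b22ᵀ := by rw [two_mul]; exact h.b22
  have e1 := c11.givensCS_leftVector rfl rfl hbs hμ hk
  have e2 := c12.givensCS_rightVector rfl rfl hbs hν hk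
  have e4 := c21.givensCS_leftVector rfl rfl hbs hν hk
  have e5 := c22.givensCS_rightVector rfl rfl hbs hμ hk
  rw [hR.u1 k hk] at e2
  rw [hR.u2 k hk] at e5
  have e3 := (hmg.givensCS_eq (e1.trans e2.symm)).trans e1
  have e6 := (hmg.givensCS_eq (e4.trans e5.symm)).trans e4
  have n11 := c11.planeRot_mul rfl rfl hk
  have n21 := c21.planeRot_mul rfl rfl hk
  have n12 := c12.mul_planeRot rfl rfl hk
  have n22 := c22.mul_planeRot rfl rfl hk
  rw [hR.u1 k hk] at n12
  rw [hR.u2 k hk] at n22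
  have ek' : k + 1 + (k + 1) = 2 * k + 2 := by ring
  unfold CSD.stepU rotateU1 rotateU2
  simp only [givens_eq_planeRot, e3, e6]
  exact
    { b11 := ek' ▸ n11
      b21 := ek' ▸ n21
      b12 := by
        rw [Matrix.transpose_mul, Matrix.transpose_transpose]
        exact ek ▸ n12
      b22 := by
        rw [Matrix.transpose_mul, Matrix.transpose_transpose]
        exact ek ▸ n22
      V1 := h.V1
      U1 := by rw [rotProd, h.U1]
      U2 := by rw [rotProd, h.U2]
      V2 := h.V2
      eq11 := by rw [h.eq11]; simp only [Matrix.transpose_mul, Matrix.mul_assoc]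
      eq12 := by rw [h.eq12]; simp only [Matrix.transpose_mul, Matrix.mul_assoc]
      eq21 := by rw [h.eq21]; simp only [Matrix.transpose_mul, Matrix.mul_assoc]
      eq22 := by rw [h.eq22]; simp only [Matrix.transpose_mul, Matrix.mul_assoc]
      callsV1 := h.callsV1
      callsU1 := h.callsU1.append e1 e2 e3
      callsU2 := h.callsU2.append e4 e5 e6
      callsV2 := h.callsV2 }

theorem csdRun_inv (hB : B.IsBidiagonal) (hR : B.SharesRotations μ ν)
    (hbs : IsBulgeStart bs) (hmg : IsMerge mg) (hμ : 0 ≤ μ) (hν : 0 ≤ ν) :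
    ∀ k, k + 1 < n → CSDInv μ ν B (k + 1) (k + 1) k (csdRun bs mg μ ν B k)
  | 0, hk => ((CSDInv.zero hB μ ν).stepV1 hR hbs hmg hμ hν hk).stepU hR hbs hmg hμ hν hk
  | k + 1, hk =>
    (((csdRun_inv hB hR hbs hmg hμ hν k (by omega)).stepV1 hR hbs hmg hμ hν hk).stepV2 hR hbs hmg
      hμ hν (by omega)).stepU hR hbs hmg hμ hν hk

theorem csdCore_inv (hn : 2 ≤ n) (hB : B.IsBidiagonal) (hR : B.SharesRotations μ ν)
    (hbs : IsBulgeStart bs) (hmg : IsMerge mg) (hμ : 0 ≤ μ) (hν : 0 ≤ ν) :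
    CSDInv μ ν B (n - 1) (n - 1) (n - 1) (csdCore bs mg μ ν B) := by
  have h := (csdRun_inv hB hR hbs hmg hμ hν (n - 2) (by omega)).stepV2 hR hbs hmg hμ hν (by omega)
  rwa [show n - 2 + 1 = n - 1 by omega] at h

/-- The final blocks have their bidiagonal shape back. -/
theorem CSDInv.isBidiagonal (h : CSDInv μ ν B (n - 1) (n - 1) (n - 1) s) : s.B.IsBidiagonal := by
  have e : n - 1 + (n - 1) = 2 * (n - 1) := by ring
  have h11 := h.b11
  have h12 := h.b12
  have h21 := h.b21
  have h22 := h.b22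
  rw [e] at h11 h12 h21 h22
  exact ⟨IsChase.isUpperBidiagonal h11, IsChase.isUpperBidiagonal h12,
    IsChase.isUpperBidiagonal h21, IsChase.isUpperBidiagonal h22⟩

theorem mergedRotationsWellDefined (hn : 2 ≤ n) (hB : B.IsBidiagonal) (hR : B.SharesRotations μ ν)
    (hbs : IsBulgeStart bs) (hmg : IsMerge mg) (hμ : 0 ≤ μ) (hν : 0 ≤ ν) :
    MergedRotationsWellDefined bs mg μ ν B := by
  have h := csdCore_inv hn hB hR hbs hmg hμ hν
  have congr_list : ∀ {r r' : ℕ → ℝ × ℝ}, (∀ i, i + 1 < n → r' i = r i) →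
      (List.range (n - 1)).map (fun i => planeRot n i (r i)) =
        (List.range (n - 1)).map fun i => planeRot n i (r' i) := by
    intro r r' hr
    refine List.map_congr_left fun i hi => ?_
    rw [hr i (by have := List.mem_range.mp hi; omega)]
  have key : ∀ {r : ℕ → ℝ × ℝ} {calls : List MergeCall} {R R' : List (Matrix (Fin n) (Fin n) ℝ)},
      CallsMatch n r (n - 1) calls → (List.range (n - 1)).map (fun i => planeRot n i (r i)) = R →
      (List.range (n - 1)).map (fun i => planeRot n i (r i)) = R' → MergesAgree calls R R' := by
    rintro r calls R R' hc rfl rfl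
    exact ⟨hc.colinear, hc.first, hc.second, hc.merged, rfl⟩
  obtain ⟨-, s11, t11⟩ := svdRun_eq hbs hμ hB.b11 (n - 1) (by omega)
  obtain ⟨-, s21, t21⟩ := svdRun_eq hbs hν hB.b21 (n - 1) (by omega)
  obtain ⟨-, s12, t12⟩ := svdRun_eq hbs hν hB.b12 (n - 1) (by omega)
  obtain ⟨-, s22, t22⟩ := svdRun_eq hbs hμ hB.b22 (n - 1) (by omega)
  exact
    { v1 := key h.callsV1 t11.symm ((congr_list hR.v1).trans t21.symm)
      v2 := key h.callsV2 s12.symm ((congr_list hR.v2).trans s22.symm)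
      u1 := key h.callsU1 s11.symm ((congr_list hR.u1).trans t12.symm)
      u2 := key h.callsU2 s21.symm ((congr_list hR.u2).trans t22.symm) }

end

/-! ### Recovering the angles and the signs -/

section

variable {n : ℕ}

theorem sgn_eq_or (x : ℝ) : sgn x = 1 ∨ sgn x = -1 := by
  unfold sgn
  split_ifs <;> simp

theorem sgn_sq (x : ℝ) : sgn x ^ 2 = 1 := by
  rcases sgn_eq_or x with h | h <;> rw [h] <;> norm_num

theorem sgn_mul_self (x : ℝ) : sgn x * x = |x| := by
  unfold sgn
  split_ifs with h
  · rw [abs_of_neg h, neg_one_mul]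
  · rw [abs_of_nonneg (not_lt.mp h), one_mul]

theorem atan2_spec {x y : ℝ} (hx : 0 ≤ x) (hy : 0 ≤ y) (h : x ^ 2 + y ^ 2 = 1) :
    atan2 y x ∈ Set.Icc 0 (Real.pi / 2) ∧ Real.cos (atan2 y x) = x ∧ Real.sin (atan2 y x) = y := by
  have hn : ‖(⟨x, y⟩ : ℂ)‖ = 1 := by
    rw [Complex.norm_def, Complex.normSq_mk, ← sq, ← sq, h, Real.sqrt_one]
  have h0 : (⟨x, y⟩ : ℂ) ≠ 0 := norm_ne_zero_iff.mp (by rw [hn]; exact one_ne_zero)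
  refine ⟨⟨Complex.arg_nonneg_iff.mpr hy, Complex.arg_le_pi_div_two_iff.mpr (Or.inl hx)⟩, ?_, ?_⟩
  · rw [atan2, Complex.cos_arg h0, hn, div_one]
  · rw [atan2, Complex.sin_arg, hn, div_one]

/-- If `(x₁, x₂)` and `(y₁, y₂)` have the Gram matrix `(c, s)ᵀ (c, s)` of rank one, then they are
`c` and `s` times a common unit vector. -/
theorem eq_mul_of_gram {c s x₁ x₂ y₁ y₂ : ℝ} (h : c ^ 2 + s ^ 2 = 1) (hx : x₁ ^ 2 + x₂ ^ 2 = c ^ 2)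
    (hy : y₁ ^ 2 + y₂ ^ 2 = s ^ 2) (hxy : x₁ * y₁ + x₂ * y₂ = c * s) :
    (c * x₁ + s * y₁) ^ 2 + (c * x₂ + s * y₂) ^ 2 = 1 ∧
      (x₁ = c * (c * x₁ + s * y₁) ∧ x₂ = c * (c * x₂ + s * y₂)) ∧
      y₁ = s * (c * x₁ + s * y₁) ∧ y₂ = s * (c * x₂ + s * y₂) := by
  have sq_sum : ∀ {a b : ℝ}, a ^ 2 + b ^ 2 = 0 → a = 0 ∧ b = 0 := fun {a b} h' =>
    ⟨by nlinarith [sq_nonneg a, sq_nonneg b], by nlinarith [sq_nonneg a, sq_nonneg b]⟩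
  have hs : s ^ 2 = 1 - c ^ 2 := by linarith
  have h1 := @sq_sum (x₁ - c * (c * x₁ + s * y₁)) (x₂ - c * (c * x₂ + s * y₂)) (by
    linear_combination (1 - c ^ 2) ^ 2 * hx + c ^ 2 * s ^ 2 * hy -
      2 * (1 - c ^ 2) * c * s * hxy + c ^ 2 * (s ^ 2 - 1 + c ^ 2) * h)
  have h2 := @sq_sum (y₁ - s * (c * x₁ + s * y₁)) (y₂ - s * (c * x₂ + s * y₂)) (by
    linear_combination (1 - s ^ 2) ^ 2 * hy + c ^ 2 * s ^ 2 * hx -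
      2 * (1 - s ^ 2) * c * s * hxy + s ^ 2 * (c ^ 2 - 1 + s ^ 2) * h)
  refine ⟨?_, ⟨by linarith, by linarith⟩, by linarith, by linarith⟩
  linear_combination c ^ 2 * hx + s ^ 2 * hy + 2 * c * s * hxy + (c ^ 2 + s ^ 2 + 1) * h

/-- The relations between neighbouring rows and columns of an orthogonal matrix with bidiagonal
blocks, in terms of the entries. -/
structure EntryRelations (Y : Blocks n) (i : ℕ) : Prop where
  row1 : entry Y.b11 i i ^ 2 + entry Y.b11 i (i + 1) ^ 2 +
    (if i = 0 then 0 else entry Y.b12 i (i - 1)) ^ 2 + entry Y.b12 i i ^ 2 = 1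
  row2 : entry Y.b21 i i ^ 2 + entry Y.b21 i (i + 1) ^ 2 +
    (if i = 0 then 0 else entry Y.b22 i (i - 1)) ^ 2 + entry Y.b22 i i ^ 2 = 1
  rows : entry Y.b11 i i * entry Y.b21 i i + entry Y.b11 i (i + 1) * entry Y.b21 i (i + 1) +
    (if i = 0 then 0 else entry Y.b12 i (i - 1)) * (if i = 0 then 0 else entry Y.b22 i (i - 1)) +
    entry Y.b12 i i * entry Y.b22 i i = 0
  left : (if i = 0 then 0 else entry Y.b11 (i - 1) i) ^ 2 + entry Y.b11 i i ^ 2 +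
    (if i = 0 then 0 else entry Y.b21 (i - 1) i) ^ 2 + entry Y.b21 i i ^ 2 = 1
  right : entry Y.b12 i i ^ 2 + entry Y.b12 (i + 1) i ^ 2 + entry Y.b22 i i ^ 2 +
    entry Y.b22 (i + 1) i ^ 2 = 1
  cols : i + 1 < n → entry Y.b11 i (i + 1) * entry Y.b12 i i +
    entry Y.b11 (i + 1) (i + 1) * entry Y.b12 (i + 1) i + entry Y.b21 i (i + 1) * entry Y.b22 i i +
    entry Y.b21 (i + 1) (i + 1) * entry Y.b22 (i + 1) i = 0

theorem Blocks.IsBidiagonal.entryRelations {Y : Blocks n} (hY : Y.IsBidiagonal)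
    (ho : Y.IsColOrthogonal) {i : ℕ} (hi : i < n) : EntryRelations Y i := by
  have up := @Blocks.IsBidiagonal.transpose_mul_upper n
  have low := @Blocks.IsBidiagonal.transpose_mul_lower n
  have t11 : IsLowerBidiagonal Y.b11ᵀ := by
    rw [IsLowerBidiagonal, Matrix.transpose_transpose]; exact hY.b11
  have t21 : IsLowerBidiagonal Y.b21ᵀ := by
    rw [IsLowerBidiagonal, Matrix.transpose_transpose]; exact hY.b21
  have t12 : IsUpperBidiagonal Y.b12ᵀ := hY.b12
  have t22 : IsUpperBidiagonal Y.b22ᵀ := hY.b22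
  obtain ⟨r1, r2, r3⟩ := ho.rows
  have at_diag : ∀ {M : Matrix (Fin n) (Fin n) ℝ}, M = 1 → M ⟨i, hi⟩ ⟨i, hi⟩ = 1 := by
    rintro M rfl
    exact Matrix.one_apply_eq _
  have low' := fun {M : Matrix (Fin n) (Fin n) ℝ} hM N j => low (M := Mᵀ) hM N ⟨i, hi⟩ j
  have up' := fun {M : Matrix (Fin n) (Fin n) ℝ} hM N j => up (M := Mᵀ) hM N ⟨i, hi⟩ j
  simp only [Matrix.transpose_transpose, entry_transpose] at low' up'
  constructor
  · have h := at_diag r1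
    rw [Matrix.add_apply, low' t11, up' t12] at h
    simp only [entry_transpose] at h
    split_ifs at h ⊢ <;> linear_combination h
  · have h := at_diag r3
    rw [Matrix.add_apply, low' t21, up' t22] at h
    simp only [entry_transpose] at h
    split_ifs at h ⊢ <;> linear_combination h
  · have h := congrFun (congrFun r2 ⟨i, hi⟩) ⟨i, hi⟩
    rw [Matrix.add_apply, low' t11, up' t12, Matrix.zero_apply] at h
    simp only [entry_transpose] at h
    split_ifs at h ⊢ <;> linear_combination h
  · have h := at_diag ho.left
    rw [Matrix.add_apply, up hY.b11, up hY.b21] at h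
    dsimp only at h
    split_ifs at h ⊢ <;> linear_combination h
  · have h := at_diag ho.right
    rw [Matrix.add_apply, low hY.b12, low hY.b22] at h
    dsimp only at h
    linear_combination h
  · intro hi'
    have h := congrFun (congrFun ho.cross ⟨i + 1, hi'⟩) ⟨i, hi⟩
    rw [Matrix.add_apply, up hY.b11, up hY.b21, Matrix.zero_apply] at h
    simp only [Nat.add_sub_cancel, Nat.succ_ne_zero, if_false] at h
    linear_combination h

/-- The outcome `r` of round `i`: the signs bring the entries of the rows `i` of the four blocks
into the form prescribed by the angles. -/
structure SignRound.IsCorrect (Y : Blocks n) (i : ℕ) (φ e1 e2 : ℝ) (r : SignRound) : Prop where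
  θ_mem : r.θ ∈ Set.Icc 0 (Real.pi / 2)
  φ_mem : r.φ ∈ Set.Icc 0 (Real.pi / 2)
  d1_sign : r.d1 = 1 ∨ r.d1 = -1
  d2_sign : r.d2 = 1 ∨ r.d2 = -1
  e1_sign : r.e1 = 1 ∨ r.e1 = -1
  e2_sign : r.e2 = 1 ∨ r.e2 = -1
  b11_diag : r.d1 * entry Y.b11 i i * e1 = Real.cos r.θ * Real.cos φ
  b21_diag : r.d2 * entry Y.b21 i i * e1 = -(Real.sin r.θ * Real.cos φ)
  b12_prev : i ≠ 0 → r.d1 * entry Y.b12 i (i - 1) * e2 = Real.cos r.θ * Real.sin φ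
  b22_prev : i ≠ 0 → r.d2 * entry Y.b22 i (i - 1) * e2 = -(Real.sin r.θ * Real.sin φ)
  b11_next : r.d1 * entry Y.b11 i (i + 1) * r.e1 = -(Real.sin r.θ * Real.sin r.φ)
  b21_next : r.d2 * entry Y.b21 i (i + 1) * r.e1 = -(Real.cos r.θ * Real.sin r.φ)
  b12_diag : r.d1 * entry Y.b12 i i * r.e2 = Real.sin r.θ * Real.cos r.φ
  b22_diag : r.d2 * entry Y.b22 i i * r.e2 = Real.cos r.θ * Real.cos r.φ

/-- One round is correct if the column relations hold with the data `φ`, `e1`, `e2` of the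
previous one. -/
theorem signRound_isCorrect {Y : Blocks n} {i : ℕ} (hY : EntryRelations Y i) {φ e1 e2 : ℝ}
    (he1 : e1 ^ 2 = 1) (he2 : e2 ^ 2 = 1) (h0 : i = 0 → Real.sin φ = 0)
    (h1 : entry Y.b11 i i ^ 2 + entry Y.b21 i i ^ 2 = Real.cos φ ^ 2)
    (h2 : i ≠ 0 → entry Y.b12 i (i - 1) ^ 2 + entry Y.b22 i (i - 1) ^ 2 = Real.sin φ ^ 2)
    (h3 : i ≠ 0 → (entry Y.b11 i i * entry Y.b12 i (i - 1) +
      entry Y.b21 i i * entry Y.b22 i (i - 1)) * (e1 * e2) = Real.cos φ * Real.sin φ) :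
    (signRound Y i φ e1 e2).IsCorrect Y i φ e1 e2 := by
  set x₁ := entry Y.b11 i i with hx₁
  set x₂ := entry Y.b21 i i with hx₂
  -- in the first round there is no preceding column of the right blocks
  set y₁ := if i = 0 then 0 else entry Y.b12 i (i - 1) with hy₁
  set y₂ := if i = 0 then 0 else entry Y.b22 i (i - 1) with hy₂
  have hφ : Real.cos φ ^ 2 + Real.sin φ ^ 2 = 1 := Real.cos_sq_add_sin_sq φ
  have gram2 : y₁ ^ 2 + y₂ ^ 2 = Real.sin φ ^ 2 := by
    by_cases hi : i = 0
    · simp [hy₁, hy₂, hi, h0 hi]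
    · rw [hy₁, hy₂, if_neg hi, if_neg hi, h2 hi]
  have gram3 : (x₁ * y₁ + x₂ * y₂) * (e1 * e2) = Real.cos φ * Real.sin φ := by
    by_cases hi : i = 0
    · simp [hy₁, hy₂, hi, h0 hi]
    · rw [hy₁, hy₂, if_neg hi, if_neg hi, h3 hi]
  obtain ⟨hw, ⟨ex₁, ex₂⟩, ey₁, ey₂⟩ := eq_mul_of_gram (x₁ := x₁ * e1) (x₂ := x₂ * e1)
    (y₁ := y₁ * e2) (y₂ := y₂ * e2) hφ
    (by linear_combination e1 ^ 2 * h1 + Real.cos φ ^ 2 * he1)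
    (by linear_combination e2 ^ 2 * gram2 + Real.sin φ ^ 2 * he2)
    (by linear_combination gram3)
  have es₁ : Real.sin φ * (entry Y.b12 i (i - 1) * e2) = Real.sin φ * (y₁ * e2) := by
    by_cases hi : i = 0
    · simp [h0 hi]
    · rw [hy₁, if_neg hi]
  have es₂ : Real.sin φ * (entry Y.b22 i (i - 1) * e2) = Real.sin φ * (y₂ * e2) := by
    by_cases hi : i = 0
    · simp [h0 hi]
    · rw [hy₂, if_neg hi]
  unfold signRound
  rw [es₁, es₂, ← hx₁, ← hx₂, show -(Real.cos φ * (x₂ * e1)) - Real.sin φ * (y₂ * e2) =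
    -(Real.cos φ * (x₂ * e1) + Real.sin φ * (y₂ * e2)) by ring]
  generalize Real.cos φ * (x₁ * e1) + Real.sin φ * (y₁ * e2) = w₁ at *
  generalize Real.cos φ * (x₂ * e1) + Real.sin φ * (y₂ * e2) = w₂ at *
  obtain ⟨hθ, hcos, hsin⟩ := atan2_spec (abs_nonneg w₁) (abs_nonneg (-w₂))
    (by rw [sq_abs, sq_abs, neg_sq, hw])
  dsimp only
  generalize atan2 |(-w₂)| |w₁| = θ at *
  have hd1 := sgn_mul_self w₁
  have hd2 := sgn_mul_self (-w₂)
  have hd1' := sgn_sq w₁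
  have hd2' := sgn_sq (-w₂)
  have hd1o := sgn_eq_or w₁
  have hd2o := sgn_eq_or (-w₂)
  rw [← hcos] at hd1
  rw [← hsin] at hd2
  generalize sgn w₁ = d₁ at *
  generalize sgn (-w₂) = d₂ at *
  set a₁ := entry Y.b11 i (i + 1)
  set a₂ := entry Y.b21 i (i + 1)
  set b₁ := entry Y.b12 i i
  set b₂ := entry Y.b22 i i
  have row1 : x₁ ^ 2 + a₁ ^ 2 + y₁ ^ 2 + b₁ ^ 2 = 1 := hY.row1
  have row2 : x₂ ^ 2 + a₂ ^ 2 + y₂ ^ 2 + b₂ ^ 2 = 1 := hY.row2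
  have rows : x₁ * x₂ + a₁ * a₂ + y₁ * y₂ + b₁ * b₂ = 0 := hY.rows
  have known : ∀ u v w w' : ℝ, u * e1 = Real.cos φ * w → v * e2 = Real.sin φ * w →
      ∀ u' v', u' * e1 = Real.cos φ * w' → v' * e2 = Real.sin φ * w' →
      u * u' + v * v' = w * w' := by
    intro u v w w' k1 k2 u' v' k3 k4
    linear_combination (-u * u') * he1 - v * v' * he2 + w * w' * hφ + (u' * e1) * k1 +
      (v' * e2) * k2 + Real.cos φ * w * k3 + Real.sin φ * w * k4
  have k11 := known _ _ _ _ ex₁ ey₁ _ _ ex₁ ey₁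
  have k22 := known _ _ _ _ ex₂ ey₂ _ _ ex₂ ey₂
  have k12 := known _ _ _ _ ex₁ ey₁ _ _ ex₂ ey₂
  have sθ : Real.sin θ ^ 2 = w₂ ^ 2 := by rw [hsin, sq_abs, neg_sq]
  have cθ : Real.cos θ ^ 2 = w₁ ^ 2 := by rw [hcos, sq_abs]
  obtain ⟨hz, ⟨ea₁, eb₁⟩, ea₂, eb₂⟩ := eq_mul_of_gram (c := Real.sin θ) (s := Real.cos θ)
    (x₁ := d₁ * a₁) (x₂ := d₁ * b₁) (y₁ := d₂ * a₂) (y₂ := d₂ * b₂) (Real.sin_sq_add_cos_sq θ)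
    (by linear_combination (a₁ ^ 2 + b₁ ^ 2) * hd1' + row1 - k11 - sθ - hw)
    (by linear_combination (a₂ ^ 2 + b₂ ^ 2) * hd2' + row2 - k22 - cθ - hw)
    (by
      rw [← hd1, ← hd2]
      linear_combination d₁ * d₂ * (rows - k12))
  rw [show -(Real.sin θ * (d₁ * a₁)) - Real.cos θ * (d₂ * a₂) =
    -(Real.sin θ * (d₁ * a₁) + Real.cos θ * (d₂ * a₂)) by ring]
  generalize Real.sin θ * (d₁ * a₁) + Real.cos θ * (d₂ * a₂) = z₁ at *
  generalize Real.sin θ * (d₁ * b₁) + Real.cos θ * (d₂ * b₂) = z₂ at *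
  obtain ⟨hψ, hcosψ, hsinψ⟩ := atan2_spec (abs_nonneg z₂) (abs_nonneg (-z₁))
    (by rw [sq_abs, sq_abs, neg_sq, add_comm, hz])
  have hf1 := sgn_mul_self (-z₁)
  have hf2 := sgn_mul_self z₂
  rw [← hsinψ] at hf1
  rw [← hcosψ] at hf2
  exact
    { θ_mem := hθ
      φ_mem := hψ
      d1_sign := hd1o
      d2_sign := hd2o
      e1_sign := sgn_eq_or _
      e2_sign := sgn_eq_or _
      b11_diag := by linear_combination d₁ * ex₁ + Real.cos φ * hd1
      b21_diag := by linear_combination d₂ * ex₂ - Real.cos φ * hd2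
      b12_prev := fun hi => by
        rw [hy₁, if_neg hi] at ey₁
        linear_combination d₁ * ey₁ + Real.sin φ * hd1
      b22_prev := fun hi => by
        rw [hy₂, if_neg hi] at ey₂
        linear_combination d₂ * ey₂ - Real.sin φ * hd2
      b11_next := by linear_combination sgn (-z₁) * ea₁ - Real.sin θ * hf1
      b21_next := by linear_combination sgn (-z₁) * ea₂ - Real.cos θ * hf1
      b12_diag := by linear_combination sgn z₂ * eb₁ + Real.sin θ * hf2
      b22_diag := by linear_combination sgn z₂ * eb₂ + Real.cos θ * hf2 }

/-- The round before round `i`, whose `φ`, `e1`, `e2` are the data with which round `i` starts. Its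
other components are of no importance if `i = 0`. -/
def prevRound (Y : Blocks n) (i : ℕ) : SignRound :=
  if i = 0 then ⟨0, 0, 1, 1, 1, 1⟩ else signRun Y (i - 1)

theorem signRun_eq (Y : Blocks n) (i : ℕ) : signRun Y i =
    signRound Y i (prevRound Y i).φ (prevRound Y i).e1 (prevRound Y i).e2 := by
  cases i <;> rfl

theorem signRun_isCorrect {Y : Blocks n} (hY : Y.IsBidiagonal) (ho : Y.IsColOrthogonal) :
    ∀ i, i < n → (signRun Y i).IsCorrect Y i (prevRound Y i).φ (prevRound Y i).e1
      (prevRound Y i).e2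
  | 0, hi => by
    have hE := hY.entryRelations ho hi
    have hl := hE.left
    simp only [if_true] at hl
    rw [signRun_eq]
    refine signRound_isCorrect hE (by simp [prevRound]) (by simp [prevRound])
      (fun _ => by simp [prevRound]) ?_ (fun h => absurd rfl h) fun h => absurd rfl h
    simp only [prevRound, if_true, Real.cos_zero]
    linear_combination hl
  | i + 1, hi => by
    have hE := hY.entryRelations ho hi
    have hE' := hY.entryRelations ho (show i < n by omega)
    have ih := signRun_isCorrect hY ho i (by omega)
    have e : prevRound Y (i + 1) = signRun Y i := rfl
    rw [signRun_eq, e]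
    generalize signRun Y i = r at *
    have sq_one : ∀ {x : ℝ}, x = 1 ∨ x = -1 → x ^ 2 = 1 := fun h => by
      rcases h with rfl | rfl <;> norm_num
    have f1 := sq_one ih.e1_sign
    have f2 := sq_one ih.e2_sign
    have g1 := sq_one ih.d1_sign
    have g2 := sq_one ih.d2_sign
    have hT := Real.sin_sq_add_cos_sq r.θ
    have hP := Real.sin_sq_add_cos_sq r.φ
    -- the entries of the rows `i`, expressed by the angles found there
    have solve : ∀ {d e x t : ℝ}, d ^ 2 = 1 → e ^ 2 = 1 → d * x * e = t → x = d * e * t :=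
      fun {d e x t} hd he h => by linear_combination (d * e) * h - x * e ^ 2 * hd - x * he
    have a1 := solve g1 f1 ih.b11_next
    have a2 := solve g2 f1 ih.b21_next
    have b1 := solve g1 f2 ih.b12_diag
    have b2 := solve g2 f2 ih.b22_diag
    have hl := hE.left
    have hr := hE'.right
    have hc := hE'.cols hi
    simp only [Nat.succ_ne_zero, if_false, Nat.add_sub_cancel] at hl
    rw [a1, a2] at hl hc
    rw [b1, b2] at hr hc
    refine signRound_isCorrect hE f1 f2 (fun h => absurd h (Nat.succ_ne_zero i)) ?_ (fun _ => ?_)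
      fun _ => ?_
    · linear_combination hl - (Real.sin r.θ * Real.sin r.φ) ^ 2 * (r.e1 ^ 2 * g1 + f1) -
        (Real.cos r.θ * Real.sin r.φ) ^ 2 * (r.e1 ^ 2 * g2 + f1) - Real.sin r.φ ^ 2 * hT - hP
    · rw [Nat.add_sub_cancel]
      linear_combination hr - (Real.sin r.θ * Real.cos r.φ) ^ 2 * (r.e2 ^ 2 * g1 + f2) -
        (Real.cos r.θ * Real.cos r.φ) ^ 2 * (r.e2 ^ 2 * g2 + f2) - Real.cos r.φ ^ 2 * hT - hP
    · rw [Nat.add_sub_cancel]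
      linear_combination r.e1 * r.e2 * hc +
        Real.sin r.θ ^ 2 * Real.sin r.φ * Real.cos r.φ *
          (r.e1 ^ 2 * r.e2 ^ 2 * g1 + r.e2 ^ 2 * f1 + f2) +
        Real.cos r.θ ^ 2 * Real.sin r.φ * Real.cos r.φ *
          (r.e1 ^ 2 * r.e2 ^ 2 * g2 + r.e2 ^ 2 * f1 + f2) + Real.sin r.φ * Real.cos r.φ * hT

/-- The angles `θ` that are read off from `Y`. -/
def signTheta (Y : Blocks n) (i : Fin n) : ℝ := (signRun Y i).θ

/-- The angles `φ` that are read off from `Y`. -/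
def signPhi (Y : Blocks n) (i : Fin (n - 1)) : ℝ := (signRun Y i).φ

variable {Y : Blocks n}

theorem anglesInRange_sign (hY : Y.IsBidiagonal) (ho : Y.IsColOrthogonal) :
    AnglesInRange (signTheta Y) (signPhi Y) :=
  ⟨fun i => (signRun_isCorrect hY ho i i.2).θ_mem,
    fun i => (signRun_isCorrect hY ho i (by omega)).φ_mem⟩

/-- In the last round the angle `φ` is zero. -/
theorem extAngle_signPhi (hY : Y.IsBidiagonal) (ho : Y.IsColOrthogonal) {i : ℕ} (hi : i < n) :
    extAngle (signPhi Y) i = (signRun Y i).φ := by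
  unfold extAngle
  split_ifs with h
  · rfl
  · have h := signRun_isCorrect hY ho i hi
    have h1 := h.b11_next
    have h2 := h.b21_next
    rw [entry_of_col_ge _ _ (by omega)] at h1 h2
    have h3 : Real.sin (signRun Y i).φ = 0 := by
      linear_combination Real.sin (signRun Y i).θ * h1 + Real.cos (signRun Y i).θ * h2 -
        Real.sin (signRun Y i).φ * Real.sin_sq_add_cos_sq (signRun Y i).θ
    have hπ := Real.pi_pos
    exact ((Real.sin_eq_zero_iff_of_lt_of_lt (by linarith [h.φ_mem.1])
      (by linarith [h.φ_mem.2])).mp h3).symm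

theorem prevCos_signPhi (hY : Y.IsBidiagonal) (ho : Y.IsColOrthogonal) {i : ℕ} (hi : i < n) :
    prevCos (signPhi Y) i = Real.cos (prevRound Y i).φ := by
  unfold prevCos prevRound
  split_ifs with h
  · simp
  · rw [extAngle_signPhi hY ho (by omega)]

theorem signE1_eq (Y : Blocks n) :
    signE1 Y = Matrix.diagonal fun i : Fin n => (prevRound Y i).e1 := by
  unfold signE1 prevRound
  congr
  ext i
  split_ifs <;> rfl

theorem diagonal_mul_mul_diagonal (d e : Fin n → ℝ) (M : Matrix (Fin n) (Fin n) ℝ) (i j : Fin n) :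
    (Matrix.diagonal d * M * Matrix.diagonal e) i j = d i * entry M i j * e j := by
  rw [Matrix.mul_diagonal, Matrix.diagonal_mul, entry_val]

/-- With the signs and the angles computed by the rounds, an orthogonal matrix with bidiagonal
blocks is brought to bidiagonal block form. -/
theorem bidiagonalBlocks_sign (hY : Y.IsBidiagonal) (ho : Y.IsColOrthogonal) :
    bidiagonalBlocks (signTheta Y) (signPhi Y) =
      ⟨signD1 Y * Y.b11 * signE1 Y, signD1 Y * Y.b12 * signE2 Y, signD2 Y * Y.b21 * signE1 Y,
        signD2 Y * Y.b22 * signE2 Y⟩ := by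
  have key := signRun_isCorrect hY ho
  have h12 : IsUpperBidiagonal Y.b12ᵀ := hY.b12
  have h22 : IsUpperBidiagonal Y.b22ᵀ := hY.b22
  rw [signE1_eq, signD1, signD2, signE2]
  unfold bidiagonalBlocks
  congr 1 <;> ext i j <;> rw [Matrix.of_apply, diagonal_mul_mul_diagonal] <;> symm
  · split_ifs with h1 h2
    · rw [h1, prevCos_signPhi hY ho i.2]
      exact (key i i.2).b11_diag
    · rw [h2, extAngle_signPhi hY ho i.2]
      exact (key i i.2).b11_next
    · rw [hY.b11.entry_eq_zero (by rwa [ne_eq, ← Fin.ext_iff]) h2, mul_zero, zero_mul]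
  · split_ifs with h1 h2
    · rw [h1, extAngle_signPhi hY ho i.2]
      exact (key i i.2).b12_diag
    · rw [extAngle_signPhi hY ho j.2]
      have h := (key i i.2).b12_prev (by omega)
      rwa [prevRound, if_neg (by omega), h2, Nat.add_sub_cancel, ← h2] at h
    · rw [← entry_transpose, h12.entry_eq_zero (by rwa [ne_eq, ← Fin.ext_iff, eq_comm]) h2,
        mul_zero, zero_mul]
  · split_ifs with h1 h2
    · rw [h1, prevCos_signPhi hY ho i.2]
      exact (key i i.2).b21_diag
    · rw [h2, extAngle_signPhi hY ho i.2]
      exact (key i i.2).b21_next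
    · rw [hY.b21.entry_eq_zero (by rwa [ne_eq, ← Fin.ext_iff]) h2, mul_zero, zero_mul]
  · split_ifs with h1 h2
    · rw [h1, extAngle_signPhi hY ho i.2]
      exact (key i i.2).b22_diag
    · rw [extAngle_signPhi hY ho j.2]
      have h := (key i i.2).b22_prev (by omega)
      rwa [prevRound, if_neg (by omega), h2, Nat.add_sub_cancel, ← h2] at h
    · rw [← entry_transpose, h22.entry_eq_zero (by rwa [ne_eq, ← Fin.ext_iff, eq_comm]) h2,
        mul_zero, zero_mul]

theorem isSignature_sign (hY : Y.IsBidiagonal) (ho : Y.IsColOrthogonal) :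
    IsSignature (signD1 Y) ∧ IsSignature (signD2 Y) ∧ IsSignature (signE1 Y) ∧
      IsSignature (signE2 Y) := by
  have key := signRun_isCorrect hY ho
  refine ⟨⟨_, fun i => (key i i.2).d1_sign, rfl⟩, ⟨_, fun i => (key i i.2).d2_sign, rfl⟩,
    ⟨_, fun i => ?_, signE1_eq Y⟩, ⟨_, fun i => (key i i.2).e2_sign, rfl⟩⟩
  unfold prevRound
  split_ifs with h
  · exact Or.inl rfl
  · exact (key _ (by omega)).e1_sign

theorem IsSignature.mem_orthogonalGroup {D : Matrix (Fin n) (Fin n) ℝ} (hD : IsSignature D) :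
    D ∈ Matrix.orthogonalGroup (Fin n) ℝ := by
  obtain ⟨d, hd, rfl⟩ := hD
  refine (Matrix.mem_orthogonalGroup_iff (Fin n) ℝ).mpr ?_
  rw [Matrix.diagonal_transpose, Matrix.diagonal_mul_diagonal, ← Matrix.diagonal_one]
  congr
  ext i
  rcases hd i with h | h <;> rw [h] <;> norm_num

end

/-! ### The CSD step on the active block -/

section

variable {n : ℕ} {μ ν : ℝ} {B : Blocks n} {s : CSDState n}

theorem stepProd_mem_orthogonalGroup (hn : 0 < n) (B : Matrix (Fin n) (Fin n) ℝ) (σ : ℝ) (e : ℕ) :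
    stepProd B σ e ∈ Matrix.orthogonalGroup (Fin n) ℝ :=
  rotProd_mem_orthogonalGroup (fun i => givensRot_norm isRotator_givensCS i) _ (by omega)

theorem stepProd_congr {B B' : Matrix (Fin n) (Fin n) ℝ} {σ σ' : ℝ} {e e' : ℕ}
    (h : ∀ i, i + 1 < n → stepRot (pathWeight B) σ e i = stepRot (pathWeight B') σ' e' i) :
    stepProd B σ e = stepProd B' σ' e' :=
  rotProd_congr _ fun i hi => h i (by omega)

theorem Blocks.toMatrix_conj (B : Blocks n) (P Q R S : Matrix (Fin n) (Fin n) ℝ) :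
    (Matrix.fromBlocks P 0 0 Q)ᵀ * B.toMatrix * Matrix.fromBlocks R 0 0 S =
      Blocks.toMatrix ⟨Pᵀ * B.b11 * R, Pᵀ * B.b12 * S, Qᵀ * B.b21 * R, Qᵀ * B.b22 * S⟩ := by
  simp [Blocks.toMatrix, Matrix.fromBlocks_transpose, Matrix.fromBlocks_multiply]

theorem fromBlocks_diag_mem_orthogonalGroup {P Q : Matrix (Fin n) (Fin n) ℝ}
    (hP : P ∈ Matrix.orthogonalGroup (Fin n) ℝ) (hQ : Q ∈ Matrix.orthogonalGroup (Fin n) ℝ) :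
    Matrix.fromBlocks P 0 0 Q * (Matrix.fromBlocks P 0 0 Q)ᵀ = 1 := by
  have h1 : P * Pᵀ = 1 := (Matrix.mem_orthogonalGroup_iff (Fin n) ℝ).mp hP
  have h2 : Q * Qᵀ = 1 := (Matrix.mem_orthogonalGroup_iff (Fin n) ℝ).mp hQ
  simp [Matrix.fromBlocks_transpose, Matrix.fromBlocks_multiply, h1, h2]

theorem CSDInv.toMatrix_eq {k l m : ℕ} (h : CSDInv μ ν B k l m s) : s.B.toMatrix =
    (Matrix.fromBlocks s.U1 0 0 s.U2)ᵀ * B.toMatrix * Matrix.fromBlocks s.V1 0 0 s.V2 := by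
  rw [Blocks.toMatrix_conj, ← h.eq11, ← h.eq12, ← h.eq21, ← h.eq22]

theorem CSDInv.orthogonal (hn : 0 < n) (h : CSDInv μ ν B (n - 1) (n - 1) (n - 1) s) :
    s.U1 ∈ Matrix.orthogonalGroup (Fin n) ℝ ∧ s.U2 ∈ Matrix.orthogonalGroup (Fin n) ℝ ∧
      s.V1 ∈ Matrix.orthogonalGroup (Fin n) ℝ ∧ s.V2 ∈ Matrix.orthogonalGroup (Fin n) ℝ := by
  rw [h.U1, h.U2, h.V1, h.V2]
  exact ⟨stepProd_mem_orthogonalGroup hn B.b11 μ 1, stepProd_mem_orthogonalGroup hn B.b21 ν 1,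
    stepProd_mem_orthogonalGroup hn B.b11 μ 0, stepProd_mem_orthogonalGroup hn B.b12ᵀ ν 1⟩

theorem CSDInv.isColOrthogonal (hn : 0 < n) (h : CSDInv μ ν B (n - 1) (n - 1) (n - 1) s)
    (ho : B.IsColOrthogonal) : s.B.IsColOrthogonal := by
  obtain ⟨hU1, hU2, hV1, hV2⟩ := h.orthogonal hn
  have hU := fromBlocks_diag_mem_orthogonalGroup hU1 hU2
  have hV := mul_eq_one_comm.mp (fromBlocks_diag_mem_orthogonalGroup hV1 hV2)
  have hB := B.isColOrthogonal_iff.mp ho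
  rw [Blocks.isColOrthogonal_iff, h.toMatrix_eq]
  generalize Matrix.fromBlocks s.U1 0 0 s.U2 = U at *
  generalize Matrix.fromBlocks s.V1 0 0 s.V2 = V at *
  calc (Uᵀ * B.toMatrix * V)ᵀ * (Uᵀ * B.toMatrix * V)
      = Vᵀ * (B.toMatrixᵀ * (U * Uᵀ) * B.toMatrix) * V := by
        simp only [Matrix.transpose_mul, Matrix.transpose_transpose, Matrix.mul_assoc]
    _ = 1 := by rw [hU, Matrix.mul_one, hB, Matrix.mul_one, hV]

/-- The simultaneous SVD steps, followed by the fixing of the signs, are a CSD step. -/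
theorem CSDInv.isCSDStep (hn : 0 < n) (h : CSDInv μ ν B (n - 1) (n - 1) (n - 1) s)
    (hB : IsBidiagonalBlockForm B) (hμ : 0 ≤ μ) (hν : 0 ≤ ν) (hs : μ ^ 2 + ν ^ 2 = 1) :
    IsCSDStep μ ν B (bidiagonalBlocks (signTheta s.B) (signPhi s.B)) s.U1 s.U2 s.V1 s.V2
      (signD1 s.B) (signD2 s.B) (signE1 s.B) (signE2 s.B) := by
  obtain ⟨hb, ho⟩ : B.IsBidiagonal ∧ B.IsColOrthogonal := by
    obtain ⟨θ, φ, -, rfl⟩ := hB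
    exact ⟨isBidiagonal_bidiagonalBlocks θ φ, isColOrthogonal_bidiagonalBlocks θ φ⟩
  have hY := h.isBidiagonal
  have hYo := h.isColOrthogonal hn ho
  have hR := hb.sharesRotations ho hs
  have U1 : s.U1 = stepProd B.b11 μ 1 := h.U1
  have U2 : s.U2 = stepProd B.b21 ν 1 := h.U2
  have V1 : s.V1 = stepProd B.b11 μ 0 := h.V1
  have V2 : s.V2 = stepProd B.b12ᵀ ν 1 := h.V2
  have U1' : s.U1 = stepProd B.b12ᵀ ν 0 := U1.trans (stepProd_congr hR.u1).symm
  have U2' : s.U2 = stepProd B.b22ᵀ μ 0 := U2.trans (stepProd_congr hR.u2).symm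
  have V1' : s.V1 = stepProd B.b21 ν 0 := V1.trans (stepProd_congr hR.v1).symm
  have V2' : s.V2 = stepProd B.b22ᵀ μ 1 := V2.trans (stepProd_congr hR.v2).symm
  refine ⟨hB, hμ, hν, hs, ?_, ?_, ?_, ?_, ?_, isSignature_sign hY hYo,
    _, _, anglesInRange_sign hY hYo, rfl⟩
  · rw [bidiagonalBlocks_sign hY hYo, Matrix.mul_assoc (Matrix.fromBlocks _ _ _ _),
      Matrix.mul_assoc (Matrix.fromBlocks _ _ _ _), ← h.toMatrix_eq]
    simp [Blocks.toMatrix, Matrix.fromBlocks_multiply]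
  · rw [U1, V1]
    exact hb.b11.isSVDStep hn hμ
  · rw [U2', V2']
    exact IsLowerBidiagonal.isSVDStep hb.b22 hn hμ
  · rw [U1', V2]
    exact IsLowerBidiagonal.isSVDStep hb.b12 hn hν
  · rw [U2, V1']
    exact hb.b21.isSVDStep hn hν

end

/-! ### The active block as a direct summand -/

section

variable {q : ℕ} {lo hi : Fin q}

theorem add_val_le (h : lo ≤ hi) (a : Fin (activeSize lo hi)) : (lo : ℕ) + a ≤ hi := by
  have h1 : (a : ℕ) < hi - lo + 1 := a.2
  rw [Fin.le_def] at h
  omega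

/-- The active indices come first, the others follow. -/
def activeEquiv (h : lo ≤ hi) : Fin (activeSize lo hi) ⊕ {i : Fin q // i ∉ Set.Icc lo hi} ≃ Fin q :=
  Equiv.ofBijective
    (Sum.elim (fun a => ⟨lo + a, (add_val_le h a).trans_lt hi.2⟩)
      Subtype.val) <| by
    constructor
    · rintro (a | ⟨i, hi'⟩) (b | ⟨j, hj⟩) hab
      · simp [Fin.ext_iff] at hab
        rw [Fin.ext hab]
      · refine absurd ?_ hj
        rw [← show _ = j from hab, Set.mem_Icc, Fin.le_def, Fin.le_def]
        exact ⟨Nat.le_add_right _ _, add_val_le h a⟩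
      · refine absurd ?_ hi'
        rw [show i = _ from hab, Set.mem_Icc, Fin.le_def, Fin.le_def]
        exact ⟨Nat.le_add_right _ _, add_val_le h b⟩
      · simp only [Sum.elim_inr] at hab
        simp only [hab]
    · intro i
      by_cases hi' : i ∈ Set.Icc lo hi
      · rw [Set.mem_Icc, Fin.le_def, Fin.le_def] at hi'
        refine ⟨Sum.inl ⟨i - lo, show (i : ℕ) - lo < hi - lo + 1 by omega⟩, ?_⟩
        · rw [Fin.ext_iff]
          simp only [Sum.elim_inl]
          omega
      · exact ⟨Sum.inr ⟨i, hi'⟩, rfl⟩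

theorem activeEquiv_inl (h : lo ≤ hi) (a : Fin (activeSize lo hi)) :
    (activeEquiv h (Sum.inl a) : ℕ) = lo + a := rfl

theorem activeEquiv_inr (h : lo ≤ hi) (i : {i : Fin q // i ∉ Set.Icc lo hi}) :
    activeEquiv h (Sum.inr i) = i := rfl

theorem activeEquiv_inl_mem (h : lo ≤ hi) (a : Fin (activeSize lo hi)) :
    activeEquiv h (Sum.inl a) ∈ Set.Icc lo hi := by
  rw [Set.mem_Icc, Fin.le_def, Fin.le_def, activeEquiv_inl]
  exact ⟨Nat.le_add_right _ _, add_val_le h a⟩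

theorem submatrix_embed (h : lo ≤ hi) (A : Matrix (Fin (activeSize lo hi)) _ ℝ) :
    (embed lo hi A).submatrix (activeEquiv h) (activeEquiv h) = Matrix.fromBlocks A 0 0 1 := by
  ext (a | i) (b | j) <;> simp only [Matrix.submatrix_apply, embed, Matrix.of_apply]
  · rw [if_pos ⟨activeEquiv_inl_mem h a, activeEquiv_inl_mem h b⟩, activeEquiv_inl,
      activeEquiv_inl, Nat.add_sub_cancel_left, Nat.add_sub_cancel_left, entry_val]
    rfl
  · rw [if_neg fun h' => j.2 h'.2, Matrix.one_apply_ne fun h' => by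
      simpa using (activeEquiv h).injective h']
    rfl
  · rw [if_neg fun h' => i.2 h'.1, Matrix.one_apply_ne fun h' => by
      simpa using (activeEquiv h).injective h']
    rfl
  · rw [if_neg fun h' => i.2 h'.1, activeEquiv_inr, activeEquiv_inr, Matrix.fromBlocks_apply₂₂]
    simp only [Matrix.one_apply, Subtype.ext_iff]

theorem Decoupled.submatrix {M : Matrix (Fin q) (Fin q) ℝ} (hM : Decoupled lo hi M) (h : lo ≤ hi) :
    M.submatrix (activeEquiv h) (activeEquiv h) =
      Matrix.fromBlocks (activePart lo hi M) 0 0 (M.submatrix Subtype.val Subtype.val) := by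
  ext (a | i) (b | j)
  · rw [Matrix.submatrix_apply, Matrix.fromBlocks_apply₁₁, activePart, Matrix.of_apply,
      ← activeEquiv_inl h, ← activeEquiv_inl h, entry_val]
  · exact hM _ _ fun h' => j.2 (h'.mp (activeEquiv_inl_mem h a))
  · exact hM _ _ fun h' => i.2 (h'.mpr (activeEquiv_inl_mem h b))
  · rfl

theorem embed_mem_orthogonalGroup (h : lo ≤ hi) {A : Matrix (Fin (activeSize lo hi)) _ ℝ}
    (hA : A ∈ Matrix.orthogonalGroup (Fin (activeSize lo hi)) ℝ) :
    embed lo hi A ∈ Matrix.orthogonalGroup (Fin q) ℝ := by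
  have hA' : A * Aᵀ = 1 := (Matrix.mem_orthogonalGroup_iff _ ℝ).mp hA
  have key : embed lo hi A * (embed lo hi A)ᵀ = 1 := by
    apply (Matrix.reindex (activeEquiv h).symm (activeEquiv h).symm).injective
    simp only [Matrix.reindex_apply, Equiv.symm_symm]
    rw [← Matrix.submatrix_mul_equiv _ _ _ (activeEquiv h), ← Matrix.transpose_submatrix,
      submatrix_embed, Matrix.fromBlocks_transpose, Matrix.fromBlocks_multiply,
      Matrix.submatrix_one_equiv]
    simp [hA']
  exact (Matrix.mem_orthogonalGroup_iff _ ℝ).mpr key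

/-- Orthogonal transformations of the active part of a decoupled matrix leave the rest alone. -/
theorem Decoupled.eq_conj_embed {M M' : Matrix (Fin q) (Fin q) ℝ} (hM : Decoupled lo hi M)
    (hM' : AgreeOutside lo hi M M') (h : lo ≤ hi) {S T : Matrix (Fin (activeSize lo hi)) _ ℝ}
    (hST : activePart lo hi M' = Sᵀ * activePart lo hi M * T) :
    M' = (embed lo hi S)ᵀ * M * embed lo hi T := by
  have hd : Decoupled lo hi M' := fun i j hij => by
    rw [hM' i j fun h' => hij ⟨fun _ => h'.2, fun _ => h'.1⟩, hM i j hij]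
  have hout : (M'.submatrix Subtype.val Subtype.val :
      Matrix {i : Fin q // i ∉ Set.Icc lo hi} {i : Fin q // i ∉ Set.Icc lo hi} ℝ) =
      M.submatrix Subtype.val Subtype.val := by
    ext i j
    exact hM' i j fun h' => i.2 h'.1
  apply (Matrix.reindex (activeEquiv h).symm (activeEquiv h).symm).injective
  simp only [Matrix.reindex_apply, Equiv.symm_symm]
  rw [← Matrix.submatrix_mul_equiv _ _ _ (activeEquiv h),
    ← Matrix.submatrix_mul_equiv _ _ _ (activeEquiv h), ← Matrix.transpose_submatrix,
    submatrix_embed, submatrix_embed, hM.submatrix, hd.submatrix, hout, hST,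
    Matrix.fromBlocks_transpose, Matrix.fromBlocks_multiply, Matrix.fromBlocks_multiply]
  simp

/-! ### The angles of the active block -/

/-- The angles `φ` at both ends of the active range are zero, so that nothing couples it to the
other indices. -/
structure IsCut (lo hi : Fin q) (φ : Fin (q - 1) → ℝ) : Prop where
  hi : extAngle φ hi = 0
  lo : (lo : ℕ) ≠ 0 → extAngle φ (lo - 1) = 0

theorem extAngle_mem {φ : Fin (q - 1) → ℝ} (hφ : ∀ i, φ i ∈ Set.Icc 0 (Real.pi / 2)) (k : ℕ) :
    extAngle φ k ∈ Set.Icc 0 (Real.pi / 2) := by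
  unfold extAngle
  split_ifs with h
  · exact hφ _
  · exact ⟨le_rfl, Real.pi_div_two_pos.le⟩

/-- If a bidiagonal block form is decoupled between the indices `k` and `k + 1`, then the angle `φ`
at `k` is zero. -/
theorem extAngle_eq_zero {θ : Fin q → ℝ} {φ : Fin (q - 1) → ℝ}
    (hφ : ∀ i, φ i ∈ Set.Icc 0 (Real.pi / 2)) {k : ℕ} (hk : k < q)
    (h1 : entry (bidiagonalBlocks θ φ).b11 k (k + 1) = 0)
    (h2 : entry (bidiagonalBlocks θ φ).b21 k (k + 1) = 0) : extAngle φ k = 0 := by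
  rw [entry_b11 θ φ hk, if_neg (by omega), if_pos rfl] at h1
  rw [entry_b21 θ φ hk, if_neg (by omega), if_pos rfl] at h2
  have h3 : Real.sin (extAngle φ k) = 0 := by
    linear_combination (-Real.sin (extTheta θ k)) * h1 - Real.cos (extTheta θ k) * h2 -
      Real.sin (extAngle φ k) * Real.sin_sq_add_cos_sq (extTheta θ k)
  have hπ := Real.pi_pos
  have hm := extAngle_mem hφ k
  exact (Real.sin_eq_zero_iff_of_lt_of_lt (by linarith [hm.1]) (by linarith [hm.2])).mp h3

theorem Decoupled.entry_eq_zero {M : Matrix (Fin q) (Fin q) ℝ} (hM : Decoupled lo hi M) {i j : ℕ}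
    (h : ¬ ((lo ≤ i ∧ i ≤ (hi : ℕ)) ↔ ((lo : ℕ) ≤ j ∧ j ≤ hi))) : entry M i j = 0 := by
  unfold entry
  split_ifs
  · exact hM _ _ h
  · rfl

theorem IsDeflatedAt.isCut (h : lo ≤ hi) {θ : Fin q → ℝ} {φ : Fin (q - 1) → ℝ}
    (hφ : ∀ i, φ i ∈ Set.Icc 0 (Real.pi / 2)) (hd : IsDeflatedAt lo hi (bidiagonalBlocks θ φ)) :
    IsCut lo hi φ := by
  rw [Fin.le_def] at h
  obtain ⟨d11, -, d21, -⟩ := hd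
  refine ⟨extAngle_eq_zero (θ := θ) hφ hi.2 (d11.entry_eq_zero (by omega))
    (d21.entry_eq_zero (by omega)), fun h0 => extAngle_eq_zero (θ := θ) hφ
    (show (lo : ℕ) - 1 < q by omega) (d11.entry_eq_zero (by omega)) (d21.entry_eq_zero (by omega))⟩

/-- The active blocks of a matrix in bidiagonal block form are again in this form, with the active
angles. -/
theorem IsCut.activeBlocks_eq (h : lo ≤ hi) (θ : Fin q → ℝ) {φ : Fin (q - 1) → ℝ}
    (hc : IsCut lo hi φ) : activeBlocks lo hi (bidiagonalBlocks θ φ) =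
      bidiagonalBlocks (fun a : Fin (activeSize lo hi) => extTheta θ (lo + a))
        (fun k : Fin (activeSize lo hi - 1) => extAngle φ (lo + k)) := by
  have hle : (lo : ℕ) ≤ hi := h
  have hsize : activeSize lo hi = hi - lo + 1 := rfl
  have hφ : ∀ k < activeSize lo hi,
      extAngle (fun k : Fin (activeSize lo hi - 1) => extAngle φ (lo + k)) k =
        extAngle φ (lo + k) := by
    intro k hk
    rw [extAngle]
    split_ifs with h'
    · rfl
    · rw [← hc.hi]
      congr 1
      omega
  have hp : ∀ k < activeSize lo hi,
      prevCos (fun k : Fin (activeSize lo hi - 1) => extAngle φ (lo + k)) k =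
        prevCos φ (lo + k) := by
    rintro (_ | k) hk
    · rw [prevCos, if_pos rfl, prevCos]
      split_ifs with h'
      · rfl
      · rw [Nat.add_zero] at h' ⊢
        rw [hc.lo h', Real.cos_zero]
    · rw [prevCos_succ, hφ k (by omega), ← Nat.add_assoc, prevCos_succ]
  generalize hφ' : (fun k : Fin (activeSize lo hi - 1) => extAngle φ (lo + k)) = φ' at *
  generalize hθ' : (fun a : Fin (activeSize lo hi) => extTheta θ (lo + a)) = θ'
  have hθ : ∀ a : Fin (activeSize lo hi), extTheta θ' a = extTheta θ (lo + a) := fun a => by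
    rw [extTheta_val, ← hθ']
  have e_b11 : activePart lo hi (bidiagonalBlocks θ φ).b11 = (bidiagonalBlocks θ' φ').b11 := by
    ext a b
    have ha := (add_val_le h a).trans_lt hi.2
    have hb := (add_val_le h b).trans_lt hi.2
    rw [activePart, Matrix.of_apply, ← entry_val (bidiagonalBlocks θ' φ').b11,
      entry_b11 θ φ ha, entry_b11 θ' φ' a.2, hφ a a.2,
      hp a a.2, hθ]
    simp only [Nat.add_left_cancel_iff, Nat.add_assoc]
  have e_b12 : activePart lo hi (bidiagonalBlocks θ φ).b12 = (bidiagonalBlocks θ' φ').b12 := by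
    ext a b
    have ha := (add_val_le h a).trans_lt hi.2
    have hb := (add_val_le h b).trans_lt hi.2
    rw [activePart, Matrix.of_apply, ← entry_val (bidiagonalBlocks θ' φ').b12,
      entry_b12 θ φ _ hb, entry_b12 θ' φ' _ b.2, hφ a a.2,
      hφ b b.2, hθ]
    simp only [Nat.add_left_cancel_iff, Nat.add_assoc]
  have e_b21 : activePart lo hi (bidiagonalBlocks θ φ).b21 = (bidiagonalBlocks θ' φ').b21 := by
    ext a b
    have ha := (add_val_le h a).trans_lt hi.2
    have hb := (add_val_le h b).trans_lt hi.2
    rw [activePart, Matrix.of_apply, ← entry_val (bidiagonalBlocks θ' φ').b21,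
      entry_b21 θ φ ha, entry_b21 θ' φ' a.2, hφ a a.2,
      hp a a.2, hθ]
    simp only [Nat.add_left_cancel_iff, Nat.add_assoc]
  have e_b22 : activePart lo hi (bidiagonalBlocks θ φ).b22 = (bidiagonalBlocks θ' φ').b22 := by
    ext a b
    have ha := (add_val_le h a).trans_lt hi.2
    have hb := (add_val_le h b).trans_lt hi.2
    rw [activePart, Matrix.of_apply, ← entry_val (bidiagonalBlocks θ' φ').b22,
      entry_b22 θ φ _ hb, entry_b22 θ' φ' _ b.2, hφ a a.2,
      hφ b b.2, hθ]
    simp only [Nat.add_left_cancel_iff, Nat.add_assoc]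
  rw [activeBlocks, e_b11, e_b12, e_b21, e_b22]

/-- Changing active angles changes active entries only. -/
theorem IsCut.agreeOutside {θ θ' : Fin q → ℝ} {φ φ' : Fin (q - 1) → ℝ} (hc : IsCut lo hi φ)
    (hθ : ∀ i, i ∉ Set.Icc lo hi → θ' i = θ i)
    (hφ : ∀ k, ¬ ((lo : ℕ) ≤ k ∧ k < hi) → extAngle φ' k = extAngle φ k) :
    AgreeOutside lo hi (bidiagonalBlocks θ φ).b11 (bidiagonalBlocks θ' φ').b11 ∧
    AgreeOutside lo hi (bidiagonalBlocks θ φ).b12 (bidiagonalBlocks θ' φ').b12 ∧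
    AgreeOutside lo hi (bidiagonalBlocks θ φ).b21 (bidiagonalBlocks θ' φ').b21 ∧
    AgreeOutside lo hi (bidiagonalBlocks θ φ).b22 (bidiagonalBlocks θ' φ').b22 := by
  have hθ' : ∀ i : Fin q, ¬ ((lo : ℕ) ≤ i ∧ (i : ℕ) ≤ hi) → θ' i = θ i := fun i hi' => hθ i hi'
  have hp : ∀ i : Fin q, ¬ ((lo : ℕ) ≤ i ∧ (i : ℕ) ≤ hi) → prevCos φ' i = prevCos φ i := by
    intro i hi'
    unfold prevCos
    split_ifs with h0
    · rfl
    · rw [hφ _ (by omega)]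
  -- between an active and an inactive index the sine vanishes
  have cross : ∀ i j : Fin q, (j : ℕ) = i + 1 →
      ¬ (((lo : ℕ) ≤ i ∧ (i : ℕ) ≤ hi) ∧ ((lo : ℕ) ≤ j ∧ (j : ℕ) ≤ hi)) →
      (Real.sin (extAngle φ' i) = 0 ∧ Real.sin (extAngle φ i) = 0) ∨
        (θ' i = θ i ∧ θ' j = θ j ∧ extAngle φ' i = extAngle φ i) := by
    intro i j hij hn
    by_cases h1 : (i : ℕ) = hi
    · left
      rw [hφ _ (by omega), h1, hc.hi, Real.sin_zero]
      exact ⟨rfl, rfl⟩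
    · by_cases h2 : (j : ℕ) = lo
      · left
        rw [hφ _ (by omega), show (i : ℕ) = lo - 1 by omega, hc.lo (by omega), Real.sin_zero]
        exact ⟨rfl, rfl⟩
      · exact Or.inr ⟨hθ' _ (by omega), hθ' _ (by omega), hφ _ (by omega)⟩
  refine ⟨?_, ?_, ?_, ?_⟩ <;> intro i j hn <;>
    rw [Set.mem_Icc, Set.mem_Icc, Fin.le_def, Fin.le_def, Fin.le_def, Fin.le_def] at hn <;>
    simp only [bidiagonalBlocks, Matrix.of_apply] <;> split_ifs with h1 h2
  · subst h1
    rw [hθ' _ (by omega), hp _ (by omega)]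
  · rcases cross i j h2 hn with ⟨h3, h4⟩ | ⟨h3, h4, h5⟩
    · rw [h3, h4, mul_zero, mul_zero]
    · rw [h3, h5]
  · rfl
  · subst h1
    rw [hθ' _ (by omega), hφ _ (by omega)]
  · rcases cross j i h2 (by omega) with ⟨h3, h4⟩ | ⟨h3, h4, h5⟩
    · rw [h3, h4, mul_zero, mul_zero]
    · rw [h4, h5]
  · rfl
  · subst h1
    rw [hθ' _ (by omega), hp _ (by omega)]
  · rcases cross i j h2 hn with ⟨h3, h4⟩ | ⟨h3, h4, h5⟩
    · rw [h3, h4, mul_zero, mul_zero]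
    · rw [h3, h5]
  · rfl
  · subst h1
    rw [hθ' _ (by omega), hφ _ (by omega)]
  · rcases cross j i h2 (by omega) with ⟨h3, h4⟩ | ⟨h3, h4, h5⟩
    · rw [h3, h4, mul_zero, mul_zero]
    · rw [h4, h5]
  · rfl

/-! ### The output of the algorithm -/

variable {bs : ℝ × ℝ → ℝ → ℝ × ℝ} {mg : ℝ × ℝ → ℝ × ℝ → ℝ × ℝ} {θ : Fin q → ℝ}
  {φ : Fin (q - 1) → ℝ} {μ ν : ℝ}

theorem csdStep_theta_of_notMem {i : Fin q} (h : i ∉ Set.Icc lo hi) :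
    (csdStep bs mg θ φ lo hi μ ν).θ i = θ i := if_neg h

theorem extAngle_csdStep_of_not {k : ℕ} (h : ¬ ((lo : ℕ) ≤ k ∧ k < hi)) :
    extAngle (csdStep bs mg θ φ lo hi μ ν).φ k = extAngle φ k := by
  unfold extAngle
  split_ifs
  · exact if_neg h
  · rfl

theorem IsCut.csdStep (hc : IsCut lo hi φ) : IsCut lo hi (csdStep bs mg θ φ lo hi μ ν).φ where
  hi := by rw [extAngle_csdStep_of_not (by omega), hc.hi]
  lo := fun h => by rw [extAngle_csdStep_of_not (by omega), hc.lo h]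

theorem IsCut.activeBlocks_csdStep (h : lo ≤ hi) (hc : IsCut lo hi φ) :
    activeBlocks lo hi (bidiagonalBlocks (CSD.csdStep bs mg θ φ lo hi μ ν).θ
      (CSD.csdStep bs mg θ φ lo hi μ ν).φ) =
    bidiagonalBlocks
      (signTheta (csdCore bs mg μ ν (activeBlocks lo hi (bidiagonalBlocks θ φ))).B)
      (signPhi (csdCore bs mg μ ν (activeBlocks lo hi (bidiagonalBlocks θ φ))).B) := by
  rw [hc.csdStep.activeBlocks_eq h]
  congr
  · ext a
    have h1 := add_val_le h a
    have h2 := h1.trans_lt hi.2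
    rw [extTheta, dif_pos h2, CSD.csdStep]
    dsimp only
    rw [if_pos (show (⟨lo + a, h2⟩ : Fin q) ∈ Set.Icc lo hi from activeEquiv_inl_mem h a),
      Nat.add_sub_cancel_left]
    rfl
  · ext k
    have h1 : (k : ℕ) < hi - lo + 1 - 1 := k.2
    have h2 := hi.2
    rw [extAngle, dif_pos (by omega), CSD.csdStep]
    dsimp only
    rw [if_pos (by omega), Nat.add_sub_cancel_left]
    rfl

theorem IsCut.isBidiagonalBlockForm (h : lo ≤ hi) (hc : IsCut lo hi φ) (ha : AnglesInRange θ φ) :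
    IsBidiagonalBlockForm (activeBlocks lo hi (bidiagonalBlocks θ φ)) := by
  refine ⟨_, _, ⟨fun a => ?_, fun k => extAngle_mem ha.2 _⟩, hc.activeBlocks_eq h θ⟩
  rw [extTheta, dif_pos ((add_val_le h a).trans_lt hi.2)]
  exact ha.1 _

theorem meetsSpecification (hbs : IsBulgeStart bs) (hmg : IsMerge mg) (ha : AnglesInRange θ φ)
    (hlohi : lo < hi) (hd : IsDeflatedAt lo hi (bidiagonalBlocks θ φ)) (hμ : 0 ≤ μ) (hν : 0 ≤ ν)
    (hs : μ ^ 2 + ν ^ 2 = 1) :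
    MeetsSpecification θ φ lo hi μ ν (csdStep bs mg θ φ lo hi μ ν) ∧
      MergedRotationsWellDefined bs mg μ ν (activeBlocks lo hi (bidiagonalBlocks θ φ)) := by
  have h := hlohi.le
  have hn : 2 ≤ activeSize lo hi := by
    rw [Fin.lt_def] at hlohi
    show 2 ≤ (hi : ℕ) - lo + 1
    omega
  have hn' : 0 < activeSize lo hi := by omega
  have hc := hd.isCut h ha.2
  have hA := hc.isBidiagonalBlockForm h ha
  have hact := hc.activeBlocks_csdStep (bs := bs) (mg := mg) (θ := θ) (μ := μ) (ν := ν) h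
  obtain ⟨hb, ho⟩ : (activeBlocks lo hi (bidiagonalBlocks θ φ)).IsBidiagonal ∧
      (activeBlocks lo hi (bidiagonalBlocks θ φ)).IsColOrthogonal := by
    rw [hc.activeBlocks_eq h]
    exact ⟨isBidiagonal_bidiagonalBlocks _ _, isColOrthogonal_bidiagonalBlocks _ _⟩
  have hR := hb.sharesRotations ho hs
  have hinv := csdCore_inv hn hb hR hbs hmg hμ hν
  refine ⟨?_, mergedRotationsWellDefined hn hb hR hbs hmg hμ hν⟩
  have hstep := hinv.isCSDStep hn' hA hμ hν hs
  have hY := hinv.isBidiagonal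
  have hYo := hinv.isColOrthogonal hn' ho
  have hsign := bidiagonalBlocks_sign hY hYo
  obtain ⟨oU1, oU2, oV1, oV2⟩ := hinv.orthogonal hn'
  obtain ⟨sD1, sD2, sE1, sE2⟩ := hstep.signs
  obtain ⟨a11, a12, a21, a22⟩ := hc.agreeOutside (θ := θ) (θ' := (csdStep bs mg θ φ lo hi μ ν).θ)
    (φ' := (csdStep bs mg θ φ lo hi μ ν).φ) (fun _ => csdStep_theta_of_notMem)
    fun _ => extAngle_csdStep_of_not
  obtain ⟨d11, d12, d21, d22⟩ := hd
  have symm_sign : ∀ {D : Matrix (Fin (activeSize lo hi)) (Fin (activeSize lo hi)) ℝ},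
      IsSignature D → Dᵀ = D := by
    rintro D ⟨d, -, rfl⟩
    exact Matrix.diagonal_transpose d
  have hblocks := hact.trans hsign
  rw [hinv.eq11, hinv.eq12, hinv.eq21, hinv.eq22] at hblocks
  have conj_eq : ∀ {S D T E M M' : Matrix (Fin (activeSize lo hi)) (Fin (activeSize lo hi)) ℝ},
      IsSignature D → M' = D * (Sᵀ * M * T) * E → M' = (S * D)ᵀ * M * (T * E) := by
    intro S D T E M M' hD hM
    rw [hM, Matrix.transpose_mul, symm_sign hD]
    simp only [Matrix.mul_assoc]
  refine ⟨?_, ⟨_, _, _, _, _, _, _, _, hact ▸ hstep, rfl, rfl, rfl, rfl⟩, a11, a12, a21, a22,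
    embed_mem_orthogonalGroup h (mul_mem oU1 sD1.mem_orthogonalGroup),
    embed_mem_orthogonalGroup h (mul_mem oU2 sD2.mem_orthogonalGroup),
    embed_mem_orthogonalGroup h (mul_mem oV1 sE1.mem_orthogonalGroup),
    embed_mem_orthogonalGroup h (mul_mem oV2 sE2.mem_orthogonalGroup), ?_⟩
  · have hr := signRun_isCorrect hY hYo
    constructor
    · intro i
      unfold csdStep
      dsimp only
      split_ifs with hi'
      · rw [Set.mem_Icc, Fin.le_def, Fin.le_def] at hi'
        exact (hr _ (show (i : ℕ) - lo < hi - lo + 1 by omega)).θ_mem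
      · exact ha.1 i
    · intro k
      unfold csdStep
      dsimp only
      split_ifs with hk
      · exact (hr _ (show (k : ℕ) - lo < hi - lo + 1 by omega)).φ_mem
      · exact ha.2 k
  · rw [Blocks.toMatrix_conj, Blocks.toMatrix, Blocks.toMatrix]
    congr 1
    · exact d11.eq_conj_embed a11 h (conj_eq sD1 (congrArg Blocks.b11 hblocks))
    · exact d12.eq_conj_embed a12 h (conj_eq sD1 (congrArg Blocks.b12 hblocks))
    · exact d21.eq_conj_embed a21 h (conj_eq sD2 (congrArg Blocks.b21 hblocks))
    · exact d22.eq_conj_embed a22 h (conj_eq sD2 (congrArg Blocks.b22 hblocks))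

end

end CSD

end

theorem mainTheorem2
    (bs : ℝ × ℝ → ℝ → ℝ × ℝ) (hbs : CSD.IsBulgeStart bs)
    (mg : ℝ × ℝ → ℝ × ℝ → ℝ × ℝ) (hmg : CSD.IsMerge mg)
    (q : ℕ) (θ : Fin q → ℝ) (φ : Fin (q - 1) → ℝ) (hangles : CSD.AnglesInRange θ φ)
    (lo hi : Fin q) (hlohi : lo < hi)
    (hdeflated : CSD.IsDeflatedAt lo hi (CSD.bidiagonalBlocks θ φ))
    (μ ν : ℝ) (hμ : μ ∈ Set.Icc (0 : ℝ) 1) (hν : ν ∈ Set.Icc (0 : ℝ) 1)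
    (hshifts : μ ^ 2 + ν ^ 2 = 1) :
    CSD.MeetsSpecification θ φ lo hi μ ν (CSD.csdStep bs mg θ φ lo hi μ ν) ∧
      CSD.MergedRotationsWellDefined bs mg μ ν
        (CSD.activeBlocks lo hi (CSD.bidiagonalBlocks θ φ)) :=
  CSD.meetsSpecification hbs hmg hangles hlohi hdeflated hμ.1 hν.1 hshifts
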